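/- Let $M$ be a smooth ($C^\infty$, Hausdorff, second countable, boundaryless) manifold of dimension $n$, and let $Z\subset M$ be an embedded hypersurface that is closed as a subset ($Z$ need not be coorientable; such a pair $(M,Z)$ is called a b-pair). Let $(W,s)$ be a b-divisor associated to $(M,Z)$, i.e. a smooth real line bundle $W\to M$ with a smooth section $s$ such that the ideal $s(\Gamma(W^*))\subset C^\infty(M)$ is the ideal of smooth functions vanishing on $Z$. Let $\mathcal A_Z\to M$ be the b-tangent bundle, i.e. the Lie algebroid whose sections are the vector fields on $M$ tangent to $Z$, with the Lie bracket of vector fields. Let $\pi: W^*\setminus M\to M$ be the projection from the complement of the zero section of $W^*$, and let $\varphi: W^*\setminus M\to\mathbb R$, $\varphi(e)=\langle s(\pi(e)),e\rangle$. Then $\ker d\varphi$ is the tangent bundle of a smooth codimension-one foliation $\mathcal F$ on $W^*\setminus M$, whose leaves are exactly the connected components of the level sets of $\varphi$, such that: 1. $\mathcal F$ is coorientable, and it is invariant under the fibrewise multiplication action of $\mathbb R^*$ on $W^*\setminus M$; 2. the connected components of $\pi^{-1}(Z)$ are leaves of $\mathcal F$; 3. every other leaf of $\mathcal F$ is diffeomorphic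 to a connected component of $M\setminus Z$; 4. there is a Lie algebroid submersion $\Psi:\mathcal F\to\mathcal A_Z$ covering $\pi$, i.e. a smooth, fibrewise surjective vector bundle morphism over the surjective submersion $\pi$ which is compatible with the brackets and satisfies $\rho\circ\Psi=d\pi|_{\mathcal F}$, where $\rho:\mathcal A_Z\to TM$ is the anchor. -/

import Mathlib

open scoped Manifold ContDiff Bundle Topology
open Set VectorField Bundle

universe u v

noncomputable section

namespace BGeometry

/-! ### Foliations and their leaves -/

section Foliations

variable {E : Type*} [NormedAddCommGroup E] [NormedSpace ℝ E] {H : Type*} [TopologicalSpace H]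

/-- A smooth foliation of rank `k`: an involutive smooth subbundle of rank `k` of the tangent
bundle. A vector field with values in the subbundle is only asked to be smooth on the open set
where it is used, so it represents an arbitrary local section. -/
structure Foliation (I : ModelWithCorners ℝ E H) (N : Type u) [TopologicalSpace N]
    [ChartedSpace H N] [IsManifold I ∞ N] (k : ℕ) where
  tangent : ∀ x : N, Submodule ℝ (TangentSpace I x)
  exists_frame : ∀ x : N, ∃ U : Set N, IsOpen U ∧ x ∈ U ∧
    ∃ X : Fin k → ∀ y : N, TangentSpace I y,
      (∀ i, ContMDiffOn I I.tangent ∞ (fun y => (⟨y, X i y⟩ : TangentBundle I N)) U) ∧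
      ∀ y ∈ U, LinearIndependent ℝ (fun i => X i y) ∧
        Submodule.span ℝ (range fun i => X i y) = tangent y
  involutive : ∀ (U : Set N) (X Y : ∀ y : N, TangentSpace I y), IsOpen U →
    (∀ y, X y ∈ tangent y) → (∀ y, Y y ∈ tangent y) →
    ContMDiffOn I I.tangent ∞ (fun y => (⟨y, X y⟩ : TangentBundle I N)) U →
    ContMDiffOn I I.tangent ∞ (fun y => (⟨y, Y y⟩ : TangentBundle I N)) U →
    ∀ y ∈ U, mlieBracket I X Y y ∈ tangent y

namespace Foliation

variable {I : ModelWithCorners ℝ E H} {N : Type u} [TopologicalSpace N] [ChartedSpace H N]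
  [IsManifold I ∞ N] {k : ℕ}

/-- A codimension-one foliation is coorientable if it is the kernel of a nowhere vanishing smooth
one-form, that is, if its normal line bundle is trivial. -/
def Coorientable (F : Foliation I N k) : Prop :=
  ∃ α : Cₛ^∞⟮I; E →L[ℝ] ℝ, fun x : N => TangentSpace I x →L[ℝ] Bundle.Trivial N ℝ x⟯,
    ∀ x, α x ≠ 0 ∧ ∀ w : TangentSpace I x, w ∈ F.tangent x ↔ α x w = 0

/-- Invariance of the foliation under a diffeomorphism `f`. -/
def InvariantUnder (F : Foliation I N k) (f : N → N) : Prop :=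
  ∀ x, (F.tangent x).map (mfderiv I I f x).toLinearMap = F.tangent (f x)

/-- A connected (immersed) integral manifold: an injectively immersed connected `k`-manifold whose
tangent spaces are those of the foliation. It is automatically Hausdorff if `N` is, and second
countable if `N` is. -/
structure IntegralManifold (F : Foliation I N k) where
  carrier : Type u
  [topology : TopologicalSpace carrier]
  [charted : ChartedSpace (EuclideanSpace ℝ (Fin k)) carrier]
  [manifold : IsManifold (𝓡 k) ∞ carrier]
  [connected : ConnectedSpace carrier]
  incl : carrier → N
  injective : Function.Injective incl
  smooth : ContMDiff (𝓡 k) I ∞ incl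
  immersive : ∀ p, Function.Injective (mfderiv (𝓡 k) I incl p)
  range_mfderiv : ∀ p, LinearMap.range (mfderiv (𝓡 k) I incl p).toLinearMap = F.tangent (incl p)

attribute [instance] IntegralManifold.topology IntegralManifold.charted
  IntegralManifold.manifold IntegralManifold.connected

/-- A leaf is a maximal connected integral manifold. -/
def IntegralManifold.IsLeaf {F : Foliation I N k} (L : F.IntegralManifold) : Prop :=
  ∀ K : F.IntegralManifold, range L.incl ⊆ range K.incl → range K.incl ⊆ range L.incl

/-- The subset `S` is (the underlying set of) a leaf. -/
def IsLeafSet (F : Foliation I N k) (S : Set N) : Prop :=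
  ∃ L : F.IntegralManifold, L.IsLeaf ∧ range L.incl = S

end Foliation

end Foliations

/-! ### Hypersurfaces and the vector fields tangent to them -/

section VectorFields

variable {n : ℕ} {M : Type u} [TopologicalSpace M] [ChartedSpace (EuclideanSpace ℝ (Fin n)) M]
  [IsManifold (𝓡 n) ∞ M]

/-- `(M, Z)` is a b-pair: `Z` is a closed subset and an embedded hypersurface of `M`, i.e. around
each of its points there is a chart in which it is the zero set of one of the coordinates. -/
structure IsBPair (n : ℕ) {M : Type u} [TopologicalSpace M]
    [ChartedSpace (EuclideanSpace ℝ (Fin n)) M] (Z : Set M) : Prop where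
  isClosed : IsClosed Z
  exists_chart : ∀ p ∈ Z, ∃ ψ ∈ IsManifold.maximalAtlas (𝓡 n) ∞ M, p ∈ ψ.source ∧
    ∃ i : Fin n, ∀ x ∈ ψ.source, x ∈ Z ↔ ψ x i = 0

/-- The smooth vector fields on `M`. -/
abbrev VectorFields (n : ℕ) (M : Type u) [TopologicalSpace M]
    [ChartedSpace (EuclideanSpace ℝ (Fin n)) M] [IsManifold (𝓡 n) ∞ M] : Type u :=
  Cₛ^∞⟮𝓡 n; EuclideanSpace ℝ (Fin n), (TangentSpace (𝓡 n) : M → Type)⟯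

/-- The space `T_x Z` of vectors at `x` annihilated by the differentials of all smooth functions
that vanish on `Z`. -/
def tangentTo (Z : Set M) (x : M) : Submodule ℝ (TangentSpace (𝓡 n) x) where
  carrier := {w | ∀ f : C^∞⟮𝓡 n, M; ℝ⟯, (∀ y ∈ Z, f y = 0) → mvfderiv (𝓡 n) f x w = 0}
  zero_mem' := fun f _ => map_zero _
  add_mem' := fun ha hb f hf => by rw [map_add, ha f hf, hb f hf, add_zero]
  smul_mem' := fun c w hw f hf => by rw [map_smul, hw f hf, smul_zero]

theorem contMDiff_lieDeriv (f : C^∞⟮𝓡 n, M; ℝ⟯)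
    (X : VectorFields n M) :
    ContMDiff (𝓡 n) 𝓘(ℝ, ℝ) ∞ (fun y : M => mvfderiv (𝓡 n) f y (X y)) := by
  have h1 : ContMDiff (𝓡 n).tangent (𝓘(ℝ, ℝ)).tangent ∞ (tangentMap (𝓡 n) 𝓘(ℝ, ℝ) f) :=
    f.contMDiff.contMDiff_tangentMap (by simp)
  have h2 := h1.comp X.contMDiff
  exact (contMDiff_snd_tangentBundle_modelSpace ℝ 𝓘(ℝ, ℝ)).comp h2

theorem mvfderiv_mlieBracket (f : C^∞⟮𝓡 n, M; ℝ⟯)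
    (X Y : VectorFields n M) (x : M) :
    mvfderiv (𝓡 n) f x (mlieBracket (𝓡 n) X Y x) =
      mvfderiv (𝓡 n) (fun y : M => mvfderiv (𝓡 n) f y (Y y)) x (X x) -
        mvfderiv (𝓡 n) (fun y : M => mvfderiv (𝓡 n) f y (X y)) x (Y x) := by
  set φ := extChartAt (𝓡 n) x with hφ
  -- the fields and the function read in the chart at `x`
  let P : (∀ y : M, TangentSpace (𝓡 n) y) → EuclideanSpace ℝ (Fin n) → EuclideanSpace ℝ (Fin n) :=
    fun V => mpullbackWithin 𝓘(ℝ, EuclideanSpace ℝ (Fin n)) (𝓡 n) φ.symm V (range (𝓡 n))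
  let g : EuclideanSpace ℝ (Fin n) → ℝ := f ∘ φ.symm
  have hbr : mlieBracket (𝓡 n) X Y x = lieBracket ℝ (P X) (P Y) (φ x) := by
    have key : ∀ T : EuclideanSpace ℝ (Fin n) →L[ℝ] EuclideanSpace ℝ (Fin n),
        T = ContinuousLinearMap.id ℝ _ → ∀ S : Set (EuclideanSpace ℝ (Fin n)), S = univ →
        T.inverse (lieBracketWithin ℝ (P X) (P Y) S (φ x)) = lieBracket ℝ (P X) (P Y) (φ x) := by
      rintro _ rfl _ rfl
      rw [ContinuousLinearMap.inverse_id, lieBracketWithin_univ]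
      rfl
    exact key _ (mfderiv_extChartAt_self (I := 𝓡 n) (x := x)) (φ.symm ⁻¹' univ ∩ range (𝓡 n))
      (by simp)
  have hmd : ∀ z, mfderivWithin (𝓡 n) (𝓡 n) φ.symm (range (𝓡 n)) z =
      mfderiv (𝓡 n) (𝓡 n) φ.symm z := by
    intro z
    have h1 : range (𝓡 n) = univ := by simp
    rw [h1, mfderivWithin_univ]
  have hxt : φ x ∈ φ.target := mem_extChartAt_target x
  have hto : IsOpen φ.target := isOpen_extChartAt_target x
  have hsymm : ∀ z ∈ φ.target, MDifferentiableAt 𝓘(ℝ, EuclideanSpace ℝ (Fin n)) (𝓡 n) φ.symm z :=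
    fun z hz => ((contMDiffOn_extChartAt_symm (n := ∞) x).contMDiffAt
      (hto.mem_nhds hz)).mdifferentiableAt (by simp)
  have hfd : ∀ y, MDifferentiableAt (𝓡 n) 𝓘(ℝ, ℝ) f y :=
    fun y => f.contMDiff.mdifferentiableAt (by simp)
  -- transfer of derivatives along the pulled back field
  have htr : ∀ (u : M → ℝ) (_ : ∀ y, MDifferentiableAt (𝓡 n) 𝓘(ℝ, ℝ) u y)
      (V : ∀ y : M, TangentSpace (𝓡 n) y), ∀ z ∈ φ.target,
      fderiv ℝ (u ∘ φ.symm) z (P V z) = mvfderiv (𝓡 n) u (φ.symm z) (V (φ.symm z)) := by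
    intro u hu V z hz
    have h1 : mfderiv 𝓘(ℝ, EuclideanSpace ℝ (Fin n)) 𝓘(ℝ, ℝ) (u ∘ φ.symm) z =
        (mfderiv (𝓡 n) 𝓘(ℝ, ℝ) u (φ.symm z)).comp
          (mfderiv 𝓘(ℝ, EuclideanSpace ℝ (Fin n)) (𝓡 n) φ.symm z) :=
      mfderiv_comp z (hu _) (hsymm z hz)
    have h2 : (mfderiv 𝓘(ℝ, EuclideanSpace ℝ (Fin n)) (𝓡 n) φ.symm z) (P V z) = V (φ.symm z) := by
      have hinv := isInvertible_mfderivWithin_extChartAt_symm (I := 𝓡 n) (x := x) hz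
      have h3 : P V z = (mfderiv 𝓘(ℝ, EuclideanSpace ℝ (Fin n)) (𝓡 n) φ.symm z).inverse
          (V (φ.symm z)) := by
        rw [← hmd]
        rfl
      rw [h3]
      obtain ⟨L, hL⟩ := hinv
      have hL' : mfderiv 𝓘(ℝ, EuclideanSpace ℝ (Fin n)) (𝓡 n) φ.symm z = L := by
        rw [hL]; exact (hmd z).symm
      rw [hL', ContinuousLinearMap.inverse_equiv]
      exact L.apply_symm_apply _
    have h4 : fderiv ℝ (u ∘ φ.symm) z (P V z) = mfderiv (𝓡 n) 𝓘(ℝ, ℝ) u (φ.symm z)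
        (mfderiv 𝓘(ℝ, EuclideanSpace ℝ (Fin n)) (𝓡 n) φ.symm z (P V z)) := by
      rw [← mfderiv_eq_fderiv, h1]
      rfl
    rw [h4, h2]
    rfl
  have hg : ContDiffAt ℝ ∞ g (φ x) := by
    rw [← contMDiffAt_iff_contDiffAt]
    exact ContMDiffAt.comp (φ x) f.contMDiff.contMDiffAt
      ((contMDiffOn_extChartAt_symm (n := ∞) x).contMDiffAt (hto.mem_nhds hxt))
  have hP : ∀ V : VectorFields n M,
      DifferentiableAt ℝ (P V) (φ x) := by
    intro V
    have hd : MDifferentiableWithinAt (𝓡 n) (𝓡 n).tangent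
        (fun y => (V y : TangentBundle (𝓡 n) M)) univ x :=
      (V.contMDiff.mdifferentiableAt (by simp)).mdifferentiableWithinAt
    have := hd.differentiableWithinAt_mpullbackWithin_vectorField
    have h1 : (extChartAt (𝓡 n) x).symm ⁻¹' univ ∩ range (𝓡 n) = univ := by simp
    rw [h1] at this
    exact differentiableWithinAt_univ.1 this
  have hx0 : φ.symm (φ x) = x := extChartAt_to_inv x
  have hmain := fderiv_apply_lieBracket hg (by simp; exact WithTop.coe_le_coe.2 le_top) (hP Y) (hP X)
  have hsec : ∀ V V' : VectorFields n M,
      fderiv ℝ (fun z => fderiv ℝ g z (P V z)) (φ x) (P V' (φ x)) =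
        mvfderiv (𝓡 n) (fun y : M => mvfderiv (𝓡 n) f y (V y)) x (V' x) := by
    intro V V'
    have he : (fun z => fderiv ℝ g z (P V z)) =ᶠ[𝓝 (φ x)]
        ((fun y : M => mvfderiv (𝓡 n) f y (V y)) ∘ φ.symm) := by
      filter_upwards [hto.mem_nhds hxt] with z hz using htr f hfd V z hz
    rw [he.fderiv_eq, htr _ (fun y => (contMDiff_lieDeriv f V).mdifferentiableAt (by simp)) V' _ hxt,
      hx0]
  rw [hsec Y X, hsec X Y] at hmain
  rw [← hmain, hbr]
  have h5 : mfderiv (𝓡 n) 𝓘(ℝ, ℝ) f x = mfderiv 𝓘(ℝ, EuclideanSpace ℝ (Fin n)) 𝓘(ℝ, ℝ) g (φ x) := by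
    have h6 : mfderiv 𝓘(ℝ, EuclideanSpace ℝ (Fin n)) (𝓡 n) φ.symm (φ x) =
        ContinuousLinearMap.id ℝ _ := by
      have := mfderivWithin_range_extChartAt_symm (I := 𝓡 n) (x := x)
      rw [← hmd]; exact this
    have h7 : mfderiv 𝓘(ℝ, EuclideanSpace ℝ (Fin n)) 𝓘(ℝ, ℝ) g (φ x) =
        (mfderiv (𝓡 n) 𝓘(ℝ, ℝ) f (φ.symm (φ x))).comp
          (mfderiv 𝓘(ℝ, EuclideanSpace ℝ (Fin n)) (𝓡 n) φ.symm (φ x)) :=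
      mfderiv_comp (φ x) (hfd _) (hsymm _ hxt)
    rw [h7, h6, hx0]
    rfl
  rw [← mfderiv_eq_fderiv, ← h5]
  rfl


/-- The sections of the b-tangent bundle: the vector fields on `M` that are tangent to `Z`. -/
def bFields (n : ℕ) {M : Type u} [TopologicalSpace M]
    [ChartedSpace (EuclideanSpace ℝ (Fin n)) M] [IsManifold (𝓡 n) ∞ M] (Z : Set M) :
    Submodule ℝ (VectorFields n M) where
  carrier := {X | ∀ x ∈ Z, X x ∈ tangentTo Z x}
  zero_mem' := fun x _ => (tangentTo Z x).zero_mem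
  add_mem' := fun ha hb x hx => (tangentTo Z x).add_mem (ha x hx) (hb x hx)
  smul_mem' := fun c _ hX x hx => (tangentTo Z x).smul_mem c (hX x hx)

/-- The Lie bracket of two smooth vector fields. -/
def fieldBracket (X Y : VectorFields n M) : VectorFields n M where
  toFun := mlieBracket (𝓡 n) X Y
  contMDiff_toFun := by
    have : IsManifold (𝓡 n) (((⊤ : ℕ∞) : WithTop ℕ∞) + 1) M := by
      simpa using (inferInstance : IsManifold (𝓡 n) ∞ M)
    have : IsManifold (𝓡 n) (minSmoothness ℝ 2) M := by
      rw [minSmoothness_of_isRCLikeNormedField]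
      exact IsManifold.of_le (n := ∞) (WithTop.coe_le_coe.2 le_top)
    exact ContDiff.mlieBracket_vectorField (m := ⊤) (n := ⊤) X.contMDiff Y.contMDiff (by simp)

/-- The bracket of the b-tangent bundle, which is the bracket of vector fields. -/
def bBracket {Z : Set M} (X Y : bFields n Z) : bFields n Z where
  val := fieldBracket X.1 Y.1
  property := by
    -- the derivative of a function vanishing on `Z` along a field tangent to `Z` vanishes on `Z`
    have h : ∀ (V V' : bFields n Z) (f : C^∞⟮𝓡 n, M; ℝ⟯), (∀ y ∈ Z, f y = 0) → ∀ x ∈ Z,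
        mvfderiv (𝓡 n) (fun y : M => mvfderiv (𝓡 n) f y (V.1 y)) x (V'.1 x) = 0 := by
      intro V V' f hf x hx
      exact V'.2 x hx ⟨fun y : M => mvfderiv (𝓡 n) f y (V.1 y), contMDiff_lieDeriv f V.1⟩
        fun y hy => V.2 y hy f hf
    intro x hx f hf
    change mvfderiv (𝓡 n) f x (mlieBracket (𝓡 n) X.1 Y.1 x) = 0
    rw [mvfderiv_mlieBracket, h Y X f hf x hx, h X Y f hf x hx, sub_zero]

/-! ### The b-tangent bundle

The module of vector fields tangent to a hypersurface `Z` is locally free, and the b-tangent bundle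
`A_Z` is the vector bundle that the Serre-Swan correspondence attaches to it: with `Γ` this module,
the fibre over `x` is `Γ / 𝔪_x Γ`, the value at `x` of a section `X ∈ Γ` is its class, and locally
every smooth section is a combination, with smooth coefficients, of such sections. -/

/-- The subspace `𝔪_x Γ` of the space `Γ` of vector fields tangent to `Z`, where `𝔪_x` is the ideal
of the smooth functions vanishing at `x`. -/
def vanishingAt (n : ℕ) {M : Type u} [TopologicalSpace M]
    [ChartedSpace (EuclideanSpace ℝ (Fin n)) M] [IsManifold (𝓡 n) ∞ M] (Z : Set M) (x : M) :
    Submodule ℝ (bFields n Z) :=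
  Submodule.span ℝ {Y | ∃ (f : C^∞⟮𝓡 n, M; ℝ⟯) (X : bFields n Z), f x = 0 ∧
    ∀ y, Y.1 y = f y • X.1 y}

/-- The fibre of the b-tangent bundle `A_Z` over `x`. -/
abbrev BTangent (n : ℕ) {M : Type u} [TopologicalSpace M]
    [ChartedSpace (EuclideanSpace ℝ (Fin n)) M] [IsManifold (𝓡 n) ∞ M] (Z : Set M) (x : M) :
    Type u :=
  bFields n Z ⧸ vanishingAt n Z x

/-- The value at `x` of a section of the b-tangent bundle. -/
def bEval {Z : Set M} (x : M) : bFields n Z →ₗ[ℝ] BTangent n Z x :=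
  (vanishingAt n Z x).mkQ

/-- The anchor `A_Z → TM` over the point `x`; it sends the value of a section at `x` to the value
of the corresponding vector field. -/
def bAnchor (Z : Set M) (x : M) : BTangent n Z x →ₗ[ℝ] TangentSpace (𝓡 n) x :=
  (vanishingAt n Z x).liftQ
    { toFun := fun X => X.1 x
      map_add' := fun _ _ => rfl
      map_smul' := fun _ _ => rfl }
    (Submodule.span_le.2 (by
      rintro Y ⟨f, X, hf, hY⟩
      change Y.1 x = 0
      rw [hY x, hf, zero_smul]))

/-- A section `σ` along `g : N → M` of the b-tangent bundle is smooth on the open set `U` if near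
each point of `U` it is a finite combination of sections of the b-tangent bundle with smooth
coefficients. -/
def SmoothAlong {E : Type*} [NormedAddCommGroup E] [NormedSpace ℝ E] {H : Type*}
    [TopologicalSpace H] (I : ModelWithCorners ℝ E H) {N : Type*} [TopologicalSpace N]
    [ChartedSpace H N] (Z : Set M) (g : N → M) (σ : ∀ e : N, BTangent n Z (g e)) (U : Set N) :
    Prop :=
  ∀ e₀ ∈ U, ∃ V : Set N, IsOpen V ∧ e₀ ∈ V ∧ ∃ (m : ℕ) (c : Fin m → N → ℝ)
    (X : Fin m → bFields n Z), (∀ i, ContMDiffOn I 𝓘(ℝ, ℝ) ∞ (c i) V) ∧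
      ∀ e ∈ V ∩ U, σ e = ∑ i, c i e • bEval (g e) (X i)

/-- A Lie algebroid submersion from (the Lie algebroid of) a foliation `F` on `N` to the b-tangent
bundle `A_Z`: a smooth vector bundle morphism `Ψ`, surjective on each fibre, lifting a surjective
submersion `pr : N → M` and compatible with the anchors and the brackets. As usual, for two sections
of `F` whose images are the combinations `∑ f_i (α_i ∘ pr)` and `∑ g_j (β_j ∘ pr)` of sections of
`A_Z`, compatibility with the brackets means that the image of their bracket is
`∑ f_i g_j ([α_i, β_j] ∘ pr) + ∑ Y₁(g_j) (β_j ∘ pr) - ∑ Y₂(f_i) (α_i ∘ pr)`. -/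
structure IsLieAlgebroidSubmersion {E : Type*} [NormedAddCommGroup E] [NormedSpace ℝ E]
    {H : Type*} [TopologicalSpace H] {I : ModelWithCorners ℝ E H} {N : Type*} [TopologicalSpace N]
    [ChartedSpace H N] [IsManifold I ∞ N] {k : ℕ} (F : Foliation I N k) (Z : Set M) (pr : N → M)
    (Ψ : ∀ e : N, F.tangent e →ₗ[ℝ] BTangent n Z (pr e)) : Prop where
  base_smooth : ContMDiff I (𝓡 n) ∞ pr
  base_surjective : Function.Surjective pr
  base_submersion : ∀ e, Function.Surjective (mfderiv I (𝓡 n) pr e)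
  smooth : ∀ (U : Set N) (Y : ∀ e : N, TangentSpace I e) (hY : ∀ e, Y e ∈ F.tangent e), IsOpen U →
    ContMDiffOn I I.tangent ∞ (fun e => (⟨e, Y e⟩ : TangentBundle I N)) U →
    SmoothAlong I Z pr (fun e => Ψ e ⟨Y e, hY e⟩) U
  surjective : ∀ e, Function.Surjective (Ψ e)
  anchor : ∀ e (w : F.tangent e), bAnchor Z (pr e) (Ψ e w) = mfderiv I (𝓡 n) pr e w.1
  bracket : ∀ (U : Set N) (hU : IsOpen U) (Y₁ Y₂ : ∀ e : N, TangentSpace I e)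
    (h₁ : ∀ e, Y₁ e ∈ F.tangent e) (h₂ : ∀ e, Y₂ e ∈ F.tangent e)
    (hs₁ : ContMDiffOn I I.tangent ∞ (fun e => (⟨e, Y₁ e⟩ : TangentBundle I N)) U)
    (hs₂ : ContMDiffOn I I.tangent ∞ (fun e => (⟨e, Y₂ e⟩ : TangentBundle I N)) U)
    (p q : ℕ) (f : Fin p → N → ℝ) (g : Fin q → N → ℝ)
    (α : Fin p → bFields n Z) (β : Fin q → bFields n Z),
    (∀ i, ContMDiffOn I 𝓘(ℝ, ℝ) ∞ (f i) U) → (∀ j, ContMDiffOn I 𝓘(ℝ, ℝ) ∞ (g j) U) →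
    (∀ e ∈ U, Ψ e ⟨Y₁ e, h₁ e⟩ = ∑ i, f i e • bEval (pr e) (α i)) →
    (∀ e ∈ U, Ψ e ⟨Y₂ e, h₂ e⟩ = ∑ j, g j e • bEval (pr e) (β j)) →
    ∀ (e : N) (he : e ∈ U),
      Ψ e ⟨mlieBracket I Y₁ Y₂ e, F.involutive U Y₁ Y₂ hU h₁ h₂ hs₁ hs₂ e he⟩ =
        (∑ i, ∑ j, (f i e * g j e) • bEval (pr e) (bBracket (α i) (β j))) +
        (∑ j, mvfderiv I (g j) e (Y₁ e) • bEval (pr e) (β j)) -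
        ∑ i, mvfderiv I (f i) e (Y₂ e) • bEval (pr e) (α i)

end VectorFields

/-! ### Line bundles, b-divisors and the complement of the zero section -/

section LineBundles

variable {n : ℕ} {M : Type u} [TopologicalSpace M] [ChartedSpace (EuclideanSpace ℝ (Fin n)) M]
  [IsManifold (𝓡 n) ∞ M]

/-- The fibres of the dual of a line bundle `W`. -/
abbrev DualFiber {M : Type u} (W : M → Type v) [∀ x, AddCommGroup (W x)] [∀ x, Module ℝ (W x)]
    [∀ x, TopologicalSpace (W x)] (x : M) : Type v :=
  W x →L[ℝ] Bundle.Trivial M ℝ x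

variable (W : M → Type v) [∀ x, AddCommGroup (W x)] [∀ x, Module ℝ (W x)]
  [∀ x, TopologicalSpace (W x)] [TopologicalSpace (TotalSpace ℝ W)] [FiberBundle ℝ W]
  [VectorBundle ℝ ℝ W]

/-- `(W, s)` is a b-divisor associated to `(M, Z)`: the ideal `s(Γ(W^*))` of `C^∞(M)` is the
vanishing ideal of `Z`. -/
def IsBDivisor {W : M → Type v} [∀ x, AddCommGroup (W x)] [∀ x, Module ℝ (W x)]
    [∀ x, TopologicalSpace (W x)] [TopologicalSpace (TotalSpace ℝ W)] [FiberBundle ℝ W]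
    [VectorBundle ℝ ℝ W] [ContMDiffVectorBundle ∞ ℝ W (𝓡 n)] (Z : Set M)
    (s : Cₛ^∞⟮𝓡 n; ℝ, W⟯) : Prop :=
  ∀ f : C^∞⟮𝓡 n, M; ℝ⟯,
    (∃ η : Cₛ^∞⟮𝓡 n; ℝ →L[ℝ] ℝ, DualFiber W⟯, ∀ x, f x = η x (s x)) ↔ ∀ x ∈ Z, f x = 0

theorem isOpen_dual_ne_zero :
    IsOpen {e : TotalSpace (ℝ →L[ℝ] ℝ) (DualFiber W) | e.2 ≠ 0} := by
  rw [isOpen_iff_mem_nhds]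
  intro e he
  set t := trivializationAt (ℝ →L[ℝ] ℝ) (DualFiber W) e.proj
  have hb : e.proj ∈ t.baseSet := mem_baseSet_trivializationAt ..
  have key : ∀ e' ∈ t.source, ((t e').2 ≠ 0 ↔ e'.2 ≠ 0) := by
    intro e' he'
    have hb' : e'.proj ∈ t.baseSet := by simpa [t.mem_source] using he'
    have h2 : (t e').2 = t.continuousLinearEquivAt ℝ e'.proj hb' e'.2 := rfl
    rw [h2]; exact (t.continuousLinearEquivAt ℝ e'.proj hb').map_eq_zero_iff.not
  have hs : e ∈ t.source := t.mem_source.2 hb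
  have h1 : ContinuousAt (fun e' => (t e').2) e := (t.continuousAt hs).snd
  filter_upwards [h1.eventually_ne ((key e hs).2 he), t.open_source.mem_nhds hs] with e' h3 h4
  exact (key e' h4).1 h3

/-- The complement `W^* ∖ M` of the zero section, an open submanifold of the total space of `W^*`. -/
def puncturedDual : TopologicalSpace.Opens (TotalSpace (ℝ →L[ℝ] ℝ) (DualFiber W)) :=
  ⟨{e | e.2 ≠ 0}, isOpen_dual_ne_zero W⟩

/-- The model with corners of the total space of `W^*`. -/
abbrev dualModel (n : ℕ) := (𝓡 n).prod 𝓘(ℝ, ℝ →L[ℝ] ℝ)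

variable {W}

/-- The projection `π : W^* ∖ M → M`. -/
def proj (e : puncturedDual W) : M := e.1.1

/-- The function `φ(e) = ⟨s(π(e)), e⟩`. -/
def pairing [ContMDiffVectorBundle ∞ ℝ W (𝓡 n)] (s : Cₛ^∞⟮𝓡 n; ℝ, W⟯) (e : puncturedDual W) : ℝ :=
  e.1.2 (s e.1.1)

/-- The fibrewise multiplication by `t ∈ ℝ^*`. -/
def scale (t : ℝˣ) (e : puncturedDual W) : puncturedDual W :=
  ⟨⟨e.1.1, (t : ℝ) • e.1.2⟩, smul_ne_zero t.ne_zero e.2⟩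

end LineBundles

end BGeometry

end

/-! Everything follows from one local normal form. A local equation `r` of `Z` (a coordinate near a
point of `Z`, the constant `1` away from `Z`) lies, after a cutoff, in the vanishing ideal, so `r =
⟨s, η⟩` near the point for some section `η` of the dual bundle. This `η` cannot vanish at the point:
over `Z` it would make `r` a product of two functions vanishing there, against `dr ≠ 0`; off `Z`, `r
= 1`. Hence `η` is a local frame, a covector is `t • η` with `t ≠ 0`, and `φ = t * r`. This is
`BChart`, produced by `exists_bChart`; the later arguments use only the projection and `φ` in this
form.

Since `t ≠ 0`, the map `(y i, t) ↦ (t, t * y i)` is a diffeomorphism onto its image, so `φ` is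
locally a coordinate, even over `Z`. Thus `ker dφ` is an involutive subbundle, coorientable by `dφ`,
and its leaves are the components of the level sets (`levelFoliation_isLeafSet_iff`). Scaling by `t`
multiplies `φ` by `t`, so it preserves the kernel. The zero level is the preimage of `Z`. A level `c
≠ 0` meets each fibre off `Z` exactly once, at `t = c / r`, so a leaf there projects by a bijective
local diffeomorphism onto a component of the complement (`exists_leaf_diffeomorph`).

On `ker dφ` with `r = y i` one has `dy i = -(dt / t) * y i`. So the projection of a vector of the
foliation is a combination of the frame `∂_k` (`k ≠ i`), `y i ∂_i` of the b-tangent bundle, with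
smooth coefficients `dy k` and `-dt / t`; these coefficients define `Ψ`. Independence of the frame
and bracket compatibility both come from `sum_bEval_eq_zero`: off `Z` the anchor determines the
coefficients in the frame, and the preimage of the complement of `Z` is dense because `dφ` never
vanishes. -/

set_option linter.unusedSectionVars false

noncomputable section

namespace BGeometry

/-! ### Smoothness of derivatives of functions along vector fields. -/

section Calculus

variable {E : Type*} [NormedAddCommGroup E] [NormedSpace ℝ E] {H : Type*} [TopologicalSpace H]
  {I : ModelWithCorners ℝ E H} {N : Type*} [TopologicalSpace N] [ChartedSpace H N]
  [IsManifold I ∞ N]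

/-- The derivative of a smooth function along a smooth vector field is smooth. -/
theorem contMDiffAt_mvfderiv_apply {F : Type*} [NormedAddCommGroup F] [NormedSpace ℝ F]
    {f : N → F} {Y : ∀ y : N, TangentSpace I y} {x : N}
    (hf : ContMDiffAt I 𝓘(ℝ, F) ∞ f x)
    (hY : ContMDiffAt I I.tangent ∞ (fun y => (⟨y, Y y⟩ : TangentBundle I N)) x) :
    ContMDiffAt I 𝓘(ℝ, F) ∞ (fun y => mvfderiv I f y (Y y)) x := by
  have h1 := hf.mfderiv_const (m := ∞) (by simp)
  have h2 : ContMDiffAt I (𝓘(ℝ, F)).tangent ∞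
      (fun y => (⟨f y, mfderiv I 𝓘(ℝ, F) f y (Y y)⟩ : TangentBundle 𝓘(ℝ, F) F)) x :=
    ContMDiffAt.clm_apply_of_inCoordinates h1 hY hf
  exact (contMDiff_snd_tangentBundle_modelSpace F 𝓘(ℝ, F)).contMDiffAt.comp x h2

/-- The differential of a smooth function as a section of the cotangent bundle. -/
theorem contMDiff_mvfderiv {f : N → ℝ} (hf : ContMDiff I 𝓘(ℝ, ℝ) ∞ f) :
    ContMDiff I (I.prod 𝓘(ℝ, E →L[ℝ] ℝ)) ∞ (fun x => TotalSpace.mk' (E →L[ℝ] ℝ)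
      (E := fun x : N => TangentSpace I x →L[ℝ] Bundle.Trivial N ℝ x) x (mvfderiv I f x)) := by
  intro x
  rw [contMDiffAt_hom_bundle]
  refine ⟨contMDiffAt_id, ?_⟩
  have h1 := hf.contMDiffAt.mfderiv_const (x₀ := x) (m := ∞) (by simp)
  refine h1.congr_of_eventuallyEq (Filter.Eventually.of_forall fun y => ?_)
  ext w
  simp [inTangentCoordinates, ContinuousLinearMap.inCoordinates]
  rfl

end Calculus

/-! ### The Lie bracket as a commutator, for fields smooth only near a point. -/

section Bracket

variable {E : Type*} [NormedAddCommGroup E] [NormedSpace ℝ E] [CompleteSpace E] {H : Type*}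
  [TopologicalSpace H] {I : ModelWithCorners ℝ E H} [I.Boundaryless] {N : Type*}
  [TopologicalSpace N] [ChartedSpace H N] [IsManifold I ∞ N]

/-- The bracket of two vector fields acts on functions as the commutator of the derivations. -/
theorem mvfderiv_mlieBracket_apply {f : N → ℝ} (hf : ContMDiff I 𝓘(ℝ, ℝ) ∞ f)
    {X Y : ∀ y : N, TangentSpace I y} {x : N}
    (hX : ContMDiffAt I I.tangent ∞ (fun y => (⟨y, X y⟩ : TangentBundle I N)) x)
    (hY : ContMDiffAt I I.tangent ∞ (fun y => (⟨y, Y y⟩ : TangentBundle I N)) x) :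
    mvfderiv I f x (mlieBracket I X Y x) =
      mvfderiv I (fun y => mvfderiv I f y (Y y)) x (X x) -
        mvfderiv I (fun y => mvfderiv I f y (X y)) x (Y x) := by
  set φ := extChartAt I x with hφ
  have hrange : range I = univ := ModelWithCorners.range_eq_univ I
  let P : (∀ y : N, TangentSpace I y) → E → E :=
    fun V => mpullbackWithin 𝓘(ℝ, E) I φ.symm V (range I)
  let g : E → ℝ := f ∘ φ.symm
  have hbr : mlieBracket I X Y x = lieBracket ℝ (P X) (P Y) (φ x) := by
    -- The chart at `x` has identity differential at `x` in the tangent coordinates based there, so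
    -- the bracket at `x` is the bracket of the fields read in the chart.
    have key : ∀ T : E →L[ℝ] E, T = ContinuousLinearMap.id ℝ _ → ∀ S : Set E, S = univ →
        T.inverse (lieBracketWithin ℝ (P X) (P Y) S (φ x)) = lieBracket ℝ (P X) (P Y) (φ x) := by
      rintro _ rfl _ rfl
      rw [ContinuousLinearMap.inverse_id, lieBracketWithin_univ]
      rfl
    exact key _ (mfderiv_extChartAt_self (I := I) (x := x)) (φ.symm ⁻¹' univ ∩ range I)
      (by simp [hrange])
  have hmd : ∀ z, mfderivWithin 𝓘(ℝ, E) I φ.symm (range I) z = mfderiv 𝓘(ℝ, E) I φ.symm z := by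
    intro z
    rw [hrange, mfderivWithin_univ]
  have hxt : φ x ∈ φ.target := mem_extChartAt_target x
  have hto : IsOpen φ.target := isOpen_extChartAt_target x
  have hsymm : ∀ z ∈ φ.target, MDifferentiableAt 𝓘(ℝ, E) I φ.symm z :=
    fun z hz => ((contMDiffOn_extChartAt_symm (n := ∞) x).contMDiffAt
      (hto.mem_nhds hz)).mdifferentiableAt (by simp)
  have hfd : ∀ y, MDifferentiableAt I 𝓘(ℝ, ℝ) f y :=
    fun y => hf.mdifferentiable (by simp) y
  have htr : ∀ (V : ∀ y : N, TangentSpace I y) (u : N → ℝ), ∀ z ∈ φ.target,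
      MDifferentiableAt I 𝓘(ℝ, ℝ) u (φ.symm z) →
      fderiv ℝ (u ∘ φ.symm) z (P V z) = mvfderiv I u (φ.symm z) (V (φ.symm z)) := by
    intro V u z hz hu
    have h1 : mfderiv 𝓘(ℝ, E) 𝓘(ℝ, ℝ) (u ∘ φ.symm) z =
        (mfderiv I 𝓘(ℝ, ℝ) u (φ.symm z)).comp (mfderiv 𝓘(ℝ, E) I φ.symm z) :=
      mfderiv_comp z hu (hsymm z hz)
    have h2 : (mfderiv 𝓘(ℝ, E) I φ.symm z) (P V z) = V (φ.symm z) := by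
      have hinv := isInvertible_mfderivWithin_extChartAt_symm (I := I) (x := x) hz
      have h3 : P V z = (mfderiv 𝓘(ℝ, E) I φ.symm z).inverse (V (φ.symm z)) := by
        rw [← hmd]
        rfl
      rw [h3]
      obtain ⟨L, hL⟩ := hinv
      have hL' : mfderiv 𝓘(ℝ, E) I φ.symm z = L := by
        rw [hL]; exact (hmd z).symm
      rw [hL', ContinuousLinearMap.inverse_equiv]
      exact L.apply_symm_apply _
    have h4 : fderiv ℝ (u ∘ φ.symm) z (P V z) = mfderiv I 𝓘(ℝ, ℝ) u (φ.symm z)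
        (mfderiv 𝓘(ℝ, E) I φ.symm z (P V z)) := by
      rw [← mfderiv_eq_fderiv, h1]
      rfl
    rw [h4, h2]
    rfl
  have hg : ContDiffAt ℝ ∞ g (φ x) := by
    rw [← contMDiffAt_iff_contDiffAt]
    exact ContMDiffAt.comp (φ x) hf.contMDiffAt
      ((contMDiffOn_extChartAt_symm (n := ∞) x).contMDiffAt (hto.mem_nhds hxt))
  have hP : ∀ V : ∀ y : N, TangentSpace I y,
      ContMDiffAt I I.tangent ∞ (fun y => (⟨y, V y⟩ : TangentBundle I N)) x →
      DifferentiableAt ℝ (P V) (φ x) := by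
    intro V hV
    have hd : MDifferentiableWithinAt I I.tangent
        (fun y => (V y : TangentBundle I N)) univ x :=
      (hV.mdifferentiableAt (by simp)).mdifferentiableWithinAt
    have := hd.differentiableWithinAt_mpullbackWithin_vectorField
    have h1 : (extChartAt I x).symm ⁻¹' univ ∩ range I = univ := by simp [hrange]
    rw [h1] at this
    exact differentiableWithinAt_univ.1 this
  have hx0 : φ.symm (φ x) = x := extChartAt_to_inv x
  have hmain := fderiv_apply_lieBracket hg (by simp; exact WithTop.coe_le_coe.2 le_top)
    (hP Y hY) (hP X hX)
  have hsec : ∀ V V' : ∀ y : N, TangentSpace I y,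
      ContMDiffAt I I.tangent ∞ (fun y => (⟨y, V y⟩ : TangentBundle I N)) x →
      fderiv ℝ (fun z => fderiv ℝ g z (P V z)) (φ x) (P V' (φ x)) =
        mvfderiv I (fun y => mvfderiv I f y (V y)) x (V' x) := by
    intro V V' hV
    have he : (fun z => fderiv ℝ g z (P V z)) =ᶠ[𝓝 (φ x)]
        ((fun y => mvfderiv I f y (V y)) ∘ φ.symm) := by
      filter_upwards [hto.mem_nhds hxt] with z hz using htr V f z hz (hfd _)
    have hd : MDifferentiableAt I 𝓘(ℝ, ℝ) (fun y => mvfderiv I f y (V y)) (φ.symm (φ x)) := by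
      rw [hx0]
      exact (contMDiffAt_mvfderiv_apply hf.contMDiffAt hV).mdifferentiableAt (by simp)
    rw [he.fderiv_eq, htr V' _ _ hxt hd, hx0]
  rw [hsec Y X hY, hsec X Y hX] at hmain
  rw [← hmain, hbr]
  have h5 : mfderiv I 𝓘(ℝ, ℝ) f x = mfderiv 𝓘(ℝ, E) 𝓘(ℝ, ℝ) g (φ x) := by
    have h6 : mfderiv 𝓘(ℝ, E) I φ.symm (φ x) = ContinuousLinearMap.id ℝ _ := by
      have := mfderivWithin_range_extChartAt_symm (I := I) (x := x)
      rw [← hmd]; exact this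
    have h7 : mfderiv 𝓘(ℝ, E) 𝓘(ℝ, ℝ) g (φ x) =
        (mfderiv I 𝓘(ℝ, ℝ) f (φ.symm (φ x))).comp (mfderiv 𝓘(ℝ, E) I φ.symm (φ x)) :=
      mfderiv_comp (φ x) (hfd _) (hsymm _ hxt)
    rw [h7, h6, hx0]
    rfl
  rw [← mfderiv_eq_fderiv, ← h5]
  rfl

end Bracket

/-! ### Functions with zero differential on connected manifolds. -/

section Constant

variable {E : Type*} [NormedAddCommGroup E] [NormedSpace ℝ E] {H : Type*} [TopologicalSpace H]
  {I : ModelWithCorners ℝ E H} [I.Boundaryless] {N : Type*} [TopologicalSpace N] [ChartedSpace H N]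
  [IsManifold I ∞ N]

/-- A function with vanishing differential on a connected manifold is constant. -/
theorem eq_of_mfderiv_eq_zero [PreconnectedSpace N] {f : N → ℝ}
    (hf : ContMDiff I 𝓘(ℝ, ℝ) ∞ f) (h0 : ∀ x, mfderiv I 𝓘(ℝ, ℝ) f x = 0) (x y : N) :
    f x = f y := by
  refine IsLocallyConstant.apply_eq_of_preconnectedSpace ?_ x y
  rw [IsLocallyConstant.iff_eventually_eq]
  intro p
  set φ := extChartAt I p
  have hto : IsOpen φ.target := isOpen_extChartAt_target p
  obtain ⟨ε, hε, hball⟩ := Metric.isOpen_iff.1 hto (φ p) (mem_extChartAt_target p)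
  have hd : ∀ z ∈ φ.target, HasFDerivAt (f ∘ φ.symm) (0 : E →L[ℝ] ℝ) z := by
    intro z hz
    have h1 : MDifferentiableAt 𝓘(ℝ, E) I φ.symm z :=
      ((contMDiffOn_extChartAt_symm (n := ∞) p).contMDiffAt (hto.mem_nhds hz)).mdifferentiableAt
        (by simp)
    have h2 := (hf.mdifferentiable (by simp) (φ.symm z)).hasMFDerivAt.comp z h1.hasMFDerivAt
    rw [h0] at h2
    have h3 := h2.hasFDerivAt
    convert! h3 using 1
  -- Balls are convex, so the mean value inequality makes the function constant on a chart ball;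
  -- connectedness then spreads local constancy.
  have hc : ∀ z ∈ Metric.ball (φ p) ε, (f ∘ φ.symm) z = (f ∘ φ.symm) (φ p) := by
    intro z hz
    refine (convex_ball (φ p) ε).is_const_of_fderivWithin_eq_zero (𝕜 := ℝ)
      (fun w hw => (hd w (hball hw)).differentiableAt.differentiableWithinAt)
      (fun w hw => ?_) hz (Metric.mem_ball_self hε)
    rw [fderivWithin_of_isOpen Metric.isOpen_ball hw, (hd w (hball hw)).fderiv]
  have hcont : ContinuousAt φ p := continuousAt_extChartAt p
  filter_upwards [hcont.preimage_mem_nhds (Metric.ball_mem_nhds _ hε),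
    extChartAt_source_mem_nhds (I := I) p] with q hq hq'
  have := hc (φ q) hq
  rwa [Function.comp_apply, Function.comp_apply, φ.left_inv hq', φ.left_inv
    (mem_extChartAt_source p)] at this

end Constant

/-! ### The inverse function theorem on manifolds. -/

section InverseFunction

variable {E : Type*} [NormedAddCommGroup E] [NormedSpace ℝ E] [CompleteSpace E]
  {N : Type*} [TopologicalSpace N] [ChartedSpace E N] [IsManifold 𝓘(ℝ, E) ∞ N]
  {N' : Type*} [TopologicalSpace N'] [ChartedSpace E N'] [IsManifold 𝓘(ℝ, E) ∞ N']

/-- The inverse function theorem: a smooth map with invertible differentials is a local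
diffeomorphism. -/
theorem isLocalDiffeomorph_of_bijective_mfderiv {f : N → N'}
    (hf : ContMDiff 𝓘(ℝ, E) 𝓘(ℝ, E) ∞ f)
    (hb : ∀ p, Function.Bijective (mfderiv 𝓘(ℝ, E) 𝓘(ℝ, E) f p)) :
    IsLocalDiffeomorph 𝓘(ℝ, E) 𝓘(ℝ, E) ∞ f := by
  intro p
  set φ := chartAt E p with hφ
  set ψ := chartAt E (f p) with hψ
  have hφd : φ.MDifferentiable 𝓘(ℝ, E) 𝓘(ℝ, E) := mdifferentiable_chart p
  have hψd : ψ.MDifferentiable 𝓘(ℝ, E) 𝓘(ℝ, E) := mdifferentiable_chart (f p)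
  let F : E → E := ψ ∘ f ∘ φ.symm
  let D : Set E := φ.symm.source ∩ φ.symm ⁻¹' (f ⁻¹' ψ.source)
  have hD : IsOpen D :=
    φ.symm.isOpen_inter_preimage (hf.continuous.isOpen_preimage _ ψ.open_source)
  have hpD : φ p ∈ D := by
    refine ⟨mem_chart_target E p, ?_⟩
    change f (φ.symm (φ p)) ∈ ψ.source
    rw [φ.left_inv (mem_chart_source E p)]
    exact mem_chart_source E (f p)
  have hFs : ∀ z ∈ D, ContDiffAt ℝ ∞ F z := by
    intro z hz
    rw [← contMDiffAt_iff_contDiffAt]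
    have h1 : ContMDiffAt 𝓘(ℝ, E) 𝓘(ℝ, E) ∞ φ.symm z :=
      (contMDiffOn_chart_symm (I := 𝓘(ℝ, E)) (n := ∞) (x := p)).contMDiffAt
        (φ.open_target.mem_nhds hz.1)
    have h2 : ContMDiffAt 𝓘(ℝ, E) 𝓘(ℝ, E) ∞ ψ (f (φ.symm z)) :=
      (contMDiffOn_chart (I := 𝓘(ℝ, E)) (n := ∞) (x := f p)).contMDiffAt
        (ψ.open_source.mem_nhds hz.2)
    exact h2.comp z (hf.contMDiffAt.comp z h1)
  have hFd : ∀ z ∈ D, ∃ A : E ≃L[ℝ] E, HasFDerivAt F (A : E →L[ℝ] E) z := by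
    intro z hz
    have h1 := (hφd.mdifferentiableAt_symm hz.1).hasMFDerivAt
    have h2 := (hf.mdifferentiable (by simp) (φ.symm z)).hasMFDerivAt
    have h3 := (hψd.mdifferentiableAt hz.2).hasMFDerivAt
    have h4 := (h3.comp z (h2.comp z h1)).hasFDerivAt
    have hbij : Function.Bijective ((mfderiv 𝓘(ℝ, E) 𝓘(ℝ, E) ψ (f (φ.symm z))).comp
        ((mfderiv 𝓘(ℝ, E) 𝓘(ℝ, E) f (φ.symm z)).comp
          (mfderiv 𝓘(ℝ, E) 𝓘(ℝ, E) φ.symm z))) :=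
      (hψd.mfderiv_bijective hz.2).comp ((hb _).comp (hφd.symm.mfderiv_bijective hz.1))
    have hA : ∀ B : E →L[ℝ] E, Function.Bijective B → HasFDerivAt F B z →
        ∃ A : E ≃L[ℝ] E, HasFDerivAt F (A : E →L[ℝ] E) z := fun B hB hFB =>
      ⟨ContinuousLinearEquiv.ofBijective B (LinearMap.ker_eq_bot.2 hB.1)
        (LinearMap.range_eq_top.2 hB.2), by rwa [ContinuousLinearEquiv.coe_ofBijective]⟩
    exact hA _ hbij h4
  obtain ⟨A, hA⟩ := hFd _ hpD
  -- Restricting to `D` ensures an invertible derivative at every point of the source, so the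
  -- inverse is smooth on the whole target and not only at the image of `φ p`.
  let G := ((hFs _ hpD).toOpenPartialHomeomorph F hA (by simp)).restrOpen D hD
  have hGcoe : ∀ z, G z = F z := fun z => rfl
  have hGsource : φ p ∈ G.source :=
    ⟨(hFs _ hpD).mem_toOpenPartialHomeomorph_source hA (by simp), hpD⟩
  have hGD : G.source ⊆ D := fun z hz => hz.2
  have hGsymm : ContDiffOn ℝ ∞ G.symm G.target := by
    intro w hw
    have hmem := hGD (G.map_target hw)
    obtain ⟨B, hB⟩ := hFd _ hmem
    exact (G.contDiffAt_symm hw hB (hFs _ hmem)).contDiffWithinAt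
  let T := (φ.trans G).trans ψ.symm
  have hT1 : ∀ q ∈ T.source, q ∈ φ.source ∧ φ q ∈ G.source := by
    intro q hq
    exact ⟨hq.1.1, hq.1.2⟩
  have hTf : ∀ q ∈ T.source, T q = f q := by
    intro q hq
    obtain ⟨h1, h2⟩ := hT1 q hq
    have h3 := (hGD h2).2
    change ψ.symm (ψ (f (φ.symm (φ q)))) = f q
    change f (φ.symm (φ q)) ∈ ψ.source at h3
    rw [ψ.left_inv h3, φ.left_inv h1]
  refine ⟨⟨T.toPartialEquiv, T.open_source, T.open_target, ?_, ?_⟩, ?_, ?_⟩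
  · exact hf.contMDiffOn.congr fun q hq => hTf q hq
  · intro w hw
    have hw1 : w ∈ ψ.source := hw.1
    have hw2 : ψ w ∈ G.target := hw.2.1
    have hw3 : G.symm (ψ w) ∈ φ.target := hw.2.2
    have h1 : ContMDiffAt 𝓘(ℝ, E) 𝓘(ℝ, E) ∞ ψ w :=
      (contMDiffOn_chart (I := 𝓘(ℝ, E)) (n := ∞) (x := f p)).contMDiffAt
        (ψ.open_source.mem_nhds hw1)
    have h2 : ContMDiffAt 𝓘(ℝ, E) 𝓘(ℝ, E) ∞ G.symm (ψ w) :=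
      contMDiffAt_iff_contDiffAt.2 (hGsymm.contDiffAt (G.open_target.mem_nhds hw2))
    have h3 : ContMDiffAt 𝓘(ℝ, E) 𝓘(ℝ, E) ∞ φ.symm (G.symm (ψ w)) :=
      (contMDiffOn_chart_symm (I := 𝓘(ℝ, E)) (n := ∞) (x := p)).contMDiffAt
        (φ.open_target.mem_nhds hw3)
    exact (h3.comp w (h2.comp w h1)).contMDiffWithinAt
  · refine ⟨⟨mem_chart_source E p, hGsource⟩, ?_⟩
    change F (φ p) ∈ ψ.target
    exact ψ.map_source hpD.2
  · exact fun q hq => (hTf q hq).symm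

end InverseFunction

/-! ### Cutoff functions and separation of tangent vectors. -/

section Cutoff

variable {n : ℕ} {M : Type*} [TopologicalSpace M] [ChartedSpace (EuclideanSpace ℝ (Fin n)) M]

/-- Sections and ideals in this proof are global, charts are local; the cutoff passes between them.
It equals `1` on a neighbourhood, not just at `x`, so that differentials at `x` are unaffected. -/
theorem exists_cutoff [T2Space M] [SecondCountableTopology M] [IsManifold (𝓡 n) ∞ M] {U : Set M}
    (hU : IsOpen U) {x : M} (hx : x ∈ U) :
    ∃ χ : C^∞⟮𝓡 n, M; ℝ⟯, (∀ᶠ y in 𝓝 x, χ y = 1) ∧ tsupport χ ⊆ U := by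
  have : LocallyCompactSpace M := Manifold.locallyCompact_of_finiteDimensional (𝓡 n)
  obtain ⟨V, hV, hxV, hVU⟩ := normal_exists_closure_subset (isClosed_singleton (x := x)) hU
    (singleton_subset_iff.2 hx)
  obtain ⟨f, hf1, hf0, -⟩ := exists_contMDiffMap_one_nhds_of_subset_interior (n := ⊤) (𝓡 n)
    (isClosed_singleton (x := x)) (t := V) (by rwa [hV.interior_eq])
  refine ⟨f, by simpa using hf1, (closure_mono fun y hy => ?_).trans hVU⟩
  by_contra h
  exact hy (hf0 y h)

theorem contMDiff_smul_of_tsupport {E : Type*} [NormedAddCommGroup E] [NormedSpace ℝ E]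
    {U : Set M} (hU : IsOpen U) {χ : C^∞⟮𝓡 n, M; ℝ⟯} (hχ : tsupport χ ⊆ U) {f : M → E}
    (hf : ContMDiffOn (𝓡 n) 𝓘(ℝ, E) ∞ f U) :
    ContMDiff (𝓡 n) 𝓘(ℝ, E) ∞ (fun y => χ y • f y) := by
  refine contMDiff_of_tsupport fun y hy => ?_
  have hyU : y ∈ U := hχ (tsupport_smul_subset_left _ _ hy)
  exact χ.contMDiff.contMDiffAt.smul (hf.contMDiffAt (hU.mem_nhds hyU))

variable [T2Space M] [SecondCountableTopology M] [IsManifold (𝓡 n) ∞ M]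

/-- The differentials of global smooth functions separate tangent vectors. -/
theorem eq_of_forall_mvfderiv_eq {x : M} {v w : TangentSpace (𝓡 n) x}
    (h : ∀ f : C^∞⟮𝓡 n, M; ℝ⟯, mvfderiv (𝓡 n) f x v = mvfderiv (𝓡 n) f x w) : v = w := by
  set φ := chartAt (EuclideanSpace ℝ (Fin n)) x
  have hφd : φ.MDifferentiable (𝓡 n) (𝓡 n) := mdifferentiable_chart (I := 𝓡 n) x
  have hxs : x ∈ φ.source := mem_chart_source _ x
  apply hφd.mfderiv_injective hxs
  obtain ⟨χ, hχ1, hχ⟩ := exists_cutoff (n := n) φ.open_source hxs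
  -- The test functions are the chart coordinates, cut off.
  have key : ∀ (u : TangentSpace (𝓡 n) x) (l : EuclideanSpace ℝ (Fin n) →L[ℝ] ℝ),
      mvfderiv (𝓡 n) (fun y => χ y • l (φ y)) x u = l (mfderiv (𝓡 n) (𝓡 n) φ x u) := by
    intro u l
    have he : (fun y => χ y • l (φ y)) =ᶠ[𝓝 x] l ∘ φ := by
      filter_upwards [hχ1] with y hy
      change χ y • l (φ y) = l (φ y)
      rw [hy, one_smul]
    have h1 : HasMFDerivAt (𝓡 n) 𝓘(ℝ, ℝ) (l ∘ φ) x (l.comp (mfderiv (𝓡 n) (𝓡 n) φ x)) :=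
      l.hasMFDerivAt.comp x (hφd.mdifferentiableAt hxs).hasMFDerivAt
    have h2 := he.mfderiv_eq (I := 𝓡 n) (I' := 𝓘(ℝ, ℝ))
    change mfderiv (𝓡 n) 𝓘(ℝ, ℝ) (fun y => χ y • l (φ y)) x u = _
    rw [h2, h1.mfderiv]
    rfl
  have hl : ∀ l : EuclideanSpace ℝ (Fin n) →L[ℝ] ℝ,
      ContMDiff (𝓡 n) 𝓘(ℝ, ℝ) ∞ (fun y => χ y • l (φ y)) := fun l =>
    contMDiff_smul_of_tsupport φ.open_source hχ
      (l.contMDiff.comp_contMDiffOn (contMDiffOn_chart (I := 𝓡 n) (n := ∞) (x := x)))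
  refine (PiLp.ext fun i => ?_ : (mfderiv (𝓡 n) (𝓡 n) φ x v : EuclideanSpace ℝ (Fin n)) =
    mfderiv (𝓡 n) (𝓡 n) φ x w)
  exact ((key v _).symm.trans (h ⟨_, hl (EuclideanSpace.proj i)⟩)).trans (key w _)

end Cutoff

/-! ### Linear algebra of the hyperplane where the last coordinate vanishes. -/

section LinearFrame

theorem linearFrame_of_equiv {n : ℕ} {V : Type*} [AddCommGroup V] [Module ℝ V] [TopologicalSpace V]
    (A : V ≃L[ℝ] EuclideanSpace ℝ (Fin n) × ℝ) :
    LinearIndependent ℝ (fun k => A.symm (EuclideanSpace.single k (1 : ℝ), (0 : ℝ))) ∧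
      ∀ w : V, w ∈ Submodule.span ℝ
        (range fun k => A.symm (EuclideanSpace.single k (1 : ℝ), (0 : ℝ))) ↔ (A w).2 = 0 := by
  have hsum : ∀ v : EuclideanSpace ℝ (Fin n),
      A.symm (v, (0 : ℝ)) = ∑ k, v k • A.symm (EuclideanSpace.single k (1 : ℝ), (0 : ℝ)) := by
    intro v
    rw [← A.injective.eq_iff, A.apply_symm_apply, map_sum]
    simp only [map_smul, A.apply_symm_apply]
    refine Prod.ext ?_ ?_
    · rw [Prod.fst_sum]
      ext i
      simp [Finset.sum_apply, Pi.single_apply]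
    · rw [Prod.snd_sum]
      simp
  constructor
  · rw [Fintype.linearIndependent_iff]
    intro g hg i
    rw [← hsum (WithLp.toLp 2 g)] at hg
    have h1 : (WithLp.toLp 2 g, (0 : ℝ)) = (0 : EuclideanSpace ℝ (Fin n) × ℝ) := by
      rw [← A.symm.injective.eq_iff, hg, map_zero]
    have h2 := congrArg (fun p : EuclideanSpace ℝ (Fin n) × ℝ => p.1 i) h1
    simpa using h2
  · intro w
    constructor
    · intro hw
      induction hw using Submodule.span_induction with
      | mem x hx => obtain ⟨k, rfl⟩ := hx; simp
      | zero => simp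
      | add x y _ _ hx hy => simp [hx, hy]
      | smul a x _ hx => simp [hx]
    · intro hw
      have h1 : w = A.symm ((A w).1, (0 : ℝ)) := by
        rw [← A.injective.eq_iff, A.apply_symm_apply, ← hw]
      rw [h1, hsum]
      exact Submodule.sum_mem _ fun k _ => Submodule.smul_mem _ _ (Submodule.subset_span ⟨k, rfl⟩)

end LinearFrame

/-! ### The foliation defined by a function without critical points. -/

section LevelFoliation

variable {E : Type*} [NormedAddCommGroup E] [NormedSpace ℝ E] {H : Type*} [TopologicalSpace H]
  {I : ModelWithCorners ℝ E H} {N : Type u} [TopologicalSpace N] [ChartedSpace H N]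

/-- Near every point, the function `φ` is the last coordinate of a smooth chart with values in
`ℝⁿ × ℝ`. -/
def IsStraightenable (I : ModelWithCorners ℝ E H) {N : Type u} [TopologicalSpace N]
    [ChartedSpace H N] (n : ℕ) (φ : N → ℝ) : Prop :=
  ∀ e : N, ∃ Ξ : PartialDiffeomorph I 𝓘(ℝ, EuclideanSpace ℝ (Fin n) × ℝ) N
    (EuclideanSpace ℝ (Fin n) × ℝ) ∞, e ∈ Ξ.source ∧ ∀ e' ∈ Ξ.source, (Ξ e').2 = φ e'

variable {n : ℕ} {φ : N → ℝ}

theorem IsStraightenable.contMDiff (h : IsStraightenable I n φ) : ContMDiff I 𝓘(ℝ, ℝ) ∞ φ := by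
  intro e
  obtain ⟨Ξ, he, hΞ⟩ := h e
  have h1 : ContMDiffAt I 𝓘(ℝ, ℝ) ∞ (Prod.snd ∘ Ξ) e :=
    ContMDiffAt.comp e (contDiff_snd.contMDiff.contMDiffAt)
      (Ξ.contMDiffOn.contMDiffAt (Ξ.open_source.mem_nhds he))
  refine h1.congr_of_eventuallyEq ?_
  filter_upwards [Ξ.open_source.mem_nhds he] with e' he' using (hΞ e' he').symm

/-- The differential of a partial diffeomorphism into a vector space. -/
def diffEquiv [IsManifold I ∞ N] {F : Type*} [NormedAddCommGroup F] [NormedSpace ℝ F]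
    (Ξ : PartialDiffeomorph I 𝓘(ℝ, F) N F ∞) {e : N} (he : e ∈ Ξ.source) :
    TangentSpace I e ≃L[ℝ] F :=
  (Ξ.isLocalDiffeomorphAt I 𝓘(ℝ, F) ∞ he).mfderivToContinuousLinearEquiv (by simp)

theorem mvfderiv_eq_snd [IsManifold I ∞ N]
    (Ξ : PartialDiffeomorph I 𝓘(ℝ, EuclideanSpace ℝ (Fin n) × ℝ) N
      (EuclideanSpace ℝ (Fin n) × ℝ) ∞) (hΞ : ∀ e' ∈ Ξ.source, (Ξ e').2 = φ e')
    {e : N} (he : e ∈ Ξ.source) (w : TangentSpace I e) :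
    mvfderiv I φ e w = (diffEquiv Ξ he w).2 := by
  have h1 : HasMFDerivAt I 𝓘(ℝ, ℝ) (Prod.snd ∘ Ξ) e
      ((ContinuousLinearMap.snd ℝ (EuclideanSpace ℝ (Fin n)) ℝ).comp
        (mfderiv I 𝓘(ℝ, EuclideanSpace ℝ (Fin n) × ℝ) Ξ e)) :=
    HasMFDerivAt.comp e (ContinuousLinearMap.snd ℝ (EuclideanSpace ℝ (Fin n)) ℝ).hasMFDerivAt
      (Ξ.mdifferentiableAt (by simp) he).hasMFDerivAt
  have h2 : (Prod.snd ∘ Ξ) =ᶠ[𝓝 e] φ := by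
    filter_upwards [Ξ.open_source.mem_nhds he] with e' he' using hΞ e' he'
  have h3 := (h1.congr_of_eventuallyEq h2.symm).mfderiv
  change mfderiv I 𝓘(ℝ, ℝ) φ e w = _
  rw [h3]
  rfl

theorem IsStraightenable.mvfderiv_ne_zero [IsManifold I ∞ N] (h : IsStraightenable I n φ) (e : N) :
    mvfderiv I φ e ≠ 0 := by
  obtain ⟨Ξ, he, hΞ⟩ := h e
  intro h0
  have h1 := mvfderiv_eq_snd Ξ hΞ he ((diffEquiv Ξ he).symm (0, 1))
  rw [h0, ContinuousLinearEquiv.apply_symm_apply] at h1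
  exact zero_ne_one h1

variable [IsManifold I ∞ N] [CompleteSpace E] [I.Boundaryless]

/-- Both `X φ` and `Y φ` vanish identically, hence so does `X (Y φ) - Y (X φ)`, which is `[X, Y] φ`.
-/
theorem mlieBracket_mem_ker (hφ : ContMDiff I 𝓘(ℝ, ℝ) ∞ φ) {U : Set N} (hU : IsOpen U)
    {X Y : ∀ y : N, TangentSpace I y}
    (hX : ∀ y, X y ∈ LinearMap.ker (mvfderiv I φ y).toLinearMap)
    (hY : ∀ y, Y y ∈ LinearMap.ker (mvfderiv I φ y).toLinearMap)
    (hXs : ContMDiffOn I I.tangent ∞ (fun y => (⟨y, X y⟩ : TangentBundle I N)) U)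
    (hYs : ContMDiffOn I I.tangent ∞ (fun y => (⟨y, Y y⟩ : TangentBundle I N)) U)
    {y : N} (hy : y ∈ U) :
    mlieBracket I X Y y ∈ LinearMap.ker (mvfderiv I φ y).toLinearMap := by
  have h0 : ∀ Y : ∀ y : N, TangentSpace I y,
      (∀ y, Y y ∈ LinearMap.ker (mvfderiv I φ y).toLinearMap) →
      (fun y => mvfderiv I φ y (Y y)) = fun _ => (0 : ℝ) := fun Y hY => funext hY
  change mvfderiv I φ y (mlieBracket I X Y y) = 0
  rw [mvfderiv_mlieBracket_apply hφ (hXs.contMDiffAt (hU.mem_nhds hy))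
    (hYs.contMDiffAt (hU.mem_nhds hy)), h0 X hX, h0 Y hY, mvfderiv_const]
  simp

/-- The foliation by the level sets of a straightenable function. -/
def levelFoliation (h : IsStraightenable I n φ) : Foliation I N n where
  tangent e := LinearMap.ker (mvfderiv I φ e).toLinearMap
  exists_frame e := by
    obtain ⟨Ξ, he, hΞ⟩ := h e
    -- In a straightening chart the kernel of `dφ` is `ℝⁿ × 0`, so pulling back the first `n`
    -- constant fields frames it.
    refine ⟨Ξ.source, Ξ.open_source, he, fun k => mpullback I
      𝓘(ℝ, EuclideanSpace ℝ (Fin n) × ℝ) Ξ fun _ => (EuclideanSpace.single k (1 : ℝ), (0 : ℝ)),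
      fun k y hy => ?_, fun y hy => ?_⟩
    · refine (ContMDiffAt.mpullback_vectorField_preimage (n := ∞) (m := ∞) ?_
        (Ξ.contMDiffOn.contMDiffAt (Ξ.open_source.mem_nhds hy)) ?_ (by simp)).contMDiffWithinAt
      · exact contMDiffAt_vectorSpace_iff_contDiffAt.2 contDiffAt_const
      · exact ⟨diffEquiv Ξ hy, rfl⟩
    · have h1 : ∀ k, mpullback I 𝓘(ℝ, EuclideanSpace ℝ (Fin n) × ℝ) Ξ
          (fun _ => (EuclideanSpace.single k (1 : ℝ), (0 : ℝ))) y =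
          (diffEquiv Ξ hy).symm (EuclideanSpace.single k (1 : ℝ), (0 : ℝ)) := by
        intro k
        exact congrFun (congrArg DFunLike.coe
          (ContinuousLinearMap.inverse_equiv (diffEquiv Ξ hy))) _
      simp only [h1]
      obtain ⟨h2, h3⟩ := linearFrame_of_equiv (diffEquiv Ξ hy)
      refine ⟨h2, ?_⟩
      ext w
      rw [h3, ← mvfderiv_eq_snd Ξ hΞ hy]
      rfl
  involutive U X Y hU hX hY hXs hYs y hy :=
    mlieBracket_mem_ker h.contMDiff hU hX hY hXs hYs hy

theorem levelFoliation_coorientable (h : IsStraightenable I n φ) :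
    (levelFoliation h).Coorientable :=
  ⟨⟨fun e => mvfderiv I φ e, contMDiff_mvfderiv h.contMDiff⟩,
    fun e => ⟨h.mvfderiv_ne_zero e, fun _ => Iff.rfl⟩⟩

end LevelFoliation

/-! ### Manifold structure on open pieces of level sets. -/

section LevelSets

variable {E : Type*} [NormedAddCommGroup E] [NormedSpace ℝ E] {H : Type*} [TopologicalSpace H]
  {I : ModelWithCorners ℝ E H} {N : Type u} [TopologicalSpace N] [ChartedSpace H N]
  {n : ℕ} {φ : N → ℝ}

/-- The part of a level set of `φ` contained in `O`. -/
def levelPiece (φ : N → ℝ) (c : ℝ) (O : Set N) : Set N := {e | e ∈ O ∧ φ e = c}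

variable (h : IsStraightenable I n φ) {c : ℝ} {O : Set N} (hO : IsOpen O)

/-- A chart of `N` straightening `φ`. -/
def straightChart (e : N) : PartialDiffeomorph I 𝓘(ℝ, EuclideanSpace ℝ (Fin n) × ℝ) N
    (EuclideanSpace ℝ (Fin n) × ℝ) ∞ := (h e).choose

theorem mem_straightChart_source (e : N) : e ∈ (straightChart h e).source := (h e).choose_spec.1

theorem straightChart_snd (e : N) {e' : N} (he' : e' ∈ (straightChart h e).source) :
    (straightChart h e e').2 = φ e' := (h e).choose_spec.2 e' he'

theorem straightChart_symm_mem (e : N) {y : EuclideanSpace ℝ (Fin n)}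
    (hy : (y, c) ∈ (straightChart h e).target) (hyO : (straightChart h e).symm (y, c) ∈ O) :
    (straightChart h e).symm (y, c) ∈ levelPiece φ c O := by
  refine ⟨hyO, ?_⟩
  exact (straightChart_snd h e ((straightChart h e).map_target hy)).symm.trans
    (congrArg Prod.snd ((straightChart h e).right_inv hy))

theorem straightChart_apply (e : N) {e' : N} (he' : e' ∈ (straightChart h e).source)
    (hc : φ e' = c) : ((straightChart h e e').1, c) = straightChart h e e' :=
  Prod.ext rfl (hc.symm.trans (straightChart_snd h e he').symm)

open Classical in
/-- The chart of a piece of a level set induced by a straightening chart. -/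
def levelChart (p : levelPiece φ c O) :
    OpenPartialHomeomorph (levelPiece φ c O) (EuclideanSpace ℝ (Fin n)) where
  toFun q := (straightChart h p.1 q.1).1
  -- The base point `p` is a default value, taken where the inverse chart leaves the piece.
  invFun y := if hy : (straightChart h p.1).symm (y, c) ∈ levelPiece φ c O then ⟨_, hy⟩ else p
  source := {q | q.1 ∈ (straightChart h p.1).source}
  target := {y | (y, c) ∈ (straightChart h p.1).target ∧ (straightChart h p.1).symm (y, c) ∈ O}
  map_source' q hq := by
    change ((straightChart h p.1 q.1).1, c) ∈ _ ∧ (straightChart h p.1).symm (_, c) ∈ O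
    rw [straightChart_apply h p.1 hq q.2.2]
    refine ⟨(straightChart h p.1).map_source hq, ?_⟩
    rw [show (straightChart h p.1).symm (straightChart h p.1 q.1) = q.1 from
      (straightChart h p.1).left_inv hq]
    exact q.2.1
  map_target' y hy := by
    simp only [dif_pos (straightChart_symm_mem h p.1 hy.1 hy.2)]
    exact (straightChart h p.1).map_target hy.1
  left_inv' q hq := by
    have h1 : (straightChart h p.1).symm ((straightChart h p.1 q.1).1, c) = q.1 := by
      rw [straightChart_apply h p.1 hq q.2.2]
      exact (straightChart h p.1).left_inv hq
    have h2 : (straightChart h p.1).symm ((straightChart h p.1 q.1).1, c) ∈ levelPiece φ c O := by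
      rw [h1]; exact q.2
    simp only [dif_pos h2]
    exact Subtype.ext h1
  right_inv' y hy := by
    simp only [dif_pos (straightChart_symm_mem h p.1 hy.1 hy.2)]
    exact congrArg Prod.fst ((straightChart h p.1).right_inv hy.1)
  open_source := (straightChart h p.1).open_source.preimage continuous_subtype_val
  open_target := by
    have h1 := (straightChart h p.1).toOpenPartialHomeomorph.symm.isOpen_inter_preimage hO
    have h2 : Continuous fun y : EuclideanSpace ℝ (Fin n) => (y, c) := by fun_prop
    exact h1.preimage h2
  continuousOn_toFun := by
    have h1 := (straightChart h p.1).contMDiffOn.continuousOn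
    exact continuous_fst.comp_continuousOn
      (h1.comp continuous_subtype_val.continuousOn fun q hq => hq)
  continuousOn_invFun := by
    rw [Topology.IsInducing.subtypeVal.continuousOn_iff]
    have h1 := (straightChart h p.1).symm.contMDiffOn.continuousOn
    have h2 : Continuous fun y : EuclideanSpace ℝ (Fin n) => (y, c) := by fun_prop
    refine (h1.comp h2.continuousOn fun y hy => hy.1).congr fun y hy => ?_
    simp only [Function.comp_apply, dif_pos (straightChart_symm_mem h p.1 hy.1 hy.2)]

theorem levelChart_symm_val (p : levelPiece φ c O) {y : EuclideanSpace ℝ (Fin n)}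
    (hy : y ∈ (levelChart h hO p).target) :
    ((levelChart h hO p).symm y).1 = (straightChart h p.1).symm (y, c) :=
  congrArg Subtype.val (dif_pos (straightChart_symm_mem h p.1 hy.1 hy.2))

/-- The manifold structure of an open piece of a level set. -/
abbrev levelChartedSpace : ChartedSpace (EuclideanSpace ℝ (Fin n)) (levelPiece φ c O) where
  atlas := range (levelChart h hO)
  chartAt p := levelChart h hO p
  mem_chart_source p := mem_straightChart_source h p.1
  chart_mem_atlas p := mem_range_self p

theorem contDiff_pair (c : ℝ) :
    ContDiff ℝ ∞ (fun y : EuclideanSpace ℝ (Fin n) => (y, c)) := by fun_prop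

/-- A change of level charts is a change of straightening charts, restricted to the slice `y ↦ (y,
c)` and followed by the first projection. -/
theorem level_isManifold :
    @IsManifold ℝ _ _ _ _ _ _ (𝓡 n) ∞ (levelPiece φ c O) _ (levelChartedSpace h hO) := by
  let := levelChartedSpace h hO (c := c)
  apply isManifold_of_contDiffOn
  rintro _ _ ⟨p, rfl⟩ ⟨q, rfl⟩
  simp only [modelWithCornersSelf_coe, modelWithCornersSelf_coe_symm, Function.id_comp,
    Function.comp_id, preimage_id, range_id, inter_univ]
  intro y hy
  have hy1 : y ∈ (levelChart h hO p).target := hy.1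
  have hy2 : ((levelChart h hO p).symm y).1 ∈ (straightChart h q.1).source := hy.2
  rw [levelChart_symm_val h hO p hy1] at hy2
  have h1 : ContMDiffAt 𝓘(ℝ, EuclideanSpace ℝ (Fin n)) 𝓘(ℝ, EuclideanSpace ℝ (Fin n)) ∞
      (fun y => (straightChart h q.1 ((straightChart h p.1).symm (y, c))).1) y := by
    have h2 := (straightChart h p.1).symm.contMDiffOn.contMDiffAt
      ((straightChart h p.1).open_target.mem_nhds hy1.1)
    have h3 := (straightChart h q.1).contMDiffOn.contMDiffAt
      ((straightChart h q.1).open_source.mem_nhds hy2)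
    have h4 := (h3.comp _ h2).comp y (contDiff_pair c).contMDiff.contMDiffAt
    exact contDiff_fst.contMDiff.contMDiffAt.comp y h4
  refine (contMDiffAt_iff_contDiffAt.1 h1).contDiffWithinAt.congr (fun z hz => ?_) ?_
  · change (straightChart h q.1 ((levelChart h hO p).symm z).1).1 = _
    rw [levelChart_symm_val h hO p hz.1]
  · change (straightChart h q.1 ((levelChart h hO p).symm y).1).1 = _
    rw [levelChart_symm_val h hO p hy1]

theorem level_contMDiffAt_val [IsManifold I ∞ N] (p : levelPiece φ c O) :
    letI := levelChartedSpace h hO (c := c)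
    ContMDiffAt (𝓡 n) I ∞ (Subtype.val : levelPiece φ c O → N) p := by
  let := levelChartedSpace h hO (c := c)
  have := level_isManifold h hO (c := c)
  have h1 : ContMDiffAt (𝓡 n) (𝓡 n) ∞ (levelChart h hO p) p :=
    (contMDiffOn_chart (I := 𝓡 n) (n := ∞) (x := p)).contMDiffAt
      ((levelChart h hO p).open_source.mem_nhds (mem_straightChart_source h p.1))
  have hp : levelChart h hO p p ∈ (levelChart h hO p).target :=
    (levelChart h hO p).map_source (mem_straightChart_source h p.1)
  have h2 := (straightChart h p.1).symm.contMDiffOn.contMDiffAt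
    ((straightChart h p.1).open_target.mem_nhds hp.1)
  have h3 := h2.comp (levelChart h hO p p) (contDiff_pair c).contMDiff.contMDiffAt
  refine (h3.comp p h1).congr_of_eventuallyEq ?_
  filter_upwards [(levelChart h hO p).open_source.mem_nhds (mem_straightChart_source h p.1)]
    with q hq
  have h4 := levelChart_symm_val h hO p ((levelChart h hO p).map_source hq)
  rw [(levelChart h hO p).left_inv hq] at h4
  exact h4

/-- The level chart is the first component of the straightening chart composed with the inclusion.
Its differential is injective, so that of the inclusion is too. -/
theorem level_immersive [IsManifold I ∞ N] (p : levelPiece φ c O) :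
    letI := levelChartedSpace h hO (c := c)
    Function.Injective (mfderiv (𝓡 n) I (Subtype.val : levelPiece φ c O → N) p) := by
  let := levelChartedSpace h hO (c := c)
  have := level_isManifold h hO (c := c)
  have h1 : (levelChart h hO p).MDifferentiable (𝓡 n) (𝓡 n) := mdifferentiable_chart (I := 𝓡 n) p
  have hp := mem_straightChart_source h p.1
  have h2a : HasMFDerivAt (𝓡 n) 𝓘(ℝ, EuclideanSpace ℝ (Fin n) × ℝ)
      (straightChart h p.1 ∘ (Subtype.val : levelPiece φ c O → N)) p _ :=
    HasMFDerivAt.comp p ((straightChart h p.1).mdifferentiableAt (by simp) hp).hasMFDerivAt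
      ((level_contMDiffAt_val h hO p).mdifferentiableAt (by simp)).hasMFDerivAt
  have h2 : HasMFDerivAt (𝓡 n) (𝓡 n) (levelChart h hO p) p _ :=
    (ContinuousLinearMap.fst ℝ (EuclideanSpace ℝ (Fin n)) ℝ).hasMFDerivAt.comp p h2a
  have h3 := h1.mfderiv_injective hp
  rw [h2.mfderiv] at h3
  intro v w hvw
  apply h3
  change (mfderiv I 𝓘(ℝ, EuclideanSpace ℝ (Fin n) × ℝ) (straightChart h p.1) p.1
    (mfderiv (𝓡 n) I (Subtype.val : levelPiece φ c O → N) p v) :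
      EuclideanSpace ℝ (Fin n) × ℝ).1 = (mfderiv I 𝓘(ℝ, EuclideanSpace ℝ (Fin n) × ℝ)
        (straightChart h p.1) p.1
    (mfderiv (𝓡 n) I (Subtype.val : levelPiece φ c O → N) p w) :
      EuclideanSpace ℝ (Fin n) × ℝ).1
  rw [hvw]

theorem level_range_mfderiv [IsManifold I ∞ N] (p : levelPiece φ c O) :
    letI := levelChartedSpace h hO (c := c)
    LinearMap.range (mfderiv (𝓡 n) I (Subtype.val : levelPiece φ c O → N) p).toLinearMap =
      LinearMap.ker (mvfderiv I φ p.1).toLinearMap := by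
  let := levelChartedSpace h hO (c := c)
  have := level_isManifold h hO (c := c)
  have hp := mem_straightChart_source h p.1
  have hd : HasMFDerivAt (𝓡 n) I (Subtype.val : levelPiece φ c O → N) p _ :=
    ((level_contMDiffAt_val h hO p).mdifferentiableAt (by simp)).hasMFDerivAt
  apply le_antisymm
  · rintro _ ⟨v, rfl⟩
    -- `φ` is constant on the piece, so `dφ` kills the tangent vectors of the piece.
    have h1 : HasMFDerivAt (𝓡 n) 𝓘(ℝ, ℝ) (φ ∘ (Subtype.val : levelPiece φ c O → N)) p _ :=
      HasMFDerivAt.comp p (h.contMDiff.mdifferentiable (by simp) p.1).hasMFDerivAt hd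
    have h2 : (φ ∘ (Subtype.val : levelPiece φ c O → N)) = fun _ => c := funext fun q => q.2.2
    rw [h2] at h1
    have h3 := h1.mfderiv
    rw [mfderiv_const] at h3
    exact (DFunLike.congr_fun h3 v).symm
  · intro w hw
    let Ξ := straightChart h p.1
    have hw' : (diffEquiv Ξ hp w).2 = 0 := by
      rw [← mvfderiv_eq_snd Ξ (fun e' he' => straightChart_snd h p.1 he') hp]
      exact hw
    have h1 : (levelChart h hO p).MDifferentiable (𝓡 n) (𝓡 n) :=
      mdifferentiable_chart (I := 𝓡 n) p
    -- Conversely, a vector of the kernel has last component `0` and is determined by its first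
    -- component, which the level chart can prescribe.
    obtain ⟨v, hv⟩ := h1.mfderiv_surjective hp ((diffEquiv Ξ hp w).1)
    refine ⟨v, ?_⟩
    apply (diffEquiv Ξ hp).injective
    have h2a : HasMFDerivAt (𝓡 n) 𝓘(ℝ, EuclideanSpace ℝ (Fin n) × ℝ)
        (Ξ ∘ (Subtype.val : levelPiece φ c O → N)) p _ :=
      HasMFDerivAt.comp p (Ξ.mdifferentiableAt (by simp) hp).hasMFDerivAt hd
    have h2 : HasMFDerivAt (𝓡 n) (𝓡 n) (levelChart h hO p) p _ :=
      (ContinuousLinearMap.fst ℝ (EuclideanSpace ℝ (Fin n)) ℝ).hasMFDerivAt.comp p h2a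
    have h3 : HasMFDerivAt (𝓡 n) 𝓘(ℝ, ℝ) (Prod.snd ∘ Ξ ∘ (Subtype.val : levelPiece φ c O → N)) p
        _ := (ContinuousLinearMap.snd ℝ (EuclideanSpace ℝ (Fin n)) ℝ).hasMFDerivAt.comp p h2a
    have h4 : (Prod.snd ∘ Ξ ∘ (Subtype.val : levelPiece φ c O → N)) =ᶠ[𝓝 p] fun _ => c := by
      filter_upwards [(levelChart h hO p).open_source.mem_nhds hp] with q hq
      exact (straightChart_snd h p.1 hq).trans q.2.2
    have h5 := (h3.congr_of_eventuallyEq h4.symm).mfderiv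
    rw [mfderiv_const] at h5
    rw [h2.mfderiv] at hv
    refine Prod.ext hv ?_
    rw [hw']
    exact (DFunLike.congr_fun h5 v).symm

end LevelSets

/-! ### Leaves are the components of the level sets. -/

section Leaves

variable {E : Type*} [NormedAddCommGroup E] [NormedSpace ℝ E] [CompleteSpace E] {H : Type*}
  [TopologicalSpace H] {I : ModelWithCorners ℝ E H} [I.Boundaryless] {N : Type u}
  [TopologicalSpace N] [ChartedSpace H N] [IsManifold I ∞ N] {n : ℕ} {φ : N → ℝ}
  (h : IsStraightenable I n φ)

/-- A connected piece of a level set as an integral manifold of the foliation by level sets. -/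
def levelIntegralManifold {c : ℝ} {O : Set N} (hO : IsOpen O)
    (hc : IsConnected (levelPiece φ c O)) : (levelFoliation h).IntegralManifold :=
  letI := levelChartedSpace h hO (c := c)
  haveI := level_isManifold h hO (c := c)
  haveI := isConnected_iff_connectedSpace.1 hc
  { carrier := levelPiece φ c O
    incl := Subtype.val
    injective := Subtype.val_injective
    smooth := fun p => level_contMDiffAt_val h hO p
    immersive := fun p => level_immersive h hO p
    range_mfderiv := fun p => level_range_mfderiv h hO p }

theorem range_levelIntegralManifold {c : ℝ} {O : Set N} (hO : IsOpen O)
    (hc : IsConnected (levelPiece φ c O)) :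
    range (levelIntegralManifold h hO hc).incl = levelPiece φ c O := Subtype.range_val

/-- The components of the level sets are open in the level sets. -/
theorem exists_levelPiece_eq_connectedComponentIn {E : Type*} [NormedAddCommGroup E]
    [NormedSpace ℝ E] {H : Type*} [TopologicalSpace H] {I : ModelWithCorners ℝ E H} {N : Type u}
    [TopologicalSpace N] [ChartedSpace H N] {n : ℕ} {φ : N → ℝ}
    (h : IsStraightenable I n φ) (e : N) :
    ∃ O : Set N, IsOpen O ∧
      connectedComponentIn {e' | φ e' = φ e} e = levelPiece φ (φ e) O := by
  let S : Set N := levelPiece φ (φ e) univ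
  let := levelChartedSpace h isOpen_univ (c := φ e)
  -- The full level set is a manifold, hence locally connected, so its components are open in it and
  -- are cut out by open sets of `N`. This is why level pieces carry the open set `O`: components
  -- need no new manifold structure.
  have : LocallyConnectedSpace S :=
    ChartedSpace.locallyConnectedSpace (EuclideanSpace ℝ (Fin n)) S
  let p : S := ⟨e, mem_univ e, rfl⟩
  obtain ⟨O, hO, hOp⟩ := isOpen_induced_iff.1 (isOpen_connectedComponent (x := p))
  refine ⟨O, hO, ?_⟩
  have hS : {e' | φ e' = φ e} = S := by
    ext; simp [S, levelPiece]
  rw [hS, connectedComponentIn_eq_image p.2, ← hOp, Subtype.image_preimage_coe]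
  ext; simp [S, levelPiece, and_comm]

/-- Integral manifolds of the foliation by level sets lie in level sets. -/
theorem eq_on_integralManifold (K : (levelFoliation h).IntegralManifold) (p q : K.carrier) :
    φ (K.incl p) = φ (K.incl q) := by
  refine eq_of_mfderiv_eq_zero (I := 𝓡 n) (f := φ ∘ K.incl) (h.contMDiff.comp K.smooth)
    (fun x => ?_) p q
  rw [mfderiv_comp x (h.contMDiff.mdifferentiable (by simp) _)
    (K.smooth.mdifferentiable (by simp) x)]
  ext v
  have h1 : mfderiv (𝓡 n) I K.incl x v ∈ (levelFoliation h).tangent (K.incl x) := by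
    rw [← K.range_mfderiv]
    exact ⟨v, rfl⟩
  exact h1

/-- `φ` is constant along `K`, and the image of `K` under its continuous inclusion is connected. -/
theorem range_subset_connectedComponentIn (K : (levelFoliation h).IntegralManifold)
    {e : N} (he : e ∈ range K.incl) :
    range K.incl ⊆ connectedComponentIn {e' | φ e' = φ e} e := by
  obtain ⟨p, rfl⟩ := he
  refine (isPreconnected_range K.smooth.continuous).subset_connectedComponentIn
    (mem_range_self p) ?_
  rintro _ ⟨q, rfl⟩
  exact eq_on_integralManifold h K q p

/-- The leaves of the foliation by level sets are the components of the level sets. -/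
theorem levelFoliation_isLeafSet_iff (S : Set N) :
    (levelFoliation h).IsLeafSet S ↔
      ∃ e, S = connectedComponentIn {e' | φ e' = φ e} e := by
  have hex : ∀ e, ∃ L : (levelFoliation h).IntegralManifold,
      range L.incl = connectedComponentIn {e' | φ e' = φ e} e := by
    intro e
    obtain ⟨O, hO, hS⟩ := exists_levelPiece_eq_connectedComponentIn h e
    have hc : IsConnected (levelPiece φ (φ e) O) := by
      rw [← hS]
      exact isConnected_connectedComponentIn_iff.2 rfl
    exact ⟨levelIntegralManifold h hO hc, by rw [range_levelIntegralManifold, hS]⟩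
  constructor
  · rintro ⟨L, hL, rfl⟩
    obtain ⟨p⟩ : Nonempty L.carrier := inferInstance
    obtain ⟨K, hK⟩ := hex (L.incl p)
    refine ⟨L.incl p, ?_⟩
    -- The leaf lies in a component, which is itself an integral manifold `K`; maximality gives
    -- equality.
    have h1 := range_subset_connectedComponentIn h L (mem_range_self p)
    exact h1.antisymm (hK ▸ hL K (hK ▸ h1))
  · rintro ⟨e, rfl⟩
    obtain ⟨L, hL⟩ := hex e
    refine ⟨L, fun K hK => ?_, hL⟩
    -- An integral manifold containing the component passes through `e`, so it is confined to the
    -- component of `e`.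
    have he : e ∈ range K.incl := hK (hL ▸ mem_connectedComponentIn rfl)
    rw [hL]
    exact range_subset_connectedComponentIn h K he

end Leaves

/-! ### Adapted coordinates with `φ = t * r`, and straightening. -/

section BCharts

variable {n : ℕ}

/-- The coordinate `y i`, or the constant `1` if no coordinate is given. -/
def bCoord (i : Option (Fin n)) (y : EuclideanSpace ℝ (Fin n)) : ℝ := i.elim 1 fun k => y k

/-- The differential of `bCoord i`. -/
def bCoordDeriv (i : Option (Fin n)) : EuclideanSpace ℝ (Fin n) →L[ℝ] ℝ :=
  i.elim 0 fun k => EuclideanSpace.proj k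

theorem hasFDerivAt_bCoord (i : Option (Fin n)) (y : EuclideanSpace ℝ (Fin n)) :
    HasFDerivAt (bCoord i) (bCoordDeriv i) y := by
  cases i with
  | none => exact hasFDerivAt_const 1 y
  | some k => exact (EuclideanSpace.proj k : EuclideanSpace ℝ (Fin n) →L[ℝ] ℝ).hasFDerivAt

theorem contDiff_bCoord (i : Option (Fin n)) : ContDiff ℝ ∞ (bCoord i) := by
  cases i with
  | none => exact contDiff_const
  | some k => exact (EuclideanSpace.proj k : EuclideanSpace ℝ (Fin n) →L[ℝ] ℝ).contDiff

/-- Replacing the coordinate `i` of a point. -/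
def replaceCoord (i : Fin n) (y : EuclideanSpace ℝ (Fin n)) (t : ℝ) : EuclideanSpace ℝ (Fin n) :=
  y + (t - y i) • EuclideanSpace.single i (1 : ℝ)

theorem replaceCoord_self (i : Fin n) (y : EuclideanSpace ℝ (Fin n)) (t : ℝ) :
    replaceCoord i y t i = t := by
  simp [replaceCoord]

theorem replaceCoord_replaceCoord (i : Fin n) (y : EuclideanSpace ℝ (Fin n)) (t : ℝ) :
    replaceCoord i (replaceCoord i y t) (y i) = y := by
  rw [replaceCoord, replaceCoord_self, replaceCoord, add_assoc, ← add_smul]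
  simp

/-- The diffeomorphism of `ℝⁿ × ℝ` that replaces the coordinates `(y i, t)` by `(t, t * y i)`, where
`t` does not vanish. -/
def swapDiffeo (i : Fin n) : PartialDiffeomorph 𝓘(ℝ, EuclideanSpace ℝ (Fin n) × ℝ)
    𝓘(ℝ, EuclideanSpace ℝ (Fin n) × ℝ) (EuclideanSpace ℝ (Fin n) × ℝ)
    (EuclideanSpace ℝ (Fin n) × ℝ) ∞ where
  toFun p := (replaceCoord i p.1 p.2, p.2 * p.1 i)
  invFun p := (replaceCoord i p.1 (p.2 / p.1 i), p.1 i)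
  source := {p | p.2 ≠ 0}
  target := {p | p.1 i ≠ 0}
  map_source' p hp := by
    change replaceCoord i p.1 p.2 i ≠ 0
    rwa [replaceCoord_self]
  map_target' p hp := hp
  left_inv' p hp := by
    have hp' : p.2 ≠ 0 := hp
    simp only [replaceCoord_self]
    rw [mul_div_cancel_left₀ _ hp', replaceCoord_replaceCoord]
  right_inv' p hp := by
    have hp' : p.1 i ≠ 0 := hp
    simp only [replaceCoord_self]
    rw [mul_div_cancel₀ _ hp', replaceCoord_replaceCoord]
  open_source := isOpen_ne_fun (by fun_prop) (by fun_prop)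
  open_target := isOpen_ne_fun (by fun_prop) (by fun_prop)
  contMDiffOn_toFun := by
    refine ContDiff.contMDiff ?_ |>.contMDiffOn
    unfold replaceCoord
    fun_prop
  contMDiffOn_invFun := by
    rw [contMDiffOn_iff_contDiffOn]
    intro p hp
    have hp' : p.1 i ≠ 0 := hp
    have h1 : ContDiffAt ℝ ∞ (fun p : EuclideanSpace ℝ (Fin n) × ℝ => p.1 i) p := by fun_prop
    have h2 : ContDiffAt ℝ ∞ (fun p : EuclideanSpace ℝ (Fin n) × ℝ => p.2 / p.1 i) p :=
      contDiffAt_snd.div h1 hp'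
    refine ContDiffAt.contDiffWithinAt ?_
    unfold replaceCoord
    fun_prop

variable {M : Type u} [TopologicalSpace M] [ChartedSpace (EuclideanSpace ℝ (Fin n)) M]
  {E : Type*} [NormedAddCommGroup E] [NormedSpace ℝ E] {H : Type*} [TopologicalSpace H]

/-- Coordinates on `N` adapted to the projection `pr : N → M`, with fibre `ℝ ∖ {0}`, and to the
function `φ`: a chart `ψ` of `M` and a fibre coordinate `t` such that `φ = t * r`, where `r` is
either a coordinate of `ψ` or the constant `1`, and where `r` generates the vanishing ideal
of `Z`. -/
structure BChart (n : ℕ) {M : Type u} [TopologicalSpace M]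
    [ChartedSpace (EuclideanSpace ℝ (Fin n)) M] (I : ModelWithCorners ℝ E H) {N : Type*}
    [TopologicalSpace N] [ChartedSpace H N]
    (Z : Set M) (pr : N → M) (φ : N → ℝ) where
  base : PartialDiffeomorph (𝓡 n) 𝓘(ℝ, EuclideanSpace ℝ (Fin n)) M (EuclideanSpace ℝ (Fin n)) ∞
  total : PartialDiffeomorph I 𝓘(ℝ, EuclideanSpace ℝ (Fin n) × ℝ) N
    (EuclideanSpace ℝ (Fin n) × ℝ) ∞
  source_eq : total.source = pr ⁻¹' base.source
  target_eq : total.target = base.target ×ˢ {0}ᶜ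
  fst_eq : ∀ e ∈ total.source, (total e).1 = base (pr e)
  index : Option (Fin n)
  mem_iff : ∀ x ∈ base.source, x ∈ Z ↔ bCoord index (base x) = 0
  eq_mul : ∀ e ∈ total.source, φ e = (total e).2 * bCoord index (base (pr e))
  division : ∀ f : C^∞⟮𝓡 n, M; ℝ⟯, (∀ x ∈ Z, f x = 0) →
    ∃ g : M → ℝ, ContMDiffOn (𝓡 n) 𝓘(ℝ, ℝ) ∞ g base.source ∧
      ∀ x ∈ base.source, f x = g x * bCoord index (base x)

variable {I : ModelWithCorners ℝ E H} {N : Type*} [TopologicalSpace N] [ChartedSpace H N]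
  {Z : Set M} {pr : N → M} {φ : N → ℝ}

namespace BChart

variable (B : BChart n I Z pr φ)

theorem mem_source {e : N} (he : pr e ∈ B.base.source) : e ∈ B.total.source := by
  rw [B.source_eq]; exact he

theorem base_mem {e : N} (he : e ∈ B.total.source) : pr e ∈ B.base.source := by
  rw [B.source_eq] at he; exact he

theorem snd_ne_zero {e : N} (he : e ∈ B.total.source) : (B.total e).2 ≠ 0 := by
  have h1 := B.total.map_source he
  rw [B.target_eq] at h1
  exact h1.2

theorem mem_target {x : M} (hx : x ∈ B.base.source) {t : ℝ} (ht : t ≠ 0) :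
    (B.base x, t) ∈ B.total.target := by
  rw [B.target_eq]
  exact ⟨B.base.map_source hx, ht⟩

theorem symm_mem {x : M} (hx : x ∈ B.base.source) {t : ℝ} (ht : t ≠ 0) :
    B.total.symm (B.base x, t) ∈ B.total.source := B.total.map_target (B.mem_target hx ht)

theorem total_symm {x : M} (hx : x ∈ B.base.source) {t : ℝ} (ht : t ≠ 0) :
    B.total (B.total.symm (B.base x, t)) = (B.base x, t) :=
  B.total.right_inv (B.mem_target hx ht)

theorem pr_symm {x : M} (hx : x ∈ B.base.source) {t : ℝ} (ht : t ≠ 0) :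
    pr (B.total.symm (B.base x, t)) = x := by
  have h1 := B.fst_eq _ (B.symm_mem hx ht)
  rw [B.total_symm hx ht] at h1
  exact (B.base.injOn hx (B.base_mem (B.symm_mem hx ht)) h1).symm

theorem eq_of_eq {e e' : N} (he : e ∈ B.total.source) (hpr : pr e = pr e')
    (h2 : (B.total e).2 = (B.total e').2) : e = e' := by
  have he' : e' ∈ B.total.source := B.mem_source (hpr ▸ B.base_mem he)
  refine B.total.injOn he he' (Prod.ext ?_ h2)
  rw [B.fst_eq e he, B.fst_eq e' he', hpr]

theorem mem_iff_eq_zero {e : N} (he : e ∈ B.total.source) : pr e ∈ Z ↔ φ e = 0 := by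
  rw [B.mem_iff _ (B.base_mem he), B.eq_mul e he, mul_eq_zero, or_iff_right (B.snd_ne_zero he)]

theorem contMDiffAt_pr {e : N} (he : e ∈ B.total.source) : ContMDiffAt I (𝓡 n) ∞ pr e := by
  have h1 := B.total.contMDiffOn.contMDiffAt (B.total.open_source.mem_nhds he)
  have h2 : ContMDiffAt I 𝓘(ℝ, EuclideanSpace ℝ (Fin n)) ∞ (Prod.fst ∘ B.total) e :=
    ContMDiffAt.comp e contDiff_fst.contMDiff.contMDiffAt h1
  have h3 : (B.total e).1 ∈ B.base.target := by
    rw [B.fst_eq e he]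
    exact B.base.map_source (B.base_mem he)
  have h4 := B.base.symm.contMDiffOn.contMDiffAt (B.base.open_target.mem_nhds h3)
  refine (h4.comp e h2).congr_of_eventuallyEq ?_
  filter_upwards [B.total.open_source.mem_nhds he] with e' he'
  change pr e' = B.base.symm ((B.total e').1)
  rw [B.fst_eq e' he']
  exact (B.base.left_inv (B.base_mem he')).symm

theorem contMDiffAt_symm {x : M} (hx : x ∈ B.base.source) {t : M → ℝ}
    (hts : ContMDiffAt (𝓡 n) 𝓘(ℝ, ℝ) ∞ t x) (ht : t x ≠ 0) :
    ContMDiffAt (𝓡 n) I ∞ (fun y => B.total.symm (B.base y, t y)) x := by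
  have h1 := B.base.contMDiffOn.contMDiffAt (B.base.open_source.mem_nhds hx)
  have h2 : ContMDiffAt (𝓡 n) 𝓘(ℝ, EuclideanSpace ℝ (Fin n) × ℝ) ∞
      (fun y => (B.base y, t y)) x := h1.prodMk_space hts
  exact ContMDiffAt.comp x (B.total.symm.contMDiffOn.contMDiffAt
    (B.total.open_target.mem_nhds (B.mem_target hx ht))) h2

/-- Freezing the fibre coordinate at its value at `e` gives a local section of `pr` through `e`,
hence a right inverse of the differential. -/
theorem surjective_mfderiv_pr {e : N} (he : e ∈ B.total.source) :
    Function.Surjective (mfderiv I (𝓡 n) pr e) := by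
  have hx := B.base_mem he
  have ht := B.snd_ne_zero he
  have he' : B.total.symm (B.base (pr e), (B.total e).2) = e := by
    rw [← B.fst_eq e he]
    exact B.total.left_inv he
  have h1 := B.contMDiffAt_symm hx (t := fun _ => (B.total e).2) contMDiffAt_const ht
  have h2 := B.contMDiffAt_pr he
  have h3 : HasMFDerivAt (𝓡 n) (𝓡 n)
      (pr ∘ fun y => B.total.symm (B.base y, (B.total e).2)) (pr e) _ :=
    HasMFDerivAt.comp (I' := I) (pr e) (by
      have := (h2.mdifferentiableAt (by simp)).hasMFDerivAt
      convert! this using 1) (h1.mdifferentiableAt (by simp)).hasMFDerivAt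
  have h4 : (pr ∘ fun y => B.total.symm (B.base y, (B.total e).2)) =ᶠ[𝓝 (pr e)] id := by
    filter_upwards [B.base.open_source.mem_nhds hx] with y hy using B.pr_symm hy ht
  have h5 := hasMFDerivAt_unique (h3.congr_of_eventuallyEq h4.symm) (hasMFDerivAt_id (pr e))
  intro v
  exact ⟨_, DFunLike.congr_fun h5 v⟩

/-- A chart straightening `φ`. -/
def straight : PartialDiffeomorph I 𝓘(ℝ, EuclideanSpace ℝ (Fin n) × ℝ) N
    (EuclideanSpace ℝ (Fin n) × ℝ) ∞ :=
  B.index.elim B.total fun i => B.total.trans (swapDiffeo i)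

/-- If `r = 1`, then `φ` is already the fibre coordinate; if `r = y i`, the swap makes `t * y i` the
last coordinate. The swap is defined at every point of the chart, including those over `Z`, because
`t` never vanishes. -/
theorem straight_spec {e : N} (he : e ∈ B.total.source) :
    e ∈ B.straight.source ∧ ∀ e' ∈ B.straight.source, (B.straight e').2 = φ e' := by
  have h1 := B.eq_mul
  unfold straight
  cases hi : B.index with
  | none =>
    rw [hi] at h1
    exact ⟨he, fun e' he' => by rw [h1 e' he']; exact (mul_one _).symm⟩
  | some i =>
    rw [hi] at h1
    refine ⟨⟨he, B.snd_ne_zero he⟩, fun e' he' => ?_⟩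
    rw [h1 e' he'.1, ← B.fst_eq e' he'.1]
    rfl

end BChart

theorem isStraightenable_of_bChart (hB : ∀ x : M, ∃ B : BChart n I Z pr φ, x ∈ B.base.source) :
    IsStraightenable I n φ := by
  intro e
  obtain ⟨B, hx⟩ := hB (pr e)
  exact ⟨B.straight, B.straight_spec (B.mem_source hx)⟩

end BCharts

/-! ### Leaves away from `Z` and the complement of `Z`. -/

section BChartLeaves

variable {n : ℕ} {M : Type u} [TopologicalSpace M] [ChartedSpace (EuclideanSpace ℝ (Fin n)) M]
  [IsManifold (𝓡 n) ∞ M]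
  {E : Type*} [NormedAddCommGroup E] [NormedSpace ℝ E] {H : Type*} [TopologicalSpace H]
  {I : ModelWithCorners ℝ E H} {N : Type v} [TopologicalSpace N] [ChartedSpace H N]
  [IsManifold I ∞ N] {Z : Set M} {pr : N → M} {φ : N → ℝ}

namespace BChart

variable (B : BChart n I Z pr φ)

theorem diffEquiv_fst {e : N} (he : e ∈ B.total.source) (w : TangentSpace I e) :
    (diffEquiv B.total he w).1 = diffEquiv B.base (B.base_mem he) (mfderiv I (𝓡 n) pr e w) := by
  have h1 : HasMFDerivAt I 𝓘(ℝ, EuclideanSpace ℝ (Fin n)) (Prod.fst ∘ B.total) e _ :=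
    (ContinuousLinearMap.fst ℝ (EuclideanSpace ℝ (Fin n)) ℝ).hasMFDerivAt.comp e
      (B.total.mdifferentiableAt (by simp) he).hasMFDerivAt
  have h2 : HasMFDerivAt I 𝓘(ℝ, EuclideanSpace ℝ (Fin n)) (B.base ∘ pr) e _ :=
    HasMFDerivAt.comp e (B.base.mdifferentiableAt (by simp) (B.base_mem he)).hasMFDerivAt
      ((B.contMDiffAt_pr he).mdifferentiableAt (by simp)).hasMFDerivAt
  have h3 : (Prod.fst ∘ B.total) =ᶠ[𝓝 e] (B.base ∘ pr) := by
    filter_upwards [B.total.open_source.mem_nhds he] with e' he' using B.fst_eq e' he'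
  exact DFunLike.congr_fun (hasMFDerivAt_unique h1 (h2.congr_of_eventuallyEq h3)) w

/-- The Leibniz rule `dφ = t dr + r dt`. -/
theorem mvfderiv_eq {e : N} (he : e ∈ B.total.source) (w : TangentSpace I e) :
    mvfderiv I φ e w = (B.total e).2 * bCoordDeriv B.index (diffEquiv B.total he w).1 +
      bCoord B.index (B.base (pr e)) * (diffEquiv B.total he w).2 := by
  have h0 : HasFDerivAt (fun p : EuclideanSpace ℝ (Fin n) × ℝ => p.2 * bCoord B.index p.1)
      ((B.total e).2 • ((bCoordDeriv B.index).comp (ContinuousLinearMap.fst ℝ _ ℝ)) +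
        bCoord B.index (B.total e).1 • ContinuousLinearMap.snd ℝ _ ℝ) (B.total e) :=
    hasFDerivAt_snd.mul ((hasFDerivAt_bCoord B.index _).comp _ hasFDerivAt_fst)
  have h1 : HasMFDerivAt I 𝓘(ℝ, ℝ)
      ((fun p : EuclideanSpace ℝ (Fin n) × ℝ => p.2 * bCoord B.index p.1) ∘ B.total) e _ :=
    HasMFDerivAt.comp e h0.hasMFDerivAt (B.total.mdifferentiableAt (by simp) he).hasMFDerivAt
  have h2 : φ =ᶠ[𝓝 e]
      ((fun p : EuclideanSpace ℝ (Fin n) × ℝ => p.2 * bCoord B.index p.1) ∘ B.total) := by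
    filter_upwards [B.total.open_source.mem_nhds he] with e' he'
    rw [B.eq_mul e' he', ← B.fst_eq e' he']
    rfl
  have h3 := (h1.congr_of_eventuallyEq h2).mfderiv
  rw [← B.fst_eq e he]
  exact DFunLike.congr_fun h3 w

/-- For a vertical vector the Leibniz rule leaves `dφ = r dt`, and `r ≠ 0` off `Z`. So the leaves
are transverse to the fibres there. -/
theorem eq_zero_of_mfderiv_eq_zero {e : N} (he : e ∈ B.total.source) (hZ : pr e ∉ Z)
    {w : TangentSpace I e} (hφ : mvfderiv I φ e w = 0) (hpr : mfderiv I (𝓡 n) pr e w = 0) :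
    w = 0 := by
  have h1 := B.diffEquiv_fst he w
  rw [hpr, map_zero] at h1
  have h2 := B.mvfderiv_eq he w
  rw [hφ, h1, map_zero, mul_zero, zero_add, zero_eq_mul,
    or_iff_right (fun h => hZ ((B.mem_iff _ (B.base_mem he)).2 h))] at h2
  rw [← map_eq_zero_iff (diffEquiv B.total he) (diffEquiv B.total he).injective]
  exact Prod.ext h1 h2

/-- Off `Z` the factor `r` can be cancelled in `t * r`, so base point and level determine the fibre
coordinate. -/
theorem eq_of_pr_eq {e e' : N} (he : e ∈ B.total.source) (hZ : pr e ∉ Z) (hpr : pr e = pr e')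
    (hφ : φ e = φ e') : e = e' := by
  have he' : e' ∈ B.total.source := B.mem_source (hpr ▸ B.base_mem he)
  refine B.eq_of_eq he hpr ?_
  rw [B.eq_mul e he, B.eq_mul e' he', ← hpr] at hφ
  exact mul_right_cancel₀ (fun h => hZ ((B.mem_iff _ (B.base_mem he)).2 h)) hφ

end BChart

theorem contMDiff_of_bChart
    (hB : ∀ x : M, ∃ B : BChart n I Z pr φ, x ∈ B.base.source) :
    ContMDiff I (𝓡 n) ∞ pr := by
  intro e
  obtain ⟨B, hx⟩ := hB (pr e)
  exact B.contMDiffAt_pr (B.mem_source hx)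

/-- Over the complement of `Z`, every nonzero level set of `φ` is the image of a continuous
section. -/
theorem exists_section_of_bChart
    (hB : ∀ x : M, ∃ B : BChart n I Z pr φ, x ∈ B.base.source)
    {c : ℝ} (hc : c ≠ 0) :
    ∃ σ : M → N, ContinuousOn σ Zᶜ ∧ ∀ x ∉ Z, pr (σ x) = x ∧ φ (σ x) = c := by
  have hloc : ∀ x₀, ∃ B : BChart n I Z pr φ, x₀ ∈ B.base.source ∧
      ∀ x ∈ B.base.source, x ∉ Z →
        pr (B.total.symm (B.base x, c / bCoord B.index (B.base x))) = x ∧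
        φ (B.total.symm (B.base x, c / bCoord B.index (B.base x))) = c := by
    intro x₀
    obtain ⟨B, hx₀⟩ := hB x₀
    refine ⟨B, hx₀, fun x hx hxZ => ?_⟩
    have hr : bCoord B.index (B.base x) ≠ 0 := fun h => hxZ ((B.mem_iff x hx).2 h)
    have hd : c / bCoord B.index (B.base x) ≠ 0 := div_ne_zero hc hr
    refine ⟨B.pr_symm hx hd, ?_⟩
    rw [B.eq_mul _ (B.symm_mem hx hd), B.pr_symm hx hd, B.total_symm hx hd, div_mul_cancel₀ _ hr]
  choose B hB₀ hB₁ using hloc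
  refine ⟨fun x => (B x).total.symm
    ((B x).base x, c / bCoord (B x).index ((B x).base x)), fun x₀ hx₀ => ?_,
    fun x hx => hB₁ x x (hB₀ x) hx⟩
  have hr : bCoord (B x₀).index ((B x₀).base x₀) ≠ 0 :=
    fun h => hx₀ (((B x₀).mem_iff x₀ (hB₀ x₀)).2 h)
  have hb : ContMDiffAt (𝓡 n) 𝓘(ℝ, ℝ) ∞ (fun x => c / bCoord (B x₀).index ((B x₀).base x)) x₀ := by
    refine contMDiffAt_const.div₀ ?_ hr
    exact (contDiff_bCoord _).contMDiff.contMDiffAt.comp x₀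
      ((B x₀).base.contMDiffOn.contMDiffAt ((B x₀).base.open_source.mem_nhds (hB₀ x₀)))
  have h1 := ((B x₀).contMDiffAt_symm (hB₀ x₀) hb (div_ne_zero hc hr)).continuousAt
  refine h1.continuousWithinAt.congr_of_eventuallyEq_of_mem ?_ hx₀
  -- The section uses a chart depending on `x`. Near `x₀` it agrees with the formula in the single
  -- chart of `x₀`, since a fibre off `Z` contains only one point of a given level.
  filter_upwards [self_mem_nhdsWithin, mem_nhdsWithin_of_mem_nhds
    ((B x₀).base.open_source.mem_nhds (hB₀ x₀))] with x hx hx'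
  obtain ⟨h2, h3⟩ := hB₁ x₀ x hx' hx
  obtain ⟨h4, h5⟩ := hB₁ x x (hB₀ x) hx
  refine (B x).eq_of_pr_eq ((B x).mem_source (h4.symm ▸ hB₀ x)) (h4.symm ▸ hx) (h4.trans h2.symm)
    (h5.trans h3.symm)

theorem preimage_eq_level_zero
    (hB : ∀ x : M, ∃ B : BChart n I Z pr φ, x ∈ B.base.source) :
    pr ⁻¹' Z = {e | φ e = 0} := by
  ext e
  obtain ⟨B, hx⟩ := hB (pr e)
  exact B.mem_iff_eq_zero (B.mem_source hx)

variable [CompleteSpace E] [I.Boundaryless]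

/-- The leaves away from `Z` are diffeomorphic to the components of the complement of `Z`. -/
theorem exists_leaf_diffeomorph
    (hB : ∀ x : M, ∃ B : BChart n I Z pr φ, x ∈ B.base.source)
    (hZ : IsClosed Z)
    (L : (levelFoliation (isStraightenable_of_bChart hB)).IntegralManifold) (hL : L.IsLeaf)
    (hLZ : ¬ ∃ e, pr e ∈ Z ∧ range L.incl = connectedComponentIn (pr ⁻¹' Z) e) :
    ∃ C : TopologicalSpace.Opens M, (∃ x ∈ Zᶜ, (C : Set M) = connectedComponentIn Zᶜ x) ∧
      Nonempty (L.carrier ≃ₘ^∞⟮𝓡 n, 𝓡 n⟯ C) := by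
  have h := isStraightenable_of_bChart hB
  have hpre := preimage_eq_level_zero hB
  have hpr := contMDiff_of_bChart hB
  obtain ⟨e₀, he₀⟩ := (levelFoliation_isLeafSet_iff h (range L.incl)).1 ⟨L, hL, rfl⟩
  have hmem : ∀ e, φ e = 0 ↔ pr e ∈ Z := fun e => (Set.ext_iff.1 hpre e).symm
  have hc : φ e₀ ≠ 0 := by
    intro hc
    refine hLZ ⟨e₀, (hmem e₀).1 hc, ?_⟩
    rw [he₀, hpre, hc]
  have hval : ∀ p, φ (L.incl p) = φ e₀ := by
    intro p
    have : L.incl p ∈ connectedComponentIn {e' | φ e' = φ e₀} e₀ := he₀ ▸ mem_range_self p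
    exact connectedComponentIn_subset {e' | φ e' = φ e₀} e₀ this
  have hnZ : ∀ p, pr (L.incl p) ∉ Z := fun p hp => hc ((hval p).symm.trans ((hmem _).2 hp))
  have hx₀ : pr e₀ ∈ Zᶜ := fun hx => hc ((hmem _).2 hx)
  have : LocallyConnectedSpace M := ChartedSpace.locallyConnectedSpace (EuclideanSpace ℝ (Fin n)) M
  let C : TopologicalSpace.Opens M :=
    ⟨connectedComponentIn Zᶜ (pr e₀), hZ.isOpen_compl.connectedComponentIn⟩
  refine ⟨C, ⟨pr e₀, hx₀, rfl⟩, ?_⟩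
  have hconn : IsPreconnected (range (pr ∘ L.incl)) :=
    isPreconnected_range (hpr.continuous.comp L.smooth.continuous)
  obtain ⟨p₀, hp₀⟩ : e₀ ∈ range L.incl := he₀ ▸ mem_connectedComponentIn rfl
  have hsub : range (pr ∘ L.incl) ⊆ connectedComponentIn Zᶜ (pr e₀) := by
    refine hconn.subset_connectedComponentIn ⟨p₀, congrArg pr hp₀⟩ ?_
    rintro _ ⟨p, rfl⟩
    exact hnZ p
  let G : L.carrier → C := fun p => ⟨pr (L.incl p), hsub (mem_range_self p)⟩
  have hGs : ContMDiff (𝓡 n) (𝓡 n) ∞ G :=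
    (ContMDiff.subtypeVal_comp_iff C G).1 (hpr.comp L.smooth)
  have hinj : ∀ p, Function.Injective (mfderiv (𝓡 n) (𝓡 n) G p) := by
    intro p
    have h1 : HasMFDerivAt (𝓡 n) (𝓡 n) (pr ∘ L.incl) p _ :=
      HasMFDerivAt.comp p (hpr.mdifferentiable (by simp) _).hasMFDerivAt
        (L.smooth.mdifferentiable (by simp) p).hasMFDerivAt
    have h2 : HasMFDerivAt (𝓡 n) (𝓡 n) (pr ∘ L.incl) p _ :=
      HasMFDerivAt.comp (g := (Subtype.val : C → M)) p
        (contMDiff_subtype_val.mdifferentiable (n := ∞) (by simp) (G p)).hasMFDerivAt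
        (hGs.mdifferentiable (by simp) p).hasMFDerivAt
    have h3 := hasMFDerivAt_unique h1 h2
    refine (injective_iff_map_eq_zero _).2 fun v hv => ?_
    have h4 : mfderiv I (𝓡 n) pr (L.incl p) (mfderiv (𝓡 n) I L.incl p v) = 0 := by
      refine (DFunLike.congr_fun h3 v).trans ?_
      exact (congrArg (mfderiv (𝓡 n) (𝓡 n) (Subtype.val : C → M) (G p)) hv).trans (map_zero _)
    obtain ⟨B, hx⟩ := hB (pr (L.incl p))
    have h5 : mfderiv (𝓡 n) I L.incl p v ∈ (levelFoliation h).tangent (L.incl p) := by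
      have := L.range_mfderiv p
      rw [← this]
      exact ⟨v, rfl⟩
    have h6 := B.eq_zero_of_mfderiv_eq_zero (B.mem_source hx) (hnZ p) h5 h4
    exact L.immersive p (h6.trans (map_zero _).symm)
  have hbij : ∀ p, Function.Bijective (mfderiv (𝓡 n) (𝓡 n) G p) := by
    intro p
    have key : ∀ A : EuclideanSpace ℝ (Fin n) →L[ℝ] EuclideanSpace ℝ (Fin n),
        Function.Injective A → Function.Bijective A := fun A hA =>
      ⟨hA, (LinearMap.injective_iff_surjective (f := A.toLinearMap)).1 hA⟩
    exact key _ (hinj p)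
  have hGinj : Function.Injective G := by
    intro p q hpq
    apply L.injective
    obtain ⟨B, hx⟩ := hB (pr (L.incl p))
    exact B.eq_of_pr_eq (B.mem_source hx) (hnZ p) (congrArg Subtype.val hpq)
      ((hval p).trans (hval q).symm)
  -- The section of level `φ e₀` passes through `e₀`, and its image over the connected set `C` stays
  -- in that level, hence in the leaf.
  have hGsurj : Function.Surjective G := by
    rintro ⟨x, hx⟩
    obtain ⟨σ, hσ, hσ'⟩ := exists_section_of_bChart hB hc
    have hCZ : connectedComponentIn Zᶜ (pr e₀) ⊆ Zᶜ := connectedComponentIn_subset _ _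
    have h0 : σ (pr e₀) = e₀ := by
      obtain ⟨B, hxB⟩ := hB (pr e₀)
      exact (B.eq_of_pr_eq (B.mem_source hxB) hx₀ (hσ' _ hx₀).1.symm (hσ' _ hx₀).2.symm).symm
    have h1 : σ '' connectedComponentIn Zᶜ (pr e₀) ⊆ range L.incl := by
      rw [he₀]
      refine (isPreconnected_connectedComponentIn.image σ
        (hσ.mono hCZ)).subset_connectedComponentIn ⟨_, mem_connectedComponentIn hx₀, h0⟩ ?_
      rintro _ ⟨y, hy, rfl⟩
      exact (hσ' y (hCZ hy)).2
    obtain ⟨p, hp⟩ := h1 ⟨x, hx, rfl⟩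
    exact ⟨p, Subtype.ext ((congrArg pr hp).trans (hσ' x (hCZ hx)).1)⟩
  exact ⟨(isLocalDiffeomorph_of_bijective_mfderiv hGs hbij).diffeomorphOfBijective
    ⟨hGinj, hGsurj⟩⟩

end BChartLeaves

/-! ### Local frames of the b-tangent bundle and their coefficient forms. -/

section BFrames

variable {n : ℕ}

/-- The factor by which the `k`-th coordinate field is multiplied in the frame of the b-tangent
bundle. -/
def bWeight (i : Option (Fin n)) (k : Fin n) (y : EuclideanSpace ℝ (Fin n)) : ℝ :=
  if i = some k then y k else 1

theorem contDiff_bWeight (i : Option (Fin n)) (k : Fin n) : ContDiff ℝ ∞ (bWeight i k) := by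
  unfold bWeight
  split_ifs
  · exact (EuclideanSpace.proj k : EuclideanSpace ℝ (Fin n) →L[ℝ] ℝ).contDiff
  · exact contDiff_const

theorem bWeight_ne_zero {i : Option (Fin n)} {y : EuclideanSpace ℝ (Fin n)} (k : Fin n)
    (hy : bCoord i y ≠ 0) : bWeight i k y ≠ 0 := by
  unfold bWeight
  split_ifs with h
  · subst h; exact hy
  · exact one_ne_zero

/-- Where `y i = 0` the field `y i ∂_i` vanishes, and the other `∂_k` do not differentiate `y i`.
Without an index, `r = 1` has no zeros. -/
theorem bWeight_mul_bCoordDeriv {i : Option (Fin n)} {y : EuclideanSpace ℝ (Fin n)} (k : Fin n)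
    (hy : bCoord i y = 0) :
    bWeight i k y * bCoordDeriv i (EuclideanSpace.single k (1 : ℝ)) = 0 := by
  cases i with
  | none => simp [bCoord] at hy
  | some j =>
    by_cases h : j = k
    · subst h
      change y j = 0 at hy
      simp [bWeight, hy]
    · simp [bWeight, bCoordDeriv, h]

/-- The coefficients, with respect to the frame of the b-tangent bundle, of a vector with
components `p` that annihilates `t * bCoord i y`. -/
def bCoeff (i : Option (Fin n)) (k : Fin n) (t : ℝ) : EuclideanSpace ℝ (Fin n) × ℝ →L[ℝ] ℝ :=
  if i = some k then -t⁻¹ • ContinuousLinearMap.snd ℝ (EuclideanSpace ℝ (Fin n)) ℝ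
  else (EuclideanSpace.proj k).comp (ContinuousLinearMap.fst ℝ (EuclideanSpace ℝ (Fin n)) ℝ)

/-- Dividing `t * p i + y i * p' = 0` by `t`, where `p'` is the last component of `p`, gives `p i =
(-p' / t) * y i`: the component transverse to `Z` is divisible by `y i` with a quotient that stays
smooth over `Z`. This is the source of `Ψ`. -/
theorem bCoeff_mul_bWeight {i : Option (Fin n)} (k : Fin n) {t : ℝ} (ht : t ≠ 0)
    {y : EuclideanSpace ℝ (Fin n)} {p : EuclideanSpace ℝ (Fin n) × ℝ}
    (hp : t * bCoordDeriv i p.1 + bCoord i y * p.2 = 0) :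
    bCoeff i k t p * bWeight i k y = p.1 k := by
  unfold bCoeff bWeight
  split_ifs with h
  · subst h
    change t * p.1 k + y k * p.2 = 0 at hp
    change -t⁻¹ * p.2 * y k = p.1 k
    field_simp
    linarith
  · exact mul_one _

theorem exists_bCoeff_eq (i : Option (Fin n)) {t : ℝ} (ht : t ≠ 0)
    (y : EuclideanSpace ℝ (Fin n)) (v : Fin n → ℝ) :
    ∃ p : EuclideanSpace ℝ (Fin n) × ℝ, t * bCoordDeriv i p.1 + bCoord i y * p.2 = 0 ∧
      ∀ k, bCoeff i k t p = v k := by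
  -- The last component `-t * v i` solves `-p' / t = v i`; it works also where `y i = 0`, so the
  -- coefficient forms are surjective over `Z` as well.
  refine ⟨(WithLp.toLp 2 fun k => v k * bWeight i k y, i.elim 0 fun k => -t * v k), ?_, ?_⟩
  · cases i with
    | none => simp [bCoordDeriv]
    | some j =>
      change t * (v j * bWeight (some j) j y) + y j * (-t * v j) = 0
      simp [bWeight]
      ring
  · intro k
    unfold bCoeff
    split_ifs with h
    · subst h
      change -t⁻¹ * (-t * v k) = v k
      field_simp
    · change v k * bWeight i k y = v k
      simp [bWeight, h]

theorem sum_smul_symm_single {V : Type*} [AddCommGroup V] [Module ℝ V] [TopologicalSpace V]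
    (D : V ≃L[ℝ] EuclideanSpace ℝ (Fin n)) (w : V) :
    w = ∑ k, (D w) k • D.symm (EuclideanSpace.single k (1 : ℝ)) := by
  rw [← D.injective.eq_iff, map_sum]
  simp only [map_smul, D.apply_symm_apply]
  ext i
  simp [Finset.sum_apply, Pi.single_apply]

theorem linearIndependent_smul_symm_single {V : Type*} [AddCommGroup V] [Module ℝ V]
    [TopologicalSpace V] (D : V ≃L[ℝ] EuclideanSpace ℝ (Fin n)) {c : Fin n → ℝ}
    (hc : ∀ k, c k ≠ 0) :
    LinearIndependent ℝ fun k => c k • D.symm (EuclideanSpace.single k (1 : ℝ)) := by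
  rw [Fintype.linearIndependent_iff]
  intro g hg i
  have h1 := congrArg (fun w => D w i) hg
  simp only [map_sum, map_smul, D.apply_symm_apply, map_zero] at h1
  simpa [Finset.sum_apply, Pi.single_apply, hc i] using h1

variable {M : Type u} [TopologicalSpace M] [ChartedSpace (EuclideanSpace ℝ (Fin n)) M]
  [IsManifold (𝓡 n) ∞ M]
  {E : Type*} [NormedAddCommGroup E] [NormedSpace ℝ E] {H : Type*} [TopologicalSpace H]

/-- A local frame of the b-tangent bundle, together with the one-forms along the kernel of `dφ` that
express the vectors in this kernel through the frame. -/
structure BFrame (n : ℕ) {M : Type u} [TopologicalSpace M]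
    [ChartedSpace (EuclideanSpace ℝ (Fin n)) M] [IsManifold (𝓡 n) ∞ M]
    (I : ModelWithCorners ℝ E H) {N : Type*} [TopologicalSpace N] [ChartedSpace H N]
    [IsManifold I ∞ N] (Z : Set M) (pr : N → M) (φ : N → ℝ) where
  nhd : Set M
  isOpen_nhd : IsOpen nhd
  field : Fin n → bFields n Z
  form : Fin n → ∀ e : N, TangentSpace I e →L[ℝ] ℝ
  field_indep : ∀ x ∈ nhd, x ∉ Z → LinearIndependent ℝ fun k => (field k).1 x
  exists_coeff : ∀ (X : bFields n Z), ∀ x ∈ nhd, ∃ g : Fin n → C^∞⟮𝓡 n, M; ℝ⟯,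
    ∀ᶠ y in 𝓝 x, X.1 y = ∑ k, g k y • (field k).1 y
  sum_form : ∀ e, pr e ∈ nhd → ∀ w, mvfderiv I φ e w = 0 →
    mfderiv I (𝓡 n) pr e w = ∑ k, form k e w • (field k).1 (pr e)
  form_smooth : ∀ k e, pr e ∈ nhd → ∀ Y : ∀ e : N, TangentSpace I e,
    ContMDiffAt I I.tangent ∞ (fun e => (⟨e, Y e⟩ : TangentBundle I N)) e →
    ContMDiffAt I 𝓘(ℝ, ℝ) ∞ (fun e => form k e (Y e)) e
  form_surjective : ∀ e, pr e ∈ nhd → ∀ v : Fin n → ℝ, ∃ w, mvfderiv I φ e w = 0 ∧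
    ∀ k, form k e w = v k

variable {I : ModelWithCorners ℝ E H} {N : Type*} [TopologicalSpace N] [ChartedSpace H N]
  [IsManifold I ∞ N] {Z : Set M} {pr : N → M} {φ : N → ℝ}

namespace BChart

variable (B : BChart n I Z pr φ)

/-- The fields `∂_k`, or `x_k ∂_k` for the coordinate that defines `Z`. -/
def coordField (k : Fin n) (x : M) : TangentSpace (𝓡 n) x :=
  bWeight B.index k (B.base x) • mpullback (𝓡 n) 𝓘(ℝ, EuclideanSpace ℝ (Fin n)) B.base
    (fun _ => EuclideanSpace.single k (1 : ℝ)) x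

theorem coordField_eq (k : Fin n) {x : M} (hx : x ∈ B.base.source) :
    B.coordField k x = bWeight B.index k (B.base x) •
      (diffEquiv B.base hx).symm (EuclideanSpace.single k (1 : ℝ)) :=
  congrArg (bWeight B.index k (B.base x) • ·) (congrFun (congrArg DFunLike.coe
    (ContinuousLinearMap.inverse_equiv (diffEquiv B.base hx))) _)

theorem contMDiffOn_coordField (k : Fin n) :
    ContMDiffOn (𝓡 n) (𝓡 n).tangent ∞
      (fun x => (⟨x, B.coordField k x⟩ : TangentBundle (𝓡 n) M)) B.base.source := by
  intro x hx
  have h1 := B.base.contMDiffOn.contMDiffAt (B.base.open_source.mem_nhds hx)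
  have h2 : ContMDiffAt (𝓡 n) 𝓘(ℝ, ℝ) ∞ (fun x => bWeight B.index k (B.base x)) x :=
    (contDiff_bWeight _ _).contMDiff.contMDiffAt.comp x h1
  refine (h2.smul_section ?_).contMDiffWithinAt
  refine ContMDiffAt.mpullback_vectorField_preimage (n := ∞) (m := ∞) ?_ h1
    ⟨diffEquiv B.base hx, rfl⟩ (by simp)
  exact contMDiffAt_vectorSpace_iff_contDiffAt.2 contDiffAt_const

/-- A function vanishing on `Z` is locally `g * r`. At points of `Z` the Leibniz rule leaves only `g
dr`, and `dr` kills the weighted field. -/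
theorem coordField_mem_tangentTo (k : Fin n) {x : M} (hx : x ∈ B.base.source) (hxZ : x ∈ Z) :
    B.coordField k x ∈ tangentTo Z x := by
  intro f hf
  obtain ⟨g, hg, hfg⟩ := B.division f hf
  have hx0 : bCoord B.index (B.base x) = 0 := (B.mem_iff x hx).1 hxZ
  have h1 : HasMFDerivAt (𝓡 n) 𝓘(ℝ, ℝ) (bCoord B.index ∘ B.base) x _ :=
    HasMFDerivAt.comp x (hasFDerivAt_bCoord B.index (B.base x)).hasMFDerivAt
      (B.base.mdifferentiableAt (by simp) hx).hasMFDerivAt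
  have h2 : MDifferentiableAt (𝓡 n) 𝓘(ℝ, ℝ) g x :=
    (hg.contMDiffAt (B.base.open_source.mem_nhds hx)).mdifferentiableAt (by simp)
  have h3 : (f : M → ℝ) =ᶠ[𝓝 x] g * (bCoord B.index ∘ B.base) := by
    filter_upwards [B.base.open_source.mem_nhds hx] with y hy using hfg y hy
  have h4 : mvfderiv (𝓡 n) f x = mvfderiv (𝓡 n) (g * (bCoord B.index ∘ B.base)) x := by
    ext w
    exact DFunLike.congr_fun (h3.mfderiv_eq (I := 𝓡 n) (I' := 𝓘(ℝ, ℝ))) w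
  have h5 : mvfderiv (𝓡 n) (bCoord B.index ∘ B.base) x (B.coordField k x) = 0 := by
    have h6 : mvfderiv (𝓡 n) (bCoord B.index ∘ B.base) x (B.coordField k x) =
        bCoordDeriv B.index (diffEquiv B.base hx (B.coordField k x)) :=
      DFunLike.congr_fun h1.mfderiv _
    rw [h6, B.coordField_eq k hx, map_smul, ContinuousLinearEquiv.apply_symm_apply, map_smul,
      smul_eq_mul, bWeight_mul_bCoordDeriv k hx0]
  rw [h4, mvfderiv_mul h2 h1.mdifferentiableAt]
  simp [h5, hx0]

end BChart
end BFrames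

/-! ### Construction of the local frames. -/

section BFrameConstruction

variable {n : ℕ} {M : Type u} [TopologicalSpace M] [ChartedSpace (EuclideanSpace ℝ (Fin n)) M]
  [IsManifold (𝓡 n) ∞ M]
  {E : Type*} [NormedAddCommGroup E] [NormedSpace ℝ E] {H : Type*} [TopologicalSpace H]
  {I : ModelWithCorners ℝ E H} {N : Type*} [TopologicalSpace N] [ChartedSpace H N]
  [IsManifold I ∞ N] {Z : Set M} {pr : N → M} {φ : N → ℝ}

namespace BChart

variable (B : BChart n I Z pr φ) {χ : C^∞⟮𝓡 n, M; ℝ⟯} (hχ : tsupport χ ⊆ B.base.source)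

/-- The coordinate fields of the b-tangent bundle, cut off to global fields. -/
def frameField (k : Fin n) : bFields n Z where
  val := ⟨fun x => χ x • B.coordField k x, (χ.contMDiff.contMDiffOn).smul_section_of_tsupport
    B.base.open_source hχ (B.contMDiffOn_coordField k)⟩
  property x hx := by
    by_cases hxs : x ∈ B.base.source
    · exact (tangentTo Z x).smul_mem _ (B.coordField_mem_tangentTo k hxs hx)
    · have h0 : χ x = 0 := image_eq_zero_of_notMem_tsupport fun h => hxs (hχ h)
      change χ x • B.coordField k x ∈ tangentTo Z x
      rw [h0, zero_smul]
      exact (tangentTo Z x).zero_mem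

theorem frameField_apply (k : Fin n) {x : M} (hx : x ∈ B.base.source) (h1 : χ x = 1) :
    (B.frameField hχ k).1 x = bWeight B.index k (B.base x) •
      (diffEquiv B.base hx).symm (EuclideanSpace.single k (1 : ℝ)) := by
  rw [← B.coordField_eq k hx]
  change χ x • B.coordField k x = _
  rw [h1, one_smul]

/-- Tangency of `X` makes the derivative along `X` of the cut-off coordinate `y i` vanish on `Z`, so
`division` applies to it. Where the cutoff is locally `1`, this derivative is the `i`-th component
of `X`. -/
theorem exists_div_coord (hχ : tsupport χ ⊆ B.base.source) {i : Fin n} (hi : B.index = some i)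
    (X : bFields n Z) :
    ∃ g : M → ℝ, ContMDiffOn (𝓡 n) 𝓘(ℝ, ℝ) ∞ g B.base.source ∧
      ∀ x (hx : x ∈ B.base.source), (∀ᶠ y in 𝓝 x, χ y = 1) →
        diffEquiv B.base hx (X.1 x) i = g x * B.base x i := by
  have hs : ContMDiff (𝓡 n) 𝓘(ℝ, ℝ) ∞ (fun y => χ y • B.base y i) :=
    contMDiff_smul_of_tsupport B.base.open_source hχ
      ((EuclideanSpace.proj i : EuclideanSpace ℝ (Fin n) →L[ℝ] ℝ).contMDiff.comp_contMDiffOn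
        B.base.contMDiffOn)
  let F : C^∞⟮𝓡 n, M; ℝ⟯ := ⟨_, hs⟩
  have hF : ∀ y ∈ Z, F y = 0 := by
    intro y hy
    change χ y • B.base y i = 0
    by_cases hys : y ∈ B.base.source
    · have := (B.mem_iff y hys).1 hy
      rw [hi] at this
      rw [show B.base y i = 0 from this, smul_zero]
    · rw [image_eq_zero_of_notMem_tsupport fun h => hys (hχ h), zero_smul]
  obtain ⟨g, hg, hgF⟩ := B.division ⟨_, contMDiff_lieDeriv F X.1⟩ fun x hx => X.2 x hx F hF
  refine ⟨g, hg, fun x hx h1 => ?_⟩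
  have h2 : HasMFDerivAt (𝓡 n) 𝓘(ℝ, ℝ)
      ((EuclideanSpace.proj i : EuclideanSpace ℝ (Fin n) →L[ℝ] ℝ) ∘ B.base) x _ :=
    (EuclideanSpace.proj i : EuclideanSpace ℝ (Fin n) →L[ℝ] ℝ).hasMFDerivAt.comp x
      (B.base.mdifferentiableAt (by simp) hx).hasMFDerivAt
  have h3 : (F : M → ℝ) =ᶠ[𝓝 x] (EuclideanSpace.proj i : EuclideanSpace ℝ (Fin n) →L[ℝ] ℝ) ∘
      B.base := by
    filter_upwards [h1] with y hy
    change χ y • B.base y i = B.base y i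
    rw [hy, one_smul]
  have h4 := hgF x hx
  rw [hi] at h4
  refine Eq.trans ?_ h4
  exact (DFunLike.congr_fun (h2.congr_of_eventuallyEq h3).mfderiv (X.1 x)).symm

/-- Only the component transverse to `Z` needs division; the others have weight `1` and are their
own coefficients. The cutoff makes the coefficient a global function. -/
theorem exists_frame_coeff (hχ : tsupport χ ⊆ B.base.source) (X : bFields n Z) (k : Fin n) :
    ∃ g : C^∞⟮𝓡 n, M; ℝ⟯, ∀ x (hx : x ∈ B.base.source), (∀ᶠ y in 𝓝 x, χ y = 1) →
      diffEquiv B.base hx (X.1 x) k = g x * bWeight B.index k (B.base x) := by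
  by_cases hk : B.index = some k
  · obtain ⟨g, hg, hgX⟩ := B.exists_div_coord hχ hk X
    refine ⟨⟨_, contMDiff_smul_of_tsupport B.base.open_source hχ hg⟩, fun x hx h1 => ?_⟩
    change _ = (χ x • g x) * _
    rw [h1.self_of_nhds, one_smul, hgX x hx h1, bWeight, if_pos hk]
  · have hg : ContMDiffOn (𝓡 n) 𝓘(ℝ, ℝ) ∞
        (fun y => mvfderiv (𝓡 n) B.base y (X.1 y) k) B.base.source := by
      intro y hy
      have h1 := contMDiffAt_mvfderiv_apply (B.base.contMDiffOn.contMDiffAt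
        (B.base.open_source.mem_nhds hy)) X.1.contMDiff.contMDiffAt
      exact ((EuclideanSpace.proj k :
        EuclideanSpace ℝ (Fin n) →L[ℝ] ℝ).contMDiff.contMDiffAt.comp y h1).contMDiffWithinAt
    refine ⟨⟨_, contMDiff_smul_of_tsupport B.base.open_source hχ hg⟩, fun x hx h1 => ?_⟩
    change _ = (χ x • mvfderiv (𝓡 n) B.base x (X.1 x) k) * _
    rw [h1.self_of_nhds, one_smul, bWeight, if_neg hk, mul_one]
    rfl

/-- The frame of the b-tangent bundle given by adapted coordinates, on an open set where the cutoff
function is `1`. -/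
def frame {U : Set M} (hU : IsOpen U) (hUs : U ⊆ B.base.source) (h1 : ∀ x ∈ U, χ x = 1) :
    BFrame n I Z pr φ where
  nhd := U
  isOpen_nhd := hU
  field := B.frameField hχ
  form k e := (bCoeff B.index k (B.total e).2).comp (mvfderiv I B.total e)
  field_indep x hx hxZ := by
    simp only [B.frameField_apply hχ _ (hUs hx) (h1 x hx)]
    exact linearIndependent_smul_symm_single _ fun k =>
      bWeight_ne_zero k fun h => hxZ ((B.mem_iff x (hUs hx)).2 h)
  exists_coeff X x hx := by
    choose g hg using B.exists_frame_coeff hχ X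
    refine ⟨g, ?_⟩
    filter_upwards [hU.mem_nhds hx] with y hy
    have hy1 : ∀ᶠ z in 𝓝 y, χ z = 1 := by
      filter_upwards [hU.mem_nhds hy] with z hz using h1 z hz
    rw [sum_smul_symm_single (diffEquiv B.base (hUs hy)) (X.1 y)]
    refine Finset.sum_congr rfl fun k _ => ?_
    rw [hg k y (hUs hy) hy1, B.frameField_apply hχ k (hUs hy) (h1 y hy), smul_smul]
  sum_form e he w hw := by
    have hs := B.mem_source (hUs he)
    rw [sum_smul_symm_single (diffEquiv B.base (hUs he)) (mfderiv I (𝓡 n) pr e w)]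
    refine Finset.sum_congr rfl fun k _ => ?_
    rw [B.frameField_apply hχ k (hUs he) (h1 _ he), smul_smul, ← B.diffEquiv_fst hs]
    congr 1
    rw [B.mvfderiv_eq hs] at hw
    exact (bCoeff_mul_bWeight k (B.snd_ne_zero hs) hw).symm
  form_smooth k e he Y hY := by
    have hs := B.mem_source (hUs he)
    have h2 := B.total.contMDiffOn.contMDiffAt (B.total.open_source.mem_nhds hs)
    have h3 := contMDiffAt_mvfderiv_apply h2 hY
    have h4 : ContMDiffAt I 𝓘(ℝ, ℝ) ∞ (fun e => (B.total e).2) e :=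
      contDiff_snd.contMDiff.contMDiffAt.comp e h2
    by_cases hk : B.index = some k
    · have h5 : ContMDiffAt I 𝓘(ℝ, ℝ) ∞ (fun e => (mvfderiv I B.total e (Y e)).2) e :=
        contDiff_snd.contMDiff.contMDiffAt.comp e h3
      simp only [bCoeff, if_pos hk]
      exact (h4.inv₀ (B.snd_ne_zero hs)).neg.smul h5
    · simp only [bCoeff, if_neg hk]
      exact ((EuclideanSpace.proj k : EuclideanSpace ℝ (Fin n) →L[ℝ] ℝ).comp
        (ContinuousLinearMap.fst ℝ _ ℝ)).contMDiff.contMDiffAt.comp e h3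
  form_surjective e he v := by
    have hs := B.mem_source (hUs he)
    obtain ⟨p, hp, hpv⟩ := exists_bCoeff_eq B.index (B.snd_ne_zero hs) (B.base (pr e)) v
    refine ⟨(diffEquiv B.total hs).symm p, ?_, fun k => ?_⟩
    · rw [B.mvfderiv_eq hs, ContinuousLinearEquiv.apply_symm_apply]
      exact hp
    · rw [← hpv k]
      exact congrArg (bCoeff B.index k (B.total e).2)
        ((diffEquiv B.total hs).apply_symm_apply p)

end BChart

theorem exists_bFrame [T2Space M] [SecondCountableTopology M]
    (hB : ∀ x : M, ∃ B : BChart n I Z pr φ, x ∈ B.base.source) (x : M) :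
    ∃ A : BFrame n I Z pr φ, x ∈ A.nhd := by
  obtain ⟨B, hx⟩ := hB x
  obtain ⟨χ, hχ1, hχ⟩ := exists_cutoff (n := n) B.base.open_source hx
  obtain ⟨U, hU, hUo, hxU⟩ := eventually_nhds_iff.1 hχ1
  exact ⟨B.frame hχ (hUo.inter B.base.open_source) inter_subset_right fun y hy => hU y hy.1,
    hxU, hx⟩

end BFrameConstruction

/-! ### Evaluation in the fibres `Γ / 𝔪_x Γ`. -/

section Evaluation

variable {n : ℕ} {M : Type u} [TopologicalSpace M] [ChartedSpace (EuclideanSpace ℝ (Fin n)) M]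
  [IsManifold (𝓡 n) ∞ M] {Z : Set M}

/-- The product of a smooth function and a vector field tangent to `Z`. -/
def smulField (f : C^∞⟮𝓡 n, M; ℝ⟯) (X : bFields n Z) : bFields n Z where
  val := ⟨fun x => f x • X.1 x, f.contMDiff.smul_section X.1.contMDiff⟩
  property x hx := (tangentTo Z x).smul_mem _ (X.2 x hx)

theorem bEval_eq_zero {x : M} {Y X : bFields n Z} {f : C^∞⟮𝓡 n, M; ℝ⟯} (hf : f x = 0)
    (hY : ∀ y, Y.1 y = f y • X.1 y) : bEval x Y = 0 :=
  (Submodule.Quotient.mk_eq_zero _).2 (Submodule.subset_span ⟨f, X, hf, hY⟩)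

/-- The difference of the two sides is the class of `(f - f x) • X`, whose coefficient vanishes at
`x`. -/
theorem bEval_smulField (x : M) (f : C^∞⟮𝓡 n, M; ℝ⟯) (X : bFields n Z) :
    bEval x (smulField f X) = f x • bEval x X := by
  rw [← map_smul, ← sub_eq_zero, ← map_sub]
  refine bEval_eq_zero (f := f - ContMDiffMap.const (f x)) (X := X) (sub_self _) fun y => ?_
  exact (sub_smul (f y) (f x) (X.1 y)).symm

variable [T2Space M] [SecondCountableTopology M]

/-- If `χ` is supported where `Y` vanishes and `χ x = 1`, then `Y = (1 - χ) • Y` belongs to `𝔪_x Γ`.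
So evaluation depends only on germs. -/
theorem bEval_eq_zero_of_eventually {x : M} {Y : bFields n Z} (hY : ∀ᶠ y in 𝓝 x, Y.1 y = 0) :
    bEval x Y = 0 := by
  obtain ⟨U, hU, hUo, hxU⟩ := eventually_nhds_iff.1 hY
  obtain ⟨χ, hχ1, hχ⟩ := exists_cutoff (n := n) hUo hxU
  refine bEval_eq_zero (f := ContMDiffMap.const 1 - χ) (X := Y) ?_ fun y => ?_
  · change 1 - χ x = 0
    rw [hχ1.self_of_nhds, sub_self]
  · change Y.1 y = (1 - χ y) • Y.1 y
    by_cases hy : y ∈ U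
    · rw [hU y hy, smul_zero]
    · rw [image_eq_zero_of_notMem_tsupport fun h => hy (hχ h), sub_zero, one_smul]

theorem bEval_eq_sum {ι : Type*} [Fintype ι] {x : M} {X : bFields n Z} {α : ι → bFields n Z}
    {g : ι → C^∞⟮𝓡 n, M; ℝ⟯} (h : ∀ᶠ y in 𝓝 x, X.1 y = ∑ k, g k y • (α k).1 y) :
    bEval x X = ∑ k, g k x • bEval x (α k) := by
  simp only [← bEval_smulField]
  rw [← map_sum, ← sub_eq_zero, ← map_sub]
  apply bEval_eq_zero_of_eventually
  filter_upwards [h] with y hy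
  have hsum : (∑ k, smulField (g k) (α k)).1 y = ∑ k, g k y • (α k).1 y := by
    let ev : bFields n Z →ₗ[ℝ] TangentSpace (𝓡 n) y :=
      { toFun := fun X => X.1 y, map_add' := fun _ _ => rfl, map_smul' := fun _ _ => rfl }
    exact map_sum ev _ _
  change X.1 y - (∑ k, smulField (g k) (α k)).1 y = 0
  rw [hsum, hy, sub_self]

end Evaluation

/-! ### The bundle morphism of a frame, and its determination by the anchor. -/

section Morphism

variable {n : ℕ} {M : Type u} [TopologicalSpace M] [T2Space M] [SecondCountableTopology M]
  [ChartedSpace (EuclideanSpace ℝ (Fin n)) M] [IsManifold (𝓡 n) ∞ M]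
  {E : Type*} [NormedAddCommGroup E] [NormedSpace ℝ E] {H : Type*} [TopologicalSpace H]
  {I : ModelWithCorners ℝ E H} {N : Type v} [TopologicalSpace N] [ChartedSpace H N]
  [IsManifold I ∞ N] {Z : Set M} {pr : N → M} {φ : N → ℝ}

/-- A combination, with continuous coefficients, of sections of the b-tangent bundle vanishes if its
anchor vanishes over the complement of `Z`, provided that this complement is dense. -/
theorem sum_bEval_eq_zero (A : BFrame n I Z pr φ) (hpr : Continuous pr)
    (hdense : Dense (pr ⁻¹' Zᶜ)) {ι : Type*} [Fintype ι] {e : N} (he : pr e ∈ A.nhd)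
    {c : ι → N → ℝ} (hc : ∀ i, ContinuousAt (c i) e) {X : ι → bFields n Z}
    (h0 : ∀ᶠ e' in 𝓝 e, pr e' ∉ Z → ∑ i, c i e' • (X i).1 (pr e') = 0) :
    ∑ i, c i e • bEval (pr e) (X i) = 0 := by
  choose g hg using fun i => A.exists_coeff (X i) (pr e) he
  have h1 : ∀ i, bEval (pr e) (X i) = ∑ k, g i k (pr e) • bEval (pr e) (A.field k) :=
    fun i => bEval_eq_sum (hg i)
  have hcont : ∀ k, ContinuousAt (fun e' => ∑ i, c i e' * g i k (pr e')) e := fun k =>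
    tendsto_finsetSum _ fun i _ => (hc i).mul
      ((g i k).contMDiff.continuous.continuousAt.comp hpr.continuousAt)
  have hev : ∀ᶠ e' in 𝓝 e, pr e' ∉ Z → ∀ k, ∑ i, c i e' * g i k (pr e') = 0 := by
    have hg' : ∀ᶠ e' in 𝓝 e, ∀ i, (X i).1 (pr e') = ∑ k, g i k (pr e') • (A.field k).1 (pr e') :=
      hpr.continuousAt.eventually (Filter.eventually_all.2 hg)
    filter_upwards [h0, hg', hpr.continuousAt.preimage_mem_nhds (A.isOpen_nhd.mem_nhds he)]
      with e' h2 h3 h4 hZ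
    have h5 := h2 hZ
    simp only [h3, Finset.smul_sum, smul_smul] at h5
    rw [Finset.sum_comm] at h5
    simp only [← Finset.sum_smul] at h5
    -- Over `Z` a frame field may vanish as a vector field, so the anchor determines the
    -- coefficients only off `Z`; density and continuity carry their vanishing to `e`.
    exact Fintype.linearIndependent_iff.1 (A.field_indep _ h4 hZ) _ h5
  have hzero : ∀ k, ∑ i, c i e * g i k (pr e) = 0 := by
    intro k
    have h2 : ∃ᶠ e' in 𝓝 e, ∑ i, c i e' * g i k (pr e') = 0 := by
      refine ((mem_closure_iff_frequently.1 (hdense e)).and_eventually hev).mono ?_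
      exact fun e' h => h.2 h.1 k
    by_contra hne
    exact h2 ((hcont k).eventually_ne hne)
  simp only [h1, Finset.smul_sum, smul_smul]
  rw [Finset.sum_comm]
  simp only [← Finset.sum_smul, hzero, zero_smul, Finset.sum_const_zero]

/-- The vector of the b-tangent bundle with the components given by a frame. -/
def BFrame.morphism (A : BFrame n I Z pr φ) (e : N) :
    TangentSpace I e →ₗ[ℝ] BTangent n Z (pr e) :=
  ∑ k, (A.form k e).toLinearMap.smulRight (bEval (pr e) (A.field k))

theorem BFrame.morphism_apply (A : BFrame n I Z pr φ) (e : N) (w : TangentSpace I e) :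
    A.morphism e w = ∑ k, A.form k e w • bEval (pr e) (A.field k) := by
  simp [BFrame.morphism, LinearMap.sum_apply]

theorem bAnchor_bEval (x : M) (X : bFields n Z) : bAnchor Z x (bEval x X) = X.1 x := rfl

theorem BFrame.bAnchor_morphism (A : BFrame n I Z pr φ) {e : N} (he : pr e ∈ A.nhd)
    {w : TangentSpace I e} (hw : mvfderiv I φ e w = 0) :
    bAnchor Z (pr e) (A.morphism e w) = mfderiv I (𝓡 n) pr e w := by
  rw [A.morphism_apply, map_sum, A.sum_form e he w hw]
  simp only [map_smul, bAnchor_bEval]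

theorem BFrame.morphism_surjective (A : BFrame n I Z pr φ) {e : N} (he : pr e ∈ A.nhd)
    (b : BTangent n Z (pr e)) : ∃ w, mvfderiv I φ e w = 0 ∧ A.morphism e w = b := by
  obtain ⟨X, rfl⟩ := (vanishingAt n Z (pr e)).mkQ_surjective b
  obtain ⟨g, hg⟩ := A.exists_coeff X (pr e) he
  obtain ⟨w, hw, hwg⟩ := A.form_surjective e he fun k => g k (pr e)
  refine ⟨w, hw, ?_⟩
  rw [A.morphism_apply]
  simp only [hwg]
  exact (bEval_eq_sum hg).symm

/-- A morphism computed by a frame is also computed by any expression through smooth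
coefficients with the same anchor. -/
theorem BFrame.morphism_eq_sum (A : BFrame n I Z pr φ) (hpr : Continuous pr)
    (hdense : Dense (pr ⁻¹' Zᶜ)) {e : N} (he : pr e ∈ A.nhd)
    {Y : ∀ e : N, TangentSpace I e} (hY : ∀ᶠ e' in 𝓝 e, mvfderiv I φ e' (Y e') = 0)
    (hYs : ContMDiffAt I I.tangent ∞ (fun e => (⟨e, Y e⟩ : TangentBundle I N)) e)
    {ι : Type*} [Fintype ι] {c : ι → N → ℝ} (hc : ∀ i, ContinuousAt (c i) e)
    {X : ι → bFields n Z}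
    (hX : ∀ᶠ e' in 𝓝 e, mfderiv I (𝓡 n) pr e' (Y e') = ∑ i, c i e' • (X i).1 (pr e')) :
    A.morphism e (Y e) = ∑ i, c i e • bEval (pr e) (X i) := by
  -- Applied to the difference of the two expressions, whose anchors cancel near `e`.
  have key := sum_bEval_eq_zero A hpr hdense (ι := Fin n ⊕ ι) he
    (c := Sum.elim (fun k e => A.form k e (Y e)) fun i e => -c i e)
    (X := Sum.elim A.field X) ?_ ?_
  · rw [A.morphism_apply, ← sub_eq_zero]
    simpa [Fintype.sum_sum_type, sub_eq_add_neg] using key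
  · rintro (k | i)
    · exact (A.form_smooth k e he Y hYs).continuousAt
    · exact (hc i).neg
  · filter_upwards [hY, hX, hpr.continuousAt.preimage_mem_nhds (A.isOpen_nhd.mem_nhds he)]
      with e' h1 h2 h3 _
    rw [A.sum_form e' h3 _ h1] at h2
    simp [Fintype.sum_sum_type, h2]

end Morphism

/-! ### Frame independence and brackets of related fields. -/

section Submersion

variable {n : ℕ} {M : Type u} [TopologicalSpace M] [T2Space M] [SecondCountableTopology M]
  [ChartedSpace (EuclideanSpace ℝ (Fin n)) M] [IsManifold (𝓡 n) ∞ M]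
  {E : Type*} [NormedAddCommGroup E] [NormedSpace ℝ E] [CompleteSpace E] {H : Type*}
  [TopologicalSpace H] {I : ModelWithCorners ℝ E H} [I.Boundaryless] {N : Type v}
  [TopologicalSpace N] [ChartedSpace H N] [IsManifold I ∞ N] {Z : Set M} {pr : N → M} {φ : N → ℝ}

/-- Every vector of a foliation extends to a local section. -/
theorem Foliation.exists_local_section {k : ℕ} (F : Foliation I N k) {e : N}
    {w : TangentSpace I e} (hw : w ∈ F.tangent e) :
    ∃ Y : ∀ e : N, TangentSpace I e, Y e = w ∧ (∀ᶠ e' in 𝓝 e, Y e' ∈ F.tangent e') ∧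
      ContMDiffAt I I.tangent ∞ (fun e => (⟨e, Y e⟩ : TangentBundle I N)) e := by
  obtain ⟨U, hU, heU, X, hXs, hX⟩ := F.exists_frame e
  rw [← (hX e heU).2, Submodule.mem_span_range_iff_exists_fun] at hw
  obtain ⟨c, hc⟩ := hw
  refine ⟨fun e' => ∑ i, c i • X i e', hc, ?_, ?_⟩
  · filter_upwards [hU.mem_nhds heU] with e' he'
    rw [← (hX e' he').2]
    exact Submodule.sum_mem _ fun i _ => Submodule.smul_mem _ _
      (Submodule.subset_span (mem_range_self i))
  · exact ContMDiffAt.sum_section fun i _ => ContMDiffAt.const_smul_section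
      ((hXs i).contMDiffAt (hU.mem_nhds heU))

/-- The morphisms defined by two frames agree. -/
theorem BFrame.morphism_eq (h : IsStraightenable I n φ) (A A' : BFrame n I Z pr φ)
    (hpr : Continuous pr) (hdense : Dense (pr ⁻¹' Zᶜ)) {e : N} (he : pr e ∈ A.nhd)
    (he' : pr e ∈ A'.nhd) {w : TangentSpace I e} (hw : mvfderiv I φ e w = 0) :
    A.morphism e w = A'.morphism e w := by
  -- The comparison is by continuity from nearby points, so the single vector `w` is first extended
  -- to a local section of the foliation.
  obtain ⟨Y, rfl, hYF, hYs⟩ := (levelFoliation h).exists_local_section (w := w) hw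
  have hY : ∀ᶠ e' in 𝓝 e, mvfderiv I φ e' (Y e') = 0 := hYF
  rw [A'.morphism_apply]
  refine A.morphism_eq_sum hpr hdense he hY hYs
    (c := fun k e => A'.form k e (Y e)) (X := A'.field)
    (fun k => (A'.form_smooth k e he' Y hYs).continuousAt) ?_
  filter_upwards [hY, hpr.continuousAt.preimage_mem_nhds (A'.isOpen_nhd.mem_nhds he')]
    with e' h1 h2 using A'.sum_form e' h2 _ h1

/-- The iterated derivative of a function pulled back from the base along fields that are related
to combinations of fields on the base. -/
theorem mvfderiv_mvfderiv_comp (hpr : ContMDiff I (𝓡 n) ∞ pr) {U : Set N} (hU : IsOpen U)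
    {Y₁ Y₂ : ∀ e : N, TangentSpace I e} {p q : ℕ} {f : Fin p → N → ℝ} {g : Fin q → N → ℝ}
    {α : Fin p → VectorFields n M} {β : Fin q → VectorFields n M}
    (hg : ∀ j, ContMDiffOn I 𝓘(ℝ, ℝ) ∞ (g j) U)
    (h₁ : ∀ e ∈ U, mfderiv I (𝓡 n) pr e (Y₁ e) = ∑ i, f i e • α i (pr e))
    (h₂ : ∀ e ∈ U, mfderiv I (𝓡 n) pr e (Y₂ e) = ∑ j, g j e • β j (pr e))
    (u : C^∞⟮𝓡 n, M; ℝ⟯) {e : N} (he : e ∈ U) :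
    mvfderiv I (fun e => mvfderiv I (u ∘ pr) e (Y₂ e)) e (Y₁ e) =
      ∑ j, (mvfderiv I (g j) e (Y₁ e) * mvfderiv (𝓡 n) u (pr e) (β j (pr e)) +
        ∑ i, f i e * g j e *
          mvfderiv (𝓡 n) (fun y => mvfderiv (𝓡 n) u y (β j y)) (pr e) (α i (pr e))) := by
  have hcomp : ∀ (u : M → ℝ) (_ : ContMDiff (𝓡 n) 𝓘(ℝ, ℝ) ∞ u) (e : N) (w : TangentSpace I e),
      mvfderiv I (u ∘ pr) e w = mvfderiv (𝓡 n) u (pr e) (mfderiv I (𝓡 n) pr e w) :=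
    fun u hu e w => mvfderiv_comp_apply e (hu.mdifferentiable (by simp) _)
      (hpr.mdifferentiable (by simp) e) w
  have hβ : ∀ j, ContMDiff (𝓡 n) 𝓘(ℝ, ℝ) ∞ (fun y => mvfderiv (𝓡 n) u y (β j y)) :=
    fun j => contMDiff_lieDeriv u (β j)
  have hev : (fun e => mvfderiv I (u ∘ pr) e (Y₂ e)) =ᶠ[𝓝 e]
      ∑ j, g j * ((fun y => mvfderiv (𝓡 n) u y (β j y)) ∘ pr) := by
    filter_upwards [hU.mem_nhds he] with e' he'
    rw [hcomp u u.contMDiff, h₂ e' he', map_sum, Finset.sum_apply]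
    simp
  have hd : ∀ j, HasMFDerivAt I 𝓘(ℝ, ℝ) (g j * ((fun y => mvfderiv (𝓡 n) u y (β j y)) ∘ pr)) e
      (g j e • mvfderiv I ((fun y => mvfderiv (𝓡 n) u y (β j y)) ∘ pr) e +
        mvfderiv (𝓡 n) u (pr e) (β j (pr e)) • mvfderiv I (g j) e) := by
    intro j
    have h1 : MDifferentiableAt I 𝓘(ℝ, ℝ) (g j) e :=
      ((hg j).contMDiffAt (hU.mem_nhds he)).mdifferentiableAt (by simp)
    have h2 : MDifferentiableAt I 𝓘(ℝ, ℝ) ((fun y => mvfderiv (𝓡 n) u y (β j y)) ∘ pr) e :=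
      ((hβ j).comp hpr).mdifferentiable (by simp) e
    exact h1.hasMFDerivAt.mul h2.hasMFDerivAt
  have hsum := HasMFDerivAt.sum (t := Finset.univ) fun j _ => hd j
  have h3 := (hsum.congr_of_eventuallyEq hev).mfderiv
  refine (DFunLike.congr_fun h3 (Y₁ e)).trans ?_
  have hap : ∀ L : Fin q → (TangentSpace I e →L[ℝ] ℝ), (∑ j, L j) (Y₁ e) = ∑ j, L j (Y₁ e) :=
    fun L => by simp
  refine (hap _).trans (Finset.sum_congr rfl fun j _ => ?_)
  change g j e * mvfderiv I ((fun y => mvfderiv (𝓡 n) u y (β j y)) ∘ pr) e (Y₁ e) +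
    mvfderiv (𝓡 n) u (pr e) (β j (pr e)) * mvfderiv I (g j) e (Y₁ e) = _
  rw [hcomp _ (hβ j), h₁ e he, map_sum, Finset.mul_sum, add_comm, mul_comm]
  congr 1
  refine Finset.sum_congr rfl fun i _ => ?_
  rw [map_smul, smul_eq_mul]
  ring

/-- The bracket of two fields that are related to combinations of fields on the base. -/
theorem mfderiv_mlieBracket_eq_sum (hpr : ContMDiff I (𝓡 n) ∞ pr) {U : Set N} (hU : IsOpen U)
    {Y₁ Y₂ : ∀ e : N, TangentSpace I e} {p q : ℕ} {f : Fin p → N → ℝ} {g : Fin q → N → ℝ}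
    {α : Fin p → VectorFields n M} {β : Fin q → VectorFields n M}
    (hs₁ : ContMDiffOn I I.tangent ∞ (fun e => (⟨e, Y₁ e⟩ : TangentBundle I N)) U)
    (hs₂ : ContMDiffOn I I.tangent ∞ (fun e => (⟨e, Y₂ e⟩ : TangentBundle I N)) U)
    (hf : ∀ i, ContMDiffOn I 𝓘(ℝ, ℝ) ∞ (f i) U) (hg : ∀ j, ContMDiffOn I 𝓘(ℝ, ℝ) ∞ (g j) U)
    (h₁ : ∀ e ∈ U, mfderiv I (𝓡 n) pr e (Y₁ e) = ∑ i, f i e • α i (pr e))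
    (h₂ : ∀ e ∈ U, mfderiv I (𝓡 n) pr e (Y₂ e) = ∑ j, g j e • β j (pr e))
    {e : N} (he : e ∈ U) :
    mfderiv I (𝓡 n) pr e (mlieBracket I Y₁ Y₂ e) =
      ∑ x : Fin p × Fin q, (f x.1 e * g x.2 e) • fieldBracket (α x.1) (β x.2) (pr e) +
        (∑ j, mvfderiv I (g j) e (Y₁ e) • β j (pr e) +
          ∑ i, (-mvfderiv I (f i) e (Y₂ e)) • α i (pr e)) := by
  -- Test on `u ∘ pr`: the second derivatives of `u` occur with the same coefficients `f i * g j` in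
  -- both orders and combine into brackets on the base, while the Leibniz terms contain the
  -- derivatives of `f` and `g`.
  refine eq_of_forall_mvfderiv_eq fun u => ?_
  have h1 : mvfderiv (𝓡 n) u (pr e) (mfderiv I (𝓡 n) pr e (mlieBracket I Y₁ Y₂ e)) =
      mvfderiv I (u ∘ pr) e (mlieBracket I Y₁ Y₂ e) :=
    (mvfderiv_comp_apply e (u.contMDiff.mdifferentiable (by simp) _)
      (hpr.mdifferentiable (by simp) e) _).symm
  have hbr : ∀ i j, mvfderiv (𝓡 n) u (pr e) (fieldBracket (α i) (β j) (pr e)) =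
      mvfderiv (𝓡 n) (fun y => mvfderiv (𝓡 n) u y (β j y)) (pr e) (α i (pr e)) -
        mvfderiv (𝓡 n) (fun y => mvfderiv (𝓡 n) u y (α i y)) (pr e) (β j (pr e)) :=
    fun i j => mvfderiv_mlieBracket u (α i) (β j) (pr e)
  rw [h1, mvfderiv_mlieBracket_apply (u.contMDiff.comp hpr) (hs₁.contMDiffAt (hU.mem_nhds he))
    (hs₂.contMDiffAt (hU.mem_nhds he)), mvfderiv_mvfderiv_comp hpr hU hg h₁ h₂ u he,
    mvfderiv_mvfderiv_comp hpr hU hf h₂ h₁ u he]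
  simp only [map_add, map_sum, map_smul, hbr, Fintype.sum_prod_type, Finset.sum_add_distrib,
    smul_eq_mul, mul_sub, Finset.sum_sub_distrib, neg_mul, Finset.sum_neg_distrib]
  rw [Finset.sum_comm (f := fun j i => f i e * g j e *
    mvfderiv (𝓡 n) (fun y => mvfderiv (𝓡 n) u y (β j y)) (pr e) (α i (pr e)))]
  simp only [mul_comm (g _ e) (f _ e)]
  ring

end Submersion

/-! ### The Lie algebroid submersion. -/

section SubmersionExists

variable {n : ℕ} {M : Type u} [TopologicalSpace M] [T2Space M] [SecondCountableTopology M]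
  [ChartedSpace (EuclideanSpace ℝ (Fin n)) M] [IsManifold (𝓡 n) ∞ M]
  {E : Type*} [NormedAddCommGroup E] [NormedSpace ℝ E] [CompleteSpace E] {H : Type*}
  [TopologicalSpace H] {I : ModelWithCorners ℝ E H} [I.Boundaryless] {N : Type v}
  [TopologicalSpace N] [ChartedSpace H N] [IsManifold I ∞ N] {Z : Set M} {pr : N → M} {φ : N → ℝ}

theorem contMDiffAt_mlieBracket {Y₁ Y₂ : ∀ e : N, TangentSpace I e} {e : N}
    (h₁ : ContMDiffAt I I.tangent ∞ (fun e => (⟨e, Y₁ e⟩ : TangentBundle I N)) e)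
    (h₂ : ContMDiffAt I I.tangent ∞ (fun e => (⟨e, Y₂ e⟩ : TangentBundle I N)) e) :
    ContMDiffAt I I.tangent ∞ (fun e => (⟨e, mlieBracket I Y₁ Y₂ e⟩ : TangentBundle I N)) e := by
  have : IsManifold I (((⊤ : ℕ∞) : WithTop ℕ∞) + 1) N := by
    simpa using (inferInstance : IsManifold I ∞ N)
  have : IsManifold I (minSmoothness ℝ 2) N := by
    rw [minSmoothness_of_isRCLikeNormedField]
    exact IsManifold.of_le (n := ∞) (WithTop.coe_le_coe.2 le_top)
  exact ContMDiffAt.mlieBracket_vectorField (m := ⊤) (n := ⊤) h₁ h₂ (by simp)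

/-- If `φ` vanished on an open set, then `dφ` would vanish there; so the zero level, which is the
preimage of `Z`, has empty interior. -/
theorem dense_preimage_compl (hB : ∀ x : M, ∃ B : BChart n I Z pr φ, x ∈ B.base.source) :
    Dense (pr ⁻¹' Zᶜ) := by
  have h := isStraightenable_of_bChart hB
  rw [preimage_compl, preimage_eq_level_zero hB, ← interior_eq_empty_iff_dense_compl,
    eq_empty_iff_forall_notMem]
  intro e he
  apply h.mvfderiv_ne_zero e
  have h1 : φ =ᶠ[𝓝 e] fun _ => (0 : ℝ) := mem_interior_iff_mem_nhds.1 he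
  ext w
  refine (DFunLike.congr_fun (h1.mfderiv_eq (I := I) (I' := 𝓘(ℝ, ℝ))) w).trans ?_
  rw [mfderiv_const]
  rfl

/-- The Lie algebroid submersion onto the b-tangent bundle. -/
theorem exists_lieAlgebroidSubmersion
    (hB : ∀ x : M, ∃ B : BChart n I Z pr φ, x ∈ B.base.source) :
    ∃ Ψ : ∀ e : N, (levelFoliation (isStraightenable_of_bChart hB)).tangent e →ₗ[ℝ]
      BTangent n Z (pr e),
      IsLieAlgebroidSubmersion (levelFoliation (isStraightenable_of_bChart hB)) Z pr Ψ := by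
  have h := isStraightenable_of_bChart hB
  have hprs := contMDiff_of_bChart hB
  have hpr : Continuous pr := hprs.continuous
  have hdense := dense_preimage_compl hB
  choose A hA using exists_bFrame hB
  -- The frame is chosen separately at each base point; `BFrame.morphism_eq` is what allows a single
  -- frame to be used near a given point.
  let Ψ : ∀ e : N, (levelFoliation (isStraightenable_of_bChart hB)).tangent e →ₗ[ℝ]
      BTangent n Z (pr e) := fun e =>
    ((A (pr e)).morphism e).comp
      ((levelFoliation (isStraightenable_of_bChart hB)).tangent e).subtype
  have hanchor : ∀ e (w : (levelFoliation (isStraightenable_of_bChart hB)).tangent e),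
      bAnchor Z (pr e) (Ψ e w) = mfderiv I (𝓡 n) pr e w.1 :=
    fun e w => (A (pr e)).bAnchor_morphism (hA _) w.2
  refine ⟨Ψ, hprs, fun x => ?_, fun e => ?_, ?_, fun e b => ?_, hanchor, ?_⟩
  · obtain ⟨B, hx⟩ := hB x
    exact ⟨_, B.pr_symm hx one_ne_zero⟩
  · obtain ⟨B, hx⟩ := hB (pr e)
    exact B.surjective_mfderiv_pr (B.mem_source hx)
  · intro U Y hY hU hYs e₀ he₀
    refine ⟨U ∩ pr ⁻¹' (A (pr e₀)).nhd, hU.inter ((A (pr e₀)).isOpen_nhd.preimage hpr),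
      ⟨he₀, hA _⟩, n, fun k e => (A (pr e₀)).form k e (Y e), (A (pr e₀)).field,
      fun k e he => ?_, fun e he => ?_⟩
    · exact ((A (pr e₀)).form_smooth k e he.2 Y
        (hYs.contMDiffAt (hU.mem_nhds he.1))).contMDiffWithinAt
    · rw [← BFrame.morphism_apply]
      exact BFrame.morphism_eq h _ _ hpr hdense (hA _) he.1.2 (hY e)
  · obtain ⟨w, hw, rfl⟩ := (A (pr e)).morphism_surjective (hA _) b
    exact ⟨⟨w, hw⟩, rfl⟩
  · intro U hU Y₁ Y₂ h₁ h₂ hs₁ hs₂ p q f g α β hf hg hΨ₁ hΨ₂ e he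
    have hd₁ : ∀ e ∈ U, mfderiv I (𝓡 n) pr e (Y₁ e) = ∑ i, f i e • (α i).1 (pr e) := by
      intro e he
      rw [← hanchor e ⟨Y₁ e, h₁ e⟩, hΨ₁ e he, map_sum]
      simp only [map_smul, bAnchor_bEval]
    have hd₂ : ∀ e ∈ U, mfderiv I (𝓡 n) pr e (Y₂ e) = ∑ j, g j e • (β j).1 (pr e) := by
      intro e he
      rw [← hanchor e ⟨Y₂ e, h₂ e⟩, hΨ₂ e he, map_sum]
      simp only [map_smul, bAnchor_bEval]
    have hfe := fun i => (hf i).contMDiffAt (hU.mem_nhds he)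
    have hge := fun j => (hg j).contMDiffAt (hU.mem_nhds he)
    have hs₁e := hs₁.contMDiffAt (hU.mem_nhds he)
    have hs₂e := hs₂.contMDiffAt (hU.mem_nhds he)
    -- The two sides of the bracket formula have the same anchor near `e`, by the computation for
    -- related fields, and this forces them to agree in the b-tangent bundle.
    have key := (A (pr e)).morphism_eq_sum hpr hdense (hA _) (Y := mlieBracket I Y₁ Y₂)
      (ι := (Fin p × Fin q) ⊕ (Fin q ⊕ Fin p))
      (c := Sum.elim (fun x e => f x.1 e * g x.2 e)
        (Sum.elim (fun j e => mvfderiv I (g j) e (Y₁ e)) fun i e => -mvfderiv I (f i) e (Y₂ e)))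
      (X := Sum.elim (fun x => bBracket (α x.1) (β x.2)) (Sum.elim β α))
      (by
        filter_upwards [hU.mem_nhds he] with e' he'
        exact mlieBracket_mem_ker h.contMDiff hU h₁ h₂ hs₁ hs₂ he')
      (contMDiffAt_mlieBracket hs₁e hs₂e)
      (by
        rintro (x | j | i)
        · exact ((hfe x.1).mul (hge x.2)).continuousAt
        · exact (contMDiffAt_mvfderiv_apply (hge j) hs₁e).continuousAt
        · exact (contMDiffAt_mvfderiv_apply (hfe i) hs₂e).continuousAt.neg)
      (by
        filter_upwards [hU.mem_nhds he] with e' he'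
        rw [mfderiv_mlieBracket_eq_sum hprs hU hs₁ hs₂ hf hg hd₁ hd₂ he', Fintype.sum_sum_type,
          Fintype.sum_sum_type]
        rfl)
    refine key.trans ?_
    rw [Fintype.sum_sum_type, Fintype.sum_sum_type, Fintype.sum_prod_type]
    simp only [Sum.elim_inl, Sum.elim_inr, neg_smul, Finset.sum_neg_distrib]
    rw [← sub_eq_add_neg, add_sub_assoc]

end SubmersionExists

/-! ### Fibre coordinates on the dual line bundle. -/

section DualCoordinates

variable {n : ℕ} {M : Type u} [TopologicalSpace M] [ChartedSpace (EuclideanSpace ℝ (Fin n)) M]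
  [IsManifold (𝓡 n) ∞ M]
  {W : M → Type v} [∀ x, AddCommGroup (W x)] [∀ x, Module ℝ (W x)] [∀ x, TopologicalSpace (W x)]
  [TopologicalSpace (TotalSpace ℝ W)] [FiberBundle ℝ W] [VectorBundle ℝ ℝ W]
  [ContMDiffVectorBundle ∞ ℝ W (𝓡 n)]

/-- The fibre coordinate on the dual of a line bundle given by the trivialization at `x₀`. -/
def dualCoord (x₀ : M) (e : TotalSpace (ℝ →L[ℝ] ℝ) (DualFiber W)) : ℝ :=
  (trivializationAt (ℝ →L[ℝ] ℝ) (DualFiber W) x₀ e).2 1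

/-- The open set on which the fibre coordinate `dualCoord x₀` is defined. -/
def dualBase (W : M → Type v) [∀ x, AddCommGroup (W x)] [∀ x, Module ℝ (W x)]
    [∀ x, TopologicalSpace (W x)] [TopologicalSpace (TotalSpace ℝ W)] [FiberBundle ℝ W]
    [VectorBundle ℝ ℝ W] (x₀ : M) : Set M :=
  (trivializationAt (ℝ →L[ℝ] ℝ) (DualFiber W) x₀).baseSet

theorem isOpen_dualBase (x₀ : M) : IsOpen (dualBase W x₀) :=
  (trivializationAt (ℝ →L[ℝ] ℝ) (DualFiber W) x₀).open_baseSet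

theorem mem_dualBase (x₀ : M) : x₀ ∈ dualBase W x₀ :=
  mem_baseSet_trivializationAt (ℝ →L[ℝ] ℝ) (DualFiber W) x₀

theorem dualCoord_smul {x₀ x : M} (hx : x ∈ dualBase W x₀) (a : ℝ) (e : DualFiber W x) :
    dualCoord x₀ ⟨x, a • e⟩ = a * dualCoord x₀ ⟨x, e⟩ := by
  let A := (trivializationAt (ℝ →L[ℝ] ℝ) (DualFiber W) x₀).continuousLinearEquivAt ℝ x hx
  change A (a • e) 1 = a * A e 1
  rw [map_smul]
  rfl

theorem dualCoord_injective {x₀ x : M} (hx : x ∈ dualBase W x₀) {e e' : DualFiber W x}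
    (h : dualCoord x₀ ⟨x, e⟩ = dualCoord x₀ ⟨x, e'⟩) : e = e' := by
  let A := (trivializationAt (ℝ →L[ℝ] ℝ) (DualFiber W) x₀).continuousLinearEquivAt ℝ x hx
  apply A.injective
  ext
  exact h

theorem dualCoord_eq_zero {x₀ x : M} (hx : x ∈ dualBase W x₀) {e : DualFiber W x} :
    dualCoord x₀ ⟨x, e⟩ = 0 ↔ e = 0 := by
  have h0 : dualCoord x₀ (⟨x, 0⟩ : TotalSpace (ℝ →L[ℝ] ℝ) (DualFiber W)) = 0 := by
    have := dualCoord_smul hx 0 (0 : DualFiber W x)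
    rwa [zero_smul, zero_mul] at this
  refine ⟨fun h => dualCoord_injective hx (h.trans h0.symm), fun h => by rw [h, h0]⟩

/-- In a dual of a line bundle, every covector is a multiple of a given nonzero one. -/
theorem eq_div_smul {x₀ x : M} (hx : x ∈ dualBase W x₀) {e' : DualFiber W x} (he' : e' ≠ 0)
    (e : DualFiber W x) : e = (dualCoord x₀ ⟨x, e⟩ / dualCoord x₀ ⟨x, e'⟩) • e' := by
  apply dualCoord_injective hx
  rw [dualCoord_smul hx, div_mul_cancel₀]
  exact fun h => he' ((dualCoord_eq_zero hx).1 h)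

/-- A functional on `ℝ` is its value at `1`, so the fibre part of the smoothness criterion in a
trivialization reduces to one real function. -/
theorem contMDiffAt_dual_iff {E' : Type*} [NormedAddCommGroup E'] [NormedSpace ℝ E']
    {H' : Type*} [TopologicalSpace H'] {I' : ModelWithCorners ℝ E' H'} {P : Type*}
    [TopologicalSpace P] [ChartedSpace H' P] {x₀ : M}
    {f : P → TotalSpace (ℝ →L[ℝ] ℝ) (DualFiber W)} {p : P} (hp : (f p).1 ∈ dualBase W x₀) :
    ContMDiffAt I' (dualModel n) ∞ f p ↔ ContMDiffAt I' (𝓡 n) ∞ (fun q => (f q).1) p ∧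
      ContMDiffAt I' 𝓘(ℝ, ℝ) ∞ (fun q => dualCoord x₀ (f q)) p := by
  let t := trivializationAt (ℝ →L[ℝ] ℝ) (DualFiber W) x₀
  rw [t.contMDiffAt_iff (IB := 𝓡 n) (n := ∞) (t.mem_source.2 hp)]
  refine and_congr_right fun _ => ⟨fun h =>
    ((ContinuousLinearMap.apply ℝ ℝ (1 : ℝ)).contMDiff.contMDiffAt).comp p h, fun h => ?_⟩
  let S : ℝ →L[ℝ] (ℝ →L[ℝ] ℝ) := ContinuousLinearMap.smulRightL ℝ ℝ ℝ (ContinuousLinearMap.id ℝ ℝ)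
  have h2 : (fun q => (t (f q)).2) = S ∘ fun q => dualCoord x₀ (f q) := by
    funext q
    ext
    simp [S, dualCoord, t]
  rw [h2]
  exact S.contMDiff.contMDiffAt.comp p h

theorem contMDiffAt_dualCoord {x₀ : M} {e : TotalSpace (ℝ →L[ℝ] ℝ) (DualFiber W)}
    (he : e.1 ∈ dualBase W x₀) :
    ContMDiffAt (dualModel n) 𝓘(ℝ, ℝ) ∞ (dualCoord x₀) e :=
  ((contMDiffAt_dual_iff (f := fun e' : TotalSpace (ℝ →L[ℝ] ℝ) (DualFiber W) => e') (x₀ := x₀)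
    he).1 contMDiffAt_id).2

theorem contMDiffAt_dualCoord_section (η : Cₛ^∞⟮𝓡 n; ℝ →L[ℝ] ℝ, DualFiber W⟯) {x₀ x : M}
    (hx : x ∈ dualBase W x₀) :
    ContMDiffAt (𝓡 n) 𝓘(ℝ, ℝ) ∞ (fun x => dualCoord x₀ ⟨x, η x⟩) x :=
  ((contMDiffAt_dual_iff (x₀ := x₀) hx).1 η.contMDiff.contMDiffAt).2

/-- The pairing of sections of a bundle and its dual is smooth. -/
theorem contMDiff_dual_apply (η : Cₛ^∞⟮𝓡 n; ℝ →L[ℝ] ℝ, DualFiber W⟯) (s : Cₛ^∞⟮𝓡 n; ℝ, W⟯) :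
    ContMDiff (𝓡 n) 𝓘(ℝ, ℝ) ∞ (fun x => (η x (s x) : ℝ)) := by
  intro x
  have h1 := ContMDiffAt.clm_bundle_apply (η.contMDiff.contMDiffAt (x := x))
    (s.contMDiff.contMDiffAt (x := x))
  exact (contMDiffAt_section x).1 h1

theorem exists_section_ne_zero [T2Space M] [SecondCountableTopology M] (x : M) :
    ∃ η : Cₛ^∞⟮𝓡 n; ℝ →L[ℝ] ℝ, DualFiber W⟯, η x ≠ 0 := by
  let t := trivializationAt (ℝ →L[ℝ] ℝ) (DualFiber W) x
  obtain ⟨χ, hχ1, hχ⟩ := exists_cutoff (n := n) t.open_baseSet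
    (mem_baseSet_trivializationAt (ℝ →L[ℝ] ℝ) (DualFiber W) x)
  let ν : ∀ y, DualFiber W y := fun y => t.symm y (ContinuousLinearMap.id ℝ ℝ)
  have hν : ∀ y ∈ t.baseSet, dualCoord x ⟨y, ν y⟩ = 1 := by
    intro y hy
    change (t ⟨y, t.symm y (ContinuousLinearMap.id ℝ ℝ)⟩).2 1 = 1
    rw [t.apply_mk_symm hy]
    rfl
  have hνs : ContMDiffOn (𝓡 n) (dualModel n) ∞
      (fun y => TotalSpace.mk' (ℝ →L[ℝ] ℝ) y (ν y)) t.baseSet := by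
    intro y hy
    refine ((contMDiffAt_dual_iff (x₀ := x)
      (f := fun y => TotalSpace.mk' (ℝ →L[ℝ] ℝ) y (ν y)) (p := y) hy).2
        ⟨contMDiffAt_id, ?_⟩).contMDiffWithinAt
    refine (contMDiffAt_const (c := (1 : ℝ))).congr_of_eventuallyEq ?_
    filter_upwards [t.open_baseSet.mem_nhds hy] with z hz using hν z hz
  refine ⟨⟨fun y => χ y • ν y, χ.contMDiff.contMDiffOn.smul_section_of_tsupport t.open_baseSet hχ
    hνs⟩, fun h0 => ?_⟩
  have h1 := hν x (mem_baseSet_trivializationAt (ℝ →L[ℝ] ℝ) (DualFiber W) x)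
  change χ x • ν x = 0 at h0
  rw [hχ1.self_of_nhds, one_smul] at h0
  rw [(dualCoord_eq_zero (mem_dualBase x)).2 h0] at h1
  exact zero_ne_one h1

end DualCoordinates

/-! ### A frame of the dual bundle from a local equation of `Z`. -/

section Generators

variable {n : ℕ} {M : Type u} [TopologicalSpace M] [ChartedSpace (EuclideanSpace ℝ (Fin n)) M]
  [IsManifold (𝓡 n) ∞ M]

/-- Around every point there is a chart of the b-pair `(M, Z)`. -/
theorem IsBPair.exists_bCoord {Z : Set M} (hZ : IsBPair n Z) (x₀ : M) :
    ∃ ψ ∈ IsManifold.maximalAtlas (𝓡 n) ∞ M, x₀ ∈ ψ.source ∧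
      ∃ i : Option (Fin n), ∀ x ∈ ψ.source, x ∈ Z ↔ bCoord i (ψ x) = 0 := by
  by_cases hx : x₀ ∈ Z
  · obtain ⟨ψ, hψ, h0, i, hi⟩ := hZ.exists_chart x₀ hx
    exact ⟨ψ, hψ, h0, some i, hi⟩
  · have hO : IsOpen Zᶜ := hZ.isClosed.isOpen_compl
    refine ⟨(chartAt (EuclideanSpace ℝ (Fin n)) x₀).restr Zᶜ,
      restr_mem_maximalAtlas _ (IsManifold.chart_mem_maximalAtlas x₀) hO, ?_, none, ?_⟩
    · rw [OpenPartialHomeomorph.restr_source' _ _ hO]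
      exact ⟨mem_chart_source _ x₀, hx⟩
    · intro x hx'
      rw [OpenPartialHomeomorph.restr_source' _ _ hO] at hx'
      exact ⟨fun h => (hx'.2 h).elim, fun h => (one_ne_zero (α := ℝ) h).elim⟩

variable {W : M → Type v} [∀ x, AddCommGroup (W x)] [∀ x, Module ℝ (W x)]
  [∀ x, TopologicalSpace (W x)]
  [TopologicalSpace (TotalSpace ℝ W)] [FiberBundle ℝ W] [VectorBundle ℝ ℝ W]
  [ContMDiffVectorBundle ∞ ℝ W (𝓡 n)]

/-- A local equation of the hypersurface is the pairing of `s` with a section of the dual bundle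
that does not vanish. -/
theorem IsBDivisor.exists_section [T2Space M] [SecondCountableTopology M] {Z : Set M}
    {s : Cₛ^∞⟮𝓡 n; ℝ, W⟯} (hs : IsBDivisor Z s)
    {ψ : OpenPartialHomeomorph M (EuclideanSpace ℝ (Fin n))}
    (hψ : ψ ∈ IsManifold.maximalAtlas (𝓡 n) ∞ M) {x₀ : M} (hx₀ : x₀ ∈ ψ.source)
    {i : Option (Fin n)} (hi : ∀ x ∈ ψ.source, x ∈ Z ↔ bCoord i (ψ x) = 0) :
    ∃ η : Cₛ^∞⟮𝓡 n; ℝ →L[ℝ] ℝ, DualFiber W⟯, η x₀ ≠ 0 ∧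
      ∀ᶠ y in 𝓝 x₀, (η y (s y) : ℝ) = bCoord i (ψ y) := by
  obtain ⟨χ, hχ1, hχ⟩ := exists_cutoff (n := n) ψ.open_source hx₀
  have hsm : ContMDiffOn (𝓡 n) 𝓘(ℝ, ℝ) ∞ (fun y => bCoord i (ψ y)) ψ.source :=
    (contDiff_bCoord i).contMDiff.comp_contMDiffOn (contMDiffOn_of_mem_maximalAtlas hψ)
  obtain ⟨η, hη⟩ := (hs ⟨_, contMDiff_smul_of_tsupport ψ.open_source hχ hsm⟩).2 (by
    intro x hx
    change χ x • bCoord i (ψ x) = 0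
    by_cases h : x ∈ ψ.source
    · rw [(hi x h).1 hx, smul_zero]
    · rw [image_eq_zero_of_notMem_tsupport fun h' => h (hχ h'), zero_smul])
  have hηs : ∀ᶠ y in 𝓝 x₀, (η y (s y) : ℝ) = bCoord i (ψ y) := by
    filter_upwards [hχ1] with y hy
    have h1 : χ y • bCoord i (ψ y) = η y (s y) := hη y
    rw [← h1, hy, one_smul]
  refine ⟨η, fun h0 => ?_, hηs⟩
  have hc : bCoord i (ψ x₀) = 0 := by
    rw [← hηs.self_of_nhds, h0]
    rfl
  have hxZ : x₀ ∈ Z := (hi x₀ hx₀).2 hc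
  cases i with
  | none => exact one_ne_zero (α := ℝ) hc
  | some k =>
    -- Suppose `η x₀ = 0` and compare with a section `η₁` not zero at `x₀`: locally `η = q • η₁`
    -- with `q x₀ = 0`, and `⟨s, η₁⟩` vanishes at `x₀ ∈ Z`. Then the coordinate `r` is a product of
    -- two functions vanishing at `x₀`.
    obtain ⟨η₁, hη₁⟩ := exists_section_ne_zero (n := n) (W := W) x₀
    have hG0 : (η₁ x₀ (s x₀) : ℝ) = 0 :=
      (hs ⟨_, contMDiff_dual_apply η₁ s⟩).1 ⟨η₁, fun x => rfl⟩ x₀ hxZ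
    have hb := mem_dualBase (W := W) x₀
    have hne : dualCoord x₀ ⟨x₀, η₁ x₀⟩ ≠ 0 := fun h => hη₁ ((dualCoord_eq_zero hb).1 h)
    let q : M → ℝ := fun y => dualCoord x₀ ⟨y, η y⟩ / dualCoord x₀ ⟨y, η₁ y⟩
    have hq : ContMDiffAt (𝓡 n) 𝓘(ℝ, ℝ) ∞ q x₀ :=
      (contMDiffAt_dualCoord_section η hb).div₀ (contMDiffAt_dualCoord_section η₁ hb) hne
    have hq0 : q x₀ = 0 := by
      change _ / _ = (0 : ℝ)
      rw [(dualCoord_eq_zero hb).2 h0, zero_div]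
    have hfac : ∀ᶠ y in 𝓝 x₀, bCoord (some k) (ψ y) = q y * (η₁ y (s y) : ℝ) := by
      filter_upwards [hηs, (isOpen_dualBase x₀).mem_nhds hb,
        (contMDiffAt_dualCoord_section η₁ hb).continuousAt.eventually_ne hne] with y h1 h2 h3
      have h4 : η₁ y ≠ 0 := fun h => h3 ((dualCoord_eq_zero h2).2 h)
      rw [← h1]
      conv_lhs => rw [eq_div_smul h2 h4 (η y)]
      rfl
    have hz : ψ x₀ ∈ ψ.target := ψ.map_source hx₀
    have hdiff : ∀ g : M → ℝ, ContMDiffAt (𝓡 n) 𝓘(ℝ, ℝ) ∞ g x₀ →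
        DifferentiableAt ℝ (g ∘ ψ.symm) (ψ x₀) := by
      intro g hg
      have h1 : ContMDiffAt (𝓡 n) 𝓘(ℝ, ℝ) ∞ (g ∘ ψ.symm) (ψ x₀) := by
        refine ContMDiffAt.comp _ ?_ ((contMDiffOn_symm_of_mem_maximalAtlas hψ).contMDiffAt
          (ψ.open_target.mem_nhds hz))
        rwa [ψ.left_inv hx₀]
      exact (contMDiffAt_iff_contDiffAt.1 h1).differentiableAt (by simp)
    have h1 := (hdiff q hq).hasFDerivAt.mul
      (hdiff (fun y => (η₁ y (s y) : ℝ)) (contMDiff_dual_apply η₁ s).contMDiffAt).hasFDerivAt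
    have h2 : (q ∘ ψ.symm) (ψ x₀) = 0 := by
      rw [Function.comp_apply, ψ.left_inv hx₀, hq0]
    have h3 : ((fun y => (η₁ y (s y) : ℝ)) ∘ ψ.symm) (ψ x₀) = 0 := by
      rw [Function.comp_apply, ψ.left_inv hx₀, hG0]
    rw [h2, h3, zero_smul, zero_smul, add_zero] at h1
    have h4 : bCoord (some k) =ᶠ[𝓝 (ψ x₀)]
        (q ∘ ψ.symm) * ((fun y => (η₁ y (s y) : ℝ)) ∘ ψ.symm) := by
      have h5 : Filter.Tendsto ψ.symm (𝓝 (ψ x₀)) (𝓝 x₀) := ψ.tendsto_symm hx₀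
      filter_upwards [h5.eventually hfac, ψ.open_target.mem_nhds hz] with z h6 h7
      rw [ψ.right_inv h7] at h6
      exact h6
    have h8 := (hasFDerivAt_bCoord (some k) (ψ x₀)).unique (h1.congr_of_eventuallyEq h4)
    -- The product has zero differential, whereas the coordinate has derivative `1` along its own
    -- axis.
    have h9 := congrArg (fun A : EuclideanSpace ℝ (Fin n) →L[ℝ] ℝ =>
      A (EuclideanSpace.single k 1)) h8
    simp [bCoordDeriv] at h9

end Generators

/-! ### Adapted coordinates on the punctured dual, and scaling. -/

section DualCharts

variable {n : ℕ} {M : Type u} [TopologicalSpace M] [ChartedSpace (EuclideanSpace ℝ (Fin n)) M]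
  [IsManifold (𝓡 n) ∞ M]

/-- A chart of the maximal atlas as a diffeomorphism onto an open subset of `ℝⁿ`. -/
def chartDiffeo {ψ : OpenPartialHomeomorph M (EuclideanSpace ℝ (Fin n))}
    (hψ : ψ ∈ IsManifold.maximalAtlas (𝓡 n) ∞ M) :
    PartialDiffeomorph (𝓡 n) 𝓘(ℝ, EuclideanSpace ℝ (Fin n)) M (EuclideanSpace ℝ (Fin n)) ∞ where
  toPartialEquiv := ψ.toPartialEquiv
  open_source := ψ.open_source
  open_target := ψ.open_target
  contMDiffOn_toFun := contMDiffOn_of_mem_maximalAtlas hψ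
  contMDiffOn_invFun := contMDiffOn_symm_of_mem_maximalAtlas hψ

variable {W : M → Type v} [∀ x, AddCommGroup (W x)] [∀ x, Module ℝ (W x)]
  [∀ x, TopologicalSpace (W x)]
  [TopologicalSpace (TotalSpace ℝ W)] [FiberBundle ℝ W] [VectorBundle ℝ ℝ W]
  [ContMDiffVectorBundle ∞ ℝ W (𝓡 n)]

theorem contMDiff_dualProj :
    ContMDiff (dualModel n) (𝓡 n) ∞ (proj : puncturedDual W → M) :=
  (contMDiff_proj (DualFiber W)).comp contMDiff_subtype_val

open Classical in
/-- The nonzero covector with base point `x` and coordinate `a` in the frame `η`. -/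
def frameMap (e₀ : puncturedDual W) (η : ∀ x, DualFiber W x) (x : M) (a : ℝ) : puncturedDual W :=
  -- `e₀` is a default value, used only when the covector would be zero.
  if h : a • η x ≠ 0 then ⟨⟨x, a • η x⟩, h⟩ else e₀

theorem frameMap_of_ne (e₀ : puncturedDual W) (η : ∀ x, DualFiber W x) {x : M} {a : ℝ} (ha : a ≠ 0)
    (hx : η x ≠ 0) : (frameMap e₀ η x a).1 = ⟨x, a • η x⟩ := by
  rw [frameMap, dif_pos (smul_ne_zero ha hx)]

/-- The coordinates on the complement of the zero section of the dual bundle given by a chart of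
the base and a frame of the dual bundle. -/
def frameDiffeo {ψ : OpenPartialHomeomorph M (EuclideanSpace ℝ (Fin n))}
    (hψ : ψ ∈ IsManifold.maximalAtlas (𝓡 n) ∞ M) {x₀ : M}
    (η : Cₛ^∞⟮𝓡 n; ℝ →L[ℝ] ℝ, DualFiber W⟯) (hx₀ : ψ.source ⊆ dualBase W x₀)
    (hη : ∀ x ∈ ψ.source, η x ≠ 0) (e₀ : puncturedDual W) :
    PartialDiffeomorph (dualModel n) 𝓘(ℝ, EuclideanSpace ℝ (Fin n) × ℝ) (puncturedDual W)
      (EuclideanSpace ℝ (Fin n) × ℝ) ∞ where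
  toFun e := (ψ (proj e), dualCoord x₀ e.1 / dualCoord x₀ ⟨proj e, η (proj e)⟩)
  invFun p := frameMap e₀ η (ψ.symm p.1) p.2
  source := proj ⁻¹' ψ.source
  target := ψ.target ×ˢ {0}ᶜ
  map_source' e he := by
    refine ⟨ψ.map_source he, div_ne_zero ?_ ?_⟩
    · exact fun h => e.2 ((dualCoord_eq_zero (hx₀ he)).1 h)
    · exact fun h => hη _ he ((dualCoord_eq_zero (hx₀ he)).1 h)
  map_target' p hp := by
    have h1 := ψ.map_target hp.1
    change (frameMap e₀ η (ψ.symm p.1) p.2).1.1 ∈ ψ.source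
    rwa [frameMap_of_ne e₀ η hp.2 (hη _ h1)]
  left_inv' e he := by
    have h0 : proj e ∈ ψ.source := he
    apply Subtype.ext
    change (frameMap e₀ η (ψ.symm (ψ (proj e)))
      (dualCoord x₀ e.1 / dualCoord x₀ ⟨proj e, η (proj e)⟩)).1 = e.1
    rw [ψ.left_inv h0, frameMap_of_ne e₀ η _ (hη _ h0)]
    · exact congrArg (TotalSpace.mk (proj e)) (eq_div_smul (hx₀ he) (hη _ he) e.1.2).symm
    · exact div_ne_zero (fun h => e.2 ((dualCoord_eq_zero (hx₀ he)).1 h))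
        (fun h => hη _ he ((dualCoord_eq_zero (hx₀ he)).1 h))
  right_inv' p hp := by
    have h1 := ψ.map_target hp.1
    have h2 := frameMap_of_ne e₀ η hp.2 (hη _ h1)
    have h3 : dualCoord x₀ ⟨ψ.symm p.1, η (ψ.symm p.1)⟩ ≠ 0 :=
      fun h => hη _ h1 ((dualCoord_eq_zero (hx₀ h1)).1 h)
    have h4 : proj (frameMap e₀ η (ψ.symm p.1) p.2) = ψ.symm p.1 := by rw [proj, h2]
    have h5 : dualCoord x₀ ⟨proj (frameMap e₀ η (ψ.symm p.1) p.2),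
        η (proj (frameMap e₀ η (ψ.symm p.1) p.2))⟩ =
        dualCoord x₀ ⟨ψ.symm p.1, η (ψ.symm p.1)⟩ := by rw [h4]
    refine Prod.ext ?_ ?_
    · change ψ (proj (frameMap e₀ η (ψ.symm p.1) p.2)) = p.1
      rw [h4, ψ.right_inv hp.1]
    · change dualCoord x₀ (frameMap e₀ η (ψ.symm p.1) p.2).1 /
        dualCoord x₀ ⟨proj (frameMap e₀ η (ψ.symm p.1) p.2),
          η (proj (frameMap e₀ η (ψ.symm p.1) p.2))⟩ = p.2
      rw [h5, h2, dualCoord_smul (hx₀ h1), mul_div_cancel_right₀ _ h3]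
  open_source := ψ.open_source.preimage (contMDiff_dualProj (n := n)).continuous
  open_target := ψ.open_target.prod isOpen_compl_singleton
  contMDiffOn_toFun := by
    intro e he
    have h0 : proj e ∈ ψ.source := he
    have h1 : ContMDiffAt (dualModel n) 𝓘(ℝ, EuclideanSpace ℝ (Fin n)) ∞ (fun e => ψ (proj e)) e :=
      ContMDiffAt.comp e ((contMDiffOn_of_mem_maximalAtlas hψ).contMDiffAt
        (ψ.open_source.mem_nhds h0)) contMDiff_dualProj.contMDiffAt
    have h2 : ContMDiffAt (dualModel n) 𝓘(ℝ, ℝ) ∞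
        (fun e : puncturedDual W => dualCoord x₀ e.1) e :=
      ContMDiffAt.comp e (contMDiffAt_dualCoord (hx₀ h0)) contMDiff_subtype_val.contMDiffAt
    have h3 : ContMDiffAt (dualModel n) 𝓘(ℝ, ℝ) ∞
        (fun e : puncturedDual W => dualCoord x₀ ⟨proj e, η (proj e)⟩) e :=
      ContMDiffAt.comp e (contMDiffAt_dualCoord_section η (hx₀ h0)) contMDiff_dualProj.contMDiffAt
    exact (h1.prodMk_space (h2.div₀ h3 fun h => hη _ h0
      ((dualCoord_eq_zero (hx₀ h0)).1 h))).contMDiffWithinAt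
  contMDiffOn_invFun := by
    intro p hp
    have h0 := ψ.map_target hp.1
    have h1 : ContMDiffAt 𝓘(ℝ, EuclideanSpace ℝ (Fin n) × ℝ) (𝓡 n) ∞
        (fun p : EuclideanSpace ℝ (Fin n) × ℝ => ψ.symm p.1) p :=
      ContMDiffAt.comp p ((contMDiffOn_symm_of_mem_maximalAtlas hψ).contMDiffAt
        (ψ.open_target.mem_nhds hp.1)) contDiff_fst.contMDiff.contMDiffAt
    have h2 : ContMDiffAt 𝓘(ℝ, EuclideanSpace ℝ (Fin n) × ℝ) 𝓘(ℝ, ℝ) ∞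
        (fun p : EuclideanSpace ℝ (Fin n) × ℝ =>
          p.2 * dualCoord x₀ ⟨ψ.symm p.1, η (ψ.symm p.1)⟩) p :=
      (contDiff_snd.contMDiff.contMDiffAt).mul
        (ContMDiffAt.comp p (contMDiffAt_dualCoord_section η (hx₀ h0)) h1)
    refine ContMDiffAt.contMDiffWithinAt ?_
    rw [← ContMDiffAt.subtypeVal_comp_iff]
    have h3 : ContMDiffAt 𝓘(ℝ, EuclideanSpace ℝ (Fin n) × ℝ) (dualModel n) ∞
        (fun p : EuclideanSpace ℝ (Fin n) × ℝ =>
          (⟨ψ.symm p.1, p.2 • η (ψ.symm p.1)⟩ : TotalSpace (ℝ →L[ℝ] ℝ) (DualFiber W))) p := by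
      refine (contMDiffAt_dual_iff (f := fun p : EuclideanSpace ℝ (Fin n) × ℝ =>
          (⟨ψ.symm p.1, p.2 • η (ψ.symm p.1)⟩ : TotalSpace (ℝ →L[ℝ] ℝ) (DualFiber W)))
          (x₀ := x₀) (hx₀ h0)).2 ⟨h1, h2.congr_of_eventuallyEq ?_⟩
      filter_upwards [(ψ.open_target.prod (isOpen_compl_singleton (x := (0 : ℝ)))).mem_nhds hp]
        with r hr using dualCoord_smul (hx₀ (ψ.map_target hr.1)) _ _
    refine h3.congr_of_eventuallyEq ?_
    filter_upwards [(ψ.open_target.prod (isOpen_compl_singleton (x := (0 : ℝ)))).mem_nhds hp]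
      with r hr using frameMap_of_ne e₀ η hr.2 (hη _ (ψ.map_target hr.1))

/-- In the frame `η` with `⟨s, η⟩ = r`, every covector is `t • η`, so its pairing with `s` is `t *
r`. The neighbourhood is shrunk until this equation, the nonvanishing of `η` and the trivialization
all hold on it. -/
theorem exists_bChart [T2Space M] [SecondCountableTopology M] {Z : Set M} (hZ : IsBPair n Z)
    {s : Cₛ^∞⟮𝓡 n; ℝ, W⟯} (hs : IsBDivisor Z s) (x₀ : M) :
    ∃ B : BChart n (dualModel n) Z (proj : puncturedDual W → M) (pairing s),
      x₀ ∈ B.base.source := by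
  obtain ⟨ψ₀, hψ₀, hx₀, i, hi⟩ := hZ.exists_bCoord x₀
  obtain ⟨η, hη0, hηs⟩ := hs.exists_section hψ₀ hx₀ hi
  have hb := mem_dualBase (W := W) x₀
  have hne : ∀ᶠ y in 𝓝 x₀, η y ≠ 0 := by
    filter_upwards [(isOpen_dualBase x₀).mem_nhds hb,
      (contMDiffAt_dualCoord_section η hb).continuousAt.eventually_ne
        fun h => hη0 ((dualCoord_eq_zero hb).1 h)] with y h2 h3
    exact fun h => h3 ((dualCoord_eq_zero h2).2 h)
  obtain ⟨U, hU, hUo, hxU⟩ := eventually_nhds_iff.1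
    ((hηs.and hne).and ((isOpen_dualBase (W := W) x₀).eventually_mem hb))
  let ψ := ψ₀.restr U
  have hψ : ψ ∈ IsManifold.maximalAtlas (𝓡 n) ∞ M := restr_mem_maximalAtlas _ hψ₀ hUo
  have hsrc : ψ.source = ψ₀.source ∩ U := ψ₀.restr_source' _ hUo
  have hsub : ∀ x ∈ ψ.source, x ∈ ψ₀.source ∧ x ∈ U := fun x hx => by rwa [hsrc] at hx
  have hη : ∀ x ∈ ψ.source, η x ≠ 0 := fun x hx => (hU x (hsub x hx).2).1.2
  have hbase : ψ.source ⊆ dualBase W x₀ := fun x hx => (hU x (hsub x hx).2).2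
  have hval : ∀ x ∈ ψ.source, (η x (s x) : ℝ) = bCoord i (ψ x) :=
    fun x hx => (hU x (hsub x hx).2).1.1
  have hmul : ∀ x ∈ ψ.source, ∀ ε : DualFiber W x,
      (ε (s x) : ℝ) = dualCoord x₀ ⟨x, ε⟩ / dualCoord x₀ ⟨x, η x⟩ * bCoord i (ψ x) := by
    intro x hx ε
    rw [← hval x hx]
    conv_lhs => rw [eq_div_smul (hbase hx) (hη x hx) ε]
    rfl
  refine ⟨{
    base := chartDiffeo hψ
    total := frameDiffeo hψ η hbase hη ⟨⟨x₀, η x₀⟩, hη0⟩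
    source_eq := rfl
    target_eq := rfl
    fst_eq := fun e _ => rfl
    index := i
    mem_iff := fun x hx => hi x (hsub x hx).1
    eq_mul := fun e he => hmul (proj e) he e.1.2
    division := ?_ }, hsrc.symm.subset ⟨hx₀, hxU⟩⟩
  intro f hf
  -- Division by `r` comes from the ideal condition: `f = ⟨s, η'⟩`, and the smooth quotient is the
  -- coordinate of `η'` in the frame `η`.
  obtain ⟨η', hη'⟩ := (hs f).2 hf
  refine ⟨fun x => dualCoord x₀ ⟨x, η' x⟩ / dualCoord x₀ ⟨x, η x⟩, fun x hx => ?_,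
    fun x hx => (hη' x).trans (hmul x hx (η' x))⟩
  exact ((contMDiffAt_dualCoord_section η' (hbase hx)).div₀
    (contMDiffAt_dualCoord_section η (hbase hx))
    fun h => hη x hx ((dualCoord_eq_zero (hbase hx)).1 h)).contMDiffWithinAt

theorem contMDiff_scale (t : ℝˣ) :
    ContMDiff (dualModel n) (dualModel n) ∞ (scale t : puncturedDual W → puncturedDual W) := by
  intro e
  rw [← ContMDiffAt.subtypeVal_comp_iff]
  have hb := mem_dualBase (W := W) (proj e)
  refine (contMDiffAt_dual_iff (f := Subtype.val ∘ scale t) (x₀ := proj e) hb).2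
    ⟨contMDiff_dualProj.contMDiffAt, ?_⟩
  have h2 : ContMDiffAt (dualModel n) 𝓘(ℝ, ℝ) ∞
      (fun e' : puncturedDual W => (t : ℝ) * dualCoord (proj e) e'.1) e :=
    contMDiffAt_const.mul
      (ContMDiffAt.comp e (contMDiffAt_dualCoord hb) contMDiff_subtype_val.contMDiffAt)
  refine h2.congr_of_eventuallyEq ?_
  filter_upwards [((isOpen_dualBase (W := W) (proj e)).preimage
    (contMDiff_dualProj (n := n)).continuous).mem_nhds hb] with e' he' using dualCoord_smul he' _ _

theorem scale_inv_scale (t : ℝˣ) (e : puncturedDual W) : scale t⁻¹ (scale t e) = e := by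
  apply Subtype.ext
  change TotalSpace.mk e.1.1 (((t⁻¹ : ℝˣ) : ℝ) • (t : ℝ) • e.1.2) = e.1
  rw [smul_smul, ← Units.val_mul, inv_mul_cancel, Units.val_one, one_smul]

/-- Scaling maps the kernel of the differential of the pairing to itself. -/
theorem map_ker_mvfderiv_scale_le (s : Cₛ^∞⟮𝓡 n; ℝ, W⟯)
    (hs : ContMDiff (dualModel n) 𝓘(ℝ, ℝ) ∞ (pairing s)) (t : ℝˣ) (e : puncturedDual W)
    {w : TangentSpace (dualModel n) e} (hw : mvfderiv (dualModel n) (pairing s) e w = 0) :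
    mvfderiv (dualModel n) (pairing s) (scale t e)
      (mfderiv (dualModel n) (dualModel n) (scale t) e w) = 0 := by
  have hd : ∀ e, MDifferentiableAt (dualModel n) 𝓘(ℝ, ℝ) (pairing s) e :=
    hs.mdifferentiable (by simp)
  have h1 : mfderiv (dualModel n) 𝓘(ℝ, ℝ) (pairing s ∘ scale t) e =
      (mfderiv (dualModel n) 𝓘(ℝ, ℝ) (pairing s) (scale t e)).comp
        (mfderiv (dualModel n) (dualModel n) (scale t) e) :=
    mfderiv_comp e (hd _) ((contMDiff_scale t).mdifferentiable (by simp) e)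
  -- The pairing is linear on fibres, so scaling multiplies it by the constant `t`.
  have h2 : mfderiv (dualModel n) 𝓘(ℝ, ℝ) (pairing s ∘ scale t) e =
      (t : ℝ) • mfderiv (dualModel n) 𝓘(ℝ, ℝ) (pairing s) e :=
    ((hd e).hasMFDerivAt.const_smul (t : ℝ)).mfderiv
  have h3 := congrArg (fun A : TangentSpace (dualModel n) e →L[ℝ] ℝ => A w) (h1.symm.trans h2)
  have hw' : mfderiv (dualModel n) 𝓘(ℝ, ℝ) (pairing s) e w = (0 : ℝ) := hw
  refine h3.trans ?_
  change (t : ℝ) • (mfderiv (dualModel n) 𝓘(ℝ, ℝ) (pairing s) e w : ℝ) = 0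
  rw [hw']
  exact mul_zero (t : ℝ)

theorem map_ker_mvfderiv_scale (s : Cₛ^∞⟮𝓡 n; ℝ, W⟯)
    (hs : ContMDiff (dualModel n) 𝓘(ℝ, ℝ) ∞ (pairing s)) (t : ℝˣ) (e : puncturedDual W) :
    (LinearMap.ker (mvfderiv (dualModel n) (pairing s) e).toLinearMap).map
        (mfderiv (dualModel n) (dualModel n) (scale t) e).toLinearMap =
      LinearMap.ker (mvfderiv (dualModel n) (pairing s) (scale t e)).toLinearMap := by
  refine le_antisymm ?_ fun v hv => ?_
  · rintro _ ⟨w, hw, rfl⟩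
    exact map_ker_mvfderiv_scale_le s hs t e hw
  -- The reverse inclusion pushes `v` forward by scaling with `t⁻¹`. It is stated at a general `e'`,
  -- so that the base point `scale t⁻¹ (scale t e)` is identified with `e` only at the end.
  · have key : ∀ (e' : puncturedDual W) (v : TangentSpace (dualModel n) e'),
        mvfderiv (dualModel n) (pairing s) e' v = 0 →
        ∃ w : TangentSpace (dualModel n) (scale t⁻¹ e'),
          mvfderiv (dualModel n) (pairing s) (scale t⁻¹ e') w = 0 ∧
          (mfderiv (dualModel n) (dualModel n) (scale t) (scale t⁻¹ e') w :
            EuclideanSpace ℝ (Fin n) × (ℝ →L[ℝ] ℝ)) = v := by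
      intro e' v hv
      refine ⟨_, map_ker_mvfderiv_scale_le s hs t⁻¹ e' hv, ?_⟩
      have hinv : scale t ∘ scale t⁻¹ = (id : puncturedDual W → puncturedDual W) := by
        funext e''
        have := scale_inv_scale t⁻¹ e''
        rwa [inv_inv] at this
      have h2 := mfderiv_comp (I'' := dualModel n) e'
        ((contMDiff_scale (n := n) t).mdifferentiable (by simp) (scale t⁻¹ e'))
        ((contMDiff_scale (n := n) t⁻¹).mdifferentiable (by simp) e')
      rw [hinv, mfderiv_id] at h2
      exact (congrArg (fun A : (EuclideanSpace ℝ (Fin n) × (ℝ →L[ℝ] ℝ)) →L[ℝ]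
        (EuclideanSpace ℝ (Fin n) × (ℝ →L[ℝ] ℝ)) => A v) h2).symm
    have h1 := key (scale t e) v hv
    rw [scale_inv_scale] at h1
    exact h1

end DualCharts

end BGeometry

end

theorem mainTheorem7 {n : ℕ} {M : Type u} [TopologicalSpace M] [T2Space M]
    [SecondCountableTopology M] [ChartedSpace (EuclideanSpace ℝ (Fin n)) M] [IsManifold (𝓡 n) ∞ M]
    {W : M → Type v} [∀ x, AddCommGroup (W x)] [∀ x, Module ℝ (W x)] [∀ x, TopologicalSpace (W x)]
    [TopologicalSpace (TotalSpace ℝ W)] [FiberBundle ℝ W] [VectorBundle ℝ ℝ W]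
    [ContMDiffVectorBundle ∞ ℝ W (𝓡 n)]
    (Z : Set M) (hZ : BGeometry.IsBPair n Z)
    (s : Cₛ^∞⟮𝓡 n; ℝ, W⟯) (hs : BGeometry.IsBDivisor Z s) :
    ∃ F : BGeometry.Foliation (BGeometry.dualModel n) (BGeometry.puncturedDual W) n,
      -- the foliation by the level sets of `φ`
      (∀ e, F.tangent e =
        LinearMap.ker (mvfderiv (BGeometry.dualModel n) (BGeometry.pairing s) e).toLinearMap) ∧
      (∀ S : Set (BGeometry.puncturedDual W), F.IsLeafSet S ↔
        ∃ e, S = connectedComponentIn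
          {e' | BGeometry.pairing s e' = BGeometry.pairing s e} e) ∧
      F.Coorientable ∧
      (∀ t : ℝˣ, F.InvariantUnder (BGeometry.scale t)) ∧
      -- the components of the preimage of `Z` are leaves
      (∀ e, BGeometry.proj e ∈ Z →
        F.IsLeafSet (connectedComponentIn (BGeometry.proj ⁻¹' Z) e)) ∧
      -- the other leaves are diffeomorphic to components of the complement of `Z`
      (∀ L : F.IntegralManifold, L.IsLeaf →
        (¬ ∃ e, BGeometry.proj e ∈ Z ∧
          range L.incl = connectedComponentIn (BGeometry.proj ⁻¹' Z) e) →
        ∃ C : TopologicalSpace.Opens M,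
          (∃ x ∈ Zᶜ, (C : Set M) = connectedComponentIn Zᶜ x) ∧
          Nonempty (L.carrier ≃ₘ^∞⟮𝓡 n, 𝓡 n⟯ C)) ∧
      -- the Lie algebroid submersion onto the b-tangent bundle, covering the projection
      (∃ Ψ : ∀ e : BGeometry.puncturedDual W,
          F.tangent e →ₗ[ℝ] BGeometry.BTangent n Z (BGeometry.proj e),
        BGeometry.IsLieAlgebroidSubmersion F Z BGeometry.proj Ψ) := by
  have hB := BGeometry.exists_bChart (W := W) hZ hs
  have hst := BGeometry.isStraightenable_of_bChart hB
  refine ⟨BGeometry.levelFoliation hst, fun _ => rfl, BGeometry.levelFoliation_isLeafSet_iff hst,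
    BGeometry.levelFoliation_coorientable hst,
    fun t e => BGeometry.map_ker_mvfderiv_scale s hst.contMDiff t e, fun e he => ?_,
    fun L hL hLZ => BGeometry.exists_leaf_diffeomorph hB hZ.isClosed L hL hLZ,
    BGeometry.exists_lieAlgebroidSubmersion hB⟩
  rw [BGeometry.levelFoliation_isLeafSet_iff]
  have hpre := BGeometry.preimage_eq_level_zero hB
  have he0 : BGeometry.pairing s e = 0 := hpre.subset he
  exact ⟨e, by rw [hpre, he0]⟩
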